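/- **Setting.** A *scale* on a Banach space $E=E_0$ is a decreasing sequence of Banach spaces $(E_m,\|\cdot\|_m)_{m\ge 0}$ with compact inclusions $E_{m+1}\subset E_m$ and with $\bigcap_i E_i$ dense in every $E_m$; $\mathbb R^n$ carries the constant scale, direct sums are formed levelwise, $E^i$ is the scale $(E_{m+i})_m$, and for $U\subset E$ we put $U_m=U\cap E_m$ and $TU=U^1\oplus E$ (with levels $U_{m+1}\oplus E_m$). A map $f:U\to F$ on an open set $U\subset E$ is sc$^0$ if it restricts to continuous maps $U_m\to F_m$ for all $m$. It is sc$^1$ if it is sc$^0$, if for every $x\in U_1$ there is a bounded operator $Df(x):E_0\to F_0$ with $\|f(x+h)-f(x)-Df(x)h\|_0/\|h\|_1\to 0$ as $\|h\|_1\to 0$, and if $Tf(x,h)=(f(x),Df(x)h)$, $Tf:TU\to TF$, is sc$^0$. It is sc$^{k+1}$ if it is sc$^1$ and $Tf$ is sc$^{k}$, and sc-smooth if it is sc$^k$ for all $k$. An sc-smooth retract is $X=r(U)$ with $r:U\to U$ sc-smooth and $r\circ r=r$; it is an M-polyfold with one global chart. Put $X_m=X\cap E_m$ and $T_xX=\operatorname{im}Dr(x)\subset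 E_0$ for $x\in X_1$ (with norm $\|\cdot\|_0$ and the scale induced from $E$), $TX=Tr(TU)$. A map on $X$ (respectively on $X^1$, $TX$, $TX\oplus TX$) is sc-smooth if its composition with the retraction $r$ (respectively with the retraction induced by $r$ and $Dr$) is. $X$ is even-dimensional if every $T_xX$, $x\in X_1$, has even or infinite dimension. **The M-polyfolds $\Gamma_n^k$.** Let $n,k\ge 0$ be integers, let $(\delta_m)_{m\ge0}$ be strictly increasing real numbers with $\delta_0=0$, let $\beta:\mathbb R\to[-1,1]$ be smooth and odd with $\beta(s)=1$ for $s\ge1$, and let $\gamma_1,\dots,\gamma_k\in C_c^\infty(\mathbb R)$ be orthonormal in $L^2(\mathbb R)$. Give $L^2(\mathbb R)$ the scale $$E_m=W^{m,\delta_m}=\Big\{f:\ \|f\|_m^2=\int_{\mathbb R}\sum_{j=0}^m|D^jf(s)|^2e^{\delta_m s\beta(s)}\,ds<\infty\Big\}$$ with weak derivatives $D^jf$. Let $\pi_t=0$ for $t\le 0$, let $\pi_t f=\sum_{j=1}^k\langle f,\gamma_j(\cdot+e^{1/t})\rangle_{L^2}\,\gamma_j(\cdot+e^{1/t})$ for $t>0$,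 and let $$r(x,t,f)=(x,t,\pi_tf)\quad\text{on }\mathbb R^n\oplus\mathbb R\oplus L^2(\mathbb R),\qquad X=\Gamma_n^k=r(\mathbb R^n\oplus\mathbb R\oplus L^2(\mathbb R)).$$ **Theorem.** The map $r$ is an sc-smooth retraction. If $X=\Gamma_n^k$ is even-dimensional (equivalently, $n$ is odd and $k$ is even), then there exist on $X$ 1. an almost complex structure $J$: an sc-smooth map $J:TX\to TX$ that restricts to sc-continuous linear maps $J_x:T_xX\to T_xX$ with $J_x^2=-\mathrm{id}$ for all $x\in X_1$; 2. a strong Riemannian metric $g$: an sc-smooth map $g:TX\oplus TX\to\mathbb R$ that is bilinear, sc-continuous, symmetric and positive definite on every $T_xX$, $x\in X_1$, and such that $v\mapsto g_x(v,\cdot)$ is a topological isomorphism from $T_xX$ onto its continuous dual $(T_xX)^*$; such that $g$ is compatible with $J$, i.e. $g_x(J_xv,J_xw)=g_x(v,w)$ for all $x\in X_1$ and $v,w\in T_xX$, and such that the fundamental form $\omega_x(v,w)=g_x(J_xv,w)$ is a strong symplectic form: it is an sc-smooth alternating $2$-form, $v\mapsto\omega_x(v,\cdot)$ is a topological isomorphism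 $T_xX\to(T_xX)^*$ for every $x\in X_1$, and $d\omega=0$. The last condition means that for all sc-smooth vector fields $\mu_0,\mu_1,\mu_2$ on $X$ (sc-smooth sections $X^1\to TX$) one has, at every point of $X_2$, $$\begin{aligned}0=d\omega(\mu_0,\mu_1,\mu_2)={}&D(\omega(\mu_1,\mu_2))\mu_0-D(\omega(\mu_0,\mu_2))\mu_1+D(\omega(\mu_0,\mu_1))\mu_2\\&-\omega([\mu_0,\mu_1],\mu_2)+\omega([\mu_0,\mu_2],\mu_1)-\omega([\mu_1,\mu_2],\mu_0),\end{aligned}$$ where $[\mu,\nu]=D\nu\,\mu-D\mu\,\nu$ is the commutator bracket. -/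

import Mathlib

open MeasureTheory
open scoped ENNReal NNReal

noncomputable section

/-! ## Scales of normed spaces -/

/-- A scale of normed spaces inside a real vector space `E`: for every `m`, an extended norm
`‖x‖ₘ ∈ [0,∞]`.  The `m`-th level is `Eₘ = {x | ‖x‖ₘ < ∞}`, normed by `‖·‖ₘ`, and the inclusion
`Eₘ₊₁ ⊆ Eₘ` is bounded.  The underlying space of the scale is `E₀`; the ambient vector space `E`
is allowed to be larger, so that `E¹` (the scale with levels `Eₘ₊₁`) lives in the same ambient
space. -/
structure ScScale (E : Type*) [AddCommGroup E] [Module ℝ E] where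
  nrm : ℕ → E → ℝ≥0∞
  nrm_add_le : ∀ m x y, nrm m (x + y) ≤ nrm m x + nrm m y
  nrm_smul : ∀ m (c : ℝ) x, nrm m (c • x) = ‖c‖ₑ * nrm m x
  eq_zero_of_nrm : ∀ m x, nrm m x = 0 → x = 0
  nrm_le_succ : ∀ m, ∃ C : ℝ≥0, ∀ x, nrm m x ≤ C * nrm (m + 1) x

namespace ScScale

variable {E F : Type*} [AddCommGroup E] [Module ℝ E] [AddCommGroup F] [Module ℝ F]

theorem nrm_zero (S : ScScale E) (m : ℕ) : S.nrm m 0 = 0 := by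
  have := S.nrm_smul m 0 0
  simpa using this

/-- The level `Eₘ`. -/
def level (S : ScScale E) (m : ℕ) : Submodule ℝ E where
  carrier := {x | S.nrm m x < ∞}
  add_mem' {x y} hx hy := (S.nrm_add_le m x y).trans_lt (ENNReal.add_lt_top.2 ⟨hx, hy⟩)
  zero_mem' := (S.nrm_zero m).trans_lt ENNReal.zero_lt_top
  smul_mem' c x hx := by
    change S.nrm m (c • x) < ∞
    rw [nrm_smul]
    exact ENNReal.mul_lt_top (by simp) hx

/-- The scale `E¹`, with levels `(E¹)ₘ = Eₘ₊₁`. -/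
def shift (S : ScScale E) : ScScale E where
  nrm m x := S.nrm (m + 1) x
  nrm_add_le m := S.nrm_add_le (m + 1)
  nrm_smul m := S.nrm_smul (m + 1)
  eq_zero_of_nrm m := S.eq_zero_of_nrm (m + 1)
  nrm_le_succ m := S.nrm_le_succ (m + 1)

/-- The direct sum `E ⊕ F`, with levels `Eₘ ⊕ Fₘ`. -/
def prod (S : ScScale E) (T : ScScale F) : ScScale (E × F) where
  nrm m p := max (S.nrm m p.1) (T.nrm m p.2)
  nrm_add_le m x y := by
    apply max_le
    · exact (S.nrm_add_le m _ _).trans (add_le_add (le_max_left _ _) (le_max_left _ _))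
    · exact (T.nrm_add_le m _ _).trans (add_le_add (le_max_right _ _) (le_max_right _ _))
  nrm_smul m c x := by
    simp only [Prod.smul_fst, Prod.smul_snd, nrm_smul]
    exact (mul_right_mono (a := ‖c‖ₑ)).map_max.symm
  eq_zero_of_nrm m x h := by
    have h' := max_eq_bot.1 h
    exact Prod.ext (S.eq_zero_of_nrm m _ h'.1) (T.eq_zero_of_nrm m _ h'.2)
  nrm_le_succ m := by
    obtain ⟨C, hC⟩ := S.nrm_le_succ m
    obtain ⟨D, hD⟩ := T.nrm_le_succ m
    refine ⟨max C D, fun x => max_le ((hC _).trans ?_) ((hD _).trans ?_)⟩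
    · exact mul_le_mul' (by exact_mod_cast le_max_left _ _) (le_max_left _ _)
    · exact mul_le_mul' (by exact_mod_cast le_max_right _ _) (le_max_right _ _)

/-- The constant scale on a normed space. -/
def const (V : Type*) [NormedAddCommGroup V] [NormedSpace ℝ V] : ScScale V where
  nrm _ x := ‖x‖ₑ
  nrm_add_le _ x y := enorm_add_le x y
  nrm_smul _ c x := enorm_smul c x
  eq_zero_of_nrm _ x h := by simpa using h
  nrm_le_succ _ := ⟨1, fun x => by simp⟩

/-- The scale `TE = E¹ ⊕ E`. -/
def tangent (S : ScScale E) : ScScale (E × E) := S.shift.prod S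

/-- The tangent set `TU = U¹ ⊕ E` of `U ⊆ E`. -/
def tangentSet (S : ScScale E) (U : Set E) : Set (E × E) :=
  {p | p.1 ∈ U ∧ p.1 ∈ S.level 1 ∧ p.2 ∈ S.level 0}

end ScScale

/-! ## Scale calculus -/

section Calculus

variable {E F : Type*} [AddCommGroup E] [Module ℝ E] [AddCommGroup F] [Module ℝ F]

/-- `f` is of class sc⁰ on `U`: with `Uₘ = U ∩ Eₘ`, it maps `Uₘ` to `Fₘ`, continuously for the
`m`-th norms, for all `m`. -/
def IsScZero (S : ScScale E) (T : ScScale F) (U : Set E) (f : E → F) : Prop :=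
  ∀ m : ℕ, ∀ x ∈ U, x ∈ S.level m →
    f x ∈ T.level m ∧
    ∀ ε : ℝ≥0∞, 0 < ε → ∃ δ : ℝ≥0∞, 0 < δ ∧
      ∀ y ∈ U, S.nrm m (y - x) < δ → T.nrm m (f y - f x) < ε

/-- `A` restricts to a bounded operator `E₀ → F₀`, and
`‖f (x + h) - f x - A h‖₀ / ‖h‖₁ → 0` as `‖h‖₁ → 0`, `h ∈ E₁`, `x + h ∈ U`.
Only the restriction of `A` to `E₀` is meaningful. -/
def IsScDerivAt (S : ScScale E) (T : ScScale F) (U : Set E) (f : E → F) (x : E)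
    (A : E →ₗ[ℝ] F) : Prop :=
  (∃ C : ℝ≥0, ∀ h ∈ S.level 0, T.nrm 0 (A h) ≤ C * S.nrm 0 h) ∧
  ∀ ε : ℝ≥0, 0 < ε → ∃ δ : ℝ≥0, 0 < δ ∧
    ∀ h : E, S.nrm 1 h ≤ δ → x + h ∈ U →
      T.nrm 0 (f (x + h) - f x - A h) ≤ ε * S.nrm 1 h

open Classical in
/-- The linearization `Df(x)` (zero if there is none). -/
def scDeriv (S : ScScale E) (T : ScScale F) (U : Set E) (f : E → F) (x : E) : E →ₗ[ℝ] F :=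
  if h : ∃ A : E →ₗ[ℝ] F, IsScDerivAt S T U f x A then h.choose else 0

/-- `f` is of class scᵏ on `U`: it is sc⁰, and if `k ≥ 1` it has linearizations at all points of
`U₁` and the tangent map `Tf(x,h) = (f(x), Df(x)h)` is of class scᵏ⁻¹ on `TU`. -/
def IsSc : ℕ → ∀ {E F : Type*} [AddCommGroup E] [Module ℝ E] [AddCommGroup F] [Module ℝ F],
    ScScale E → ScScale F → Set E → (E → F) → Prop
  | 0, _, _, _, _, _, _, S, T, U, f => IsScZero S T U f
  | k + 1, E, F, _, _, _, _, S, T, U, f =>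
      IsScZero S T U f ∧
      ∃ Df : E → E →ₗ[ℝ] F,
        (∀ x ∈ U, x ∈ S.level 1 → IsScDerivAt S T U f x (Df x)) ∧
        IsSc k S.tangent T.tangent (S.tangentSet U) (fun p => (f p.1, Df p.1 p.2))

/-- sc-smooth maps. -/
def IsScSmooth (S : ScScale E) (T : ScScale F) (U : Set E) (f : E → F) : Prop :=
  ∀ k : ℕ, IsSc k S T U f

end Calculus

/-! ## Retracts, as M-polyfolds with one global chart -/

/-- The data of a retract `O = r(U)` in a scale `E` (without boundary: the partial quadrant is
all of `E`).  `IsScSmoothRetract` below says that it is an sc-smooth retract.  `O` is regarded as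
the M-polyfold with the atlas generated by the identity chart. -/
structure ScRetract (E : Type*) [AddCommGroup E] [Module ℝ E] where
  scale : ScScale E
  U : Set E
  r : E → E

namespace ScRetract

variable {E F : Type*} [AddCommGroup E] [Module ℝ E] [AddCommGroup F] [Module ℝ F]

/-- `U` is open in `E₀`, and `r` is an sc-smooth map `U → U` with `r ∘ r = r`. -/
def IsScSmoothRetract (X : ScRetract E) : Prop :=
  (∀ x ∈ X.U, x ∈ X.scale.level 0) ∧
  (∀ x ∈ X.U, ∃ ε : ℝ≥0∞, 0 < ε ∧ ∀ y, X.scale.nrm 0 (y - x) < ε → y ∈ X.U) ∧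
  (∀ x ∈ X.U, X.r x ∈ X.U) ∧
  (∀ x ∈ X.U, X.r (X.r x) = X.r x) ∧
  IsScSmooth X.scale X.scale X.U X.r

/-- The set `Xₘ` of points of regularity `m`. -/
def pts (X : ScRetract E) (m : ℕ) : Set E := {x | x ∈ X.r '' X.U ∧ x ∈ X.scale.level m}

/-- `f` (of which only the values on the retract matter) is sc-smooth on the retract. -/
def SmoothOn (X : ScRetract E) (T : ScScale F) (f : E → F) : Prop :=
  IsScSmooth X.scale T X.U (fun x => f (X.r x))

/-- The differential at `p` of a map on the retract, meaningful on the tangent space at `p`. -/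
def deriv (X : ScRetract E) (T : ScScale F) (f : E → F) (p : E) : E →ₗ[ℝ] F :=
  scDeriv X.scale T X.U (fun x => f (X.r x)) p

/-- The linearization `Dr(x)` of the retraction. -/
def Dr (X : ScRetract E) (x : E) : E →ₗ[ℝ] E := scDeriv X.scale X.scale X.U X.r x

/-- The retract `X¹`. -/
def shift (X : ScRetract E) : ScRetract E where
  scale := X.scale.shift
  U := {x | x ∈ X.U ∧ x ∈ X.scale.level 1}
  r := X.r

/-- The tangent bundle `TX`, the retract of `TU` with retraction `Tr`. -/
def tangent (X : ScRetract E) : ScRetract (E × E) where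
  scale := X.scale.tangent
  U := X.scale.tangentSet X.U
  r p := (X.r p.1, X.Dr p.1 p.2)

/-- The Whitney sum `TX ⊕ TX`, as a retract of `U¹ ⊕ E ⊕ E`. -/
def whitney (X : ScRetract E) : ScRetract (E × E × E) where
  scale := X.scale.shift.prod (X.scale.prod X.scale)
  U := {p | p.1 ∈ X.U ∧ p.1 ∈ X.scale.level 1 ∧
    p.2.1 ∈ X.scale.level 0 ∧ p.2.2 ∈ X.scale.level 0}
  r p := (X.r p.1, X.Dr p.1 p.2.1, X.Dr p.1 p.2.2)

/-- The tangent space `TₓX = Dr(x)(E₀)` at `x ∈ X₁`. -/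
def tangentSpace (X : ScRetract E) (x : E) : Submodule ℝ E :=
  (X.scale.level 0).map (X.Dr x)

theorem tangentSpace_le (X : ScRetract E) (x : E) : X.tangentSpace x ≤ X.scale.level 0 := by
  rintro _ ⟨h, hh, rfl⟩
  unfold Dr scDeriv
  split_ifs with hA
  · obtain ⟨⟨C, hC⟩, -⟩ := hA.choose_spec
    exact (hC h hh).trans_lt (ENNReal.mul_lt_top ENNReal.coe_lt_top (show X.scale.nrm 0 h < ∞ from hh))
  · exact Submodule.zero_mem _

/-- The tangent space as a normed space, with the norm `‖·‖₀`. -/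
def TanSp (X : ScRetract E) (x : E) : Type _ := ↥(X.tangentSpace x)

instance (X : ScRetract E) (x : E) : AddCommGroup (X.TanSp x) :=
  inferInstanceAs (AddCommGroup ↥(X.tangentSpace x))

instance (X : ScRetract E) (x : E) : Module ℝ (X.TanSp x) :=
  inferInstanceAs (Module ℝ ↥(X.tangentSpace x))

/-- The inclusion `TₓX → E`. -/
def incl (X : ScRetract E) (x : E) : X.TanSp x →ₗ[ℝ] E := (X.tangentSpace x).subtype

theorem incl_mem (X : ScRetract E) (x : E) (v : X.TanSp x) :
    X.incl x v ∈ X.scale.level 0 := X.tangentSpace_le x (Subtype.prop (p := (· ∈ X.tangentSpace x)) v)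

instance (X : ScRetract E) (x : E) : Norm (X.TanSp x) :=
  ⟨fun v => (X.scale.nrm 0 (X.incl x v)).toReal⟩

theorem tanSp_core (X : ScRetract E) (x : E) : NormedSpace.Core ℝ (X.TanSp x) where
  norm_nonneg _ := ENNReal.toReal_nonneg
  norm_smul c v := by
    change (X.scale.nrm 0 (X.incl x (c • v))).toReal = _ * (X.scale.nrm 0 (X.incl x v)).toReal
    rw [map_smul, X.scale.nrm_smul, ENNReal.toReal_mul]
    simp
  norm_triangle v w := by
    change (X.scale.nrm 0 (X.incl x (v + w))).toReal ≤
      (X.scale.nrm 0 (X.incl x v)).toReal + (X.scale.nrm 0 (X.incl x w)).toReal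
    have hv : X.scale.nrm 0 (X.incl x v) < ∞ := X.incl_mem x v
    have hw : X.scale.nrm 0 (X.incl x w) < ∞ := X.incl_mem x w
    rw [← ENNReal.toReal_add hv.ne hw.ne, map_add]
    exact ENNReal.toReal_mono (ENNReal.add_lt_top.2 ⟨hv, hw⟩).ne (X.scale.nrm_add_le _ _ _)
  norm_eq_zero_iff v := by
    change (X.scale.nrm 0 (X.incl x v)).toReal = 0 ↔ _
    have hv : X.scale.nrm 0 (X.incl x v) < ∞ := X.incl_mem x v
    rw [ENNReal.toReal_eq_zero_iff]
    constructor
    · rintro (h | h)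
      · exact Submodule.subtype_injective (X.tangentSpace x)
          ((X.scale.eq_zero_of_nrm 0 _ h).trans (map_zero (X.incl x)).symm)
      · exact absurd h hv.ne
    · rintro rfl
      left
      rw [map_zero, X.scale.nrm_zero]

instance (X : ScRetract E) (x : E) : NormedAddCommGroup (X.TanSp x) :=
  NormedAddCommGroup.ofCore (X.tanSp_core x)

instance (X : ScRetract E) (x : E) : NormedSpace ℝ (X.TanSp x) :=
  NormedSpace.ofCore (X.tanSp_core x)

/-- Every tangent space is infinite-dimensional or of even dimension. -/
def IsEvenDimensional (X : ScRetract E) : Prop :=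
  ∀ x ∈ X.pts 1, FiniteDimensional ℝ (X.TanSp x) → Even (Module.finrank ℝ (X.TanSp x))

/-! ### Vector fields, tensor fields, forms

A fibrewise linear map is given by linear maps of the ambient space, of which only the
restrictions to the tangent spaces matter. -/

/-- sc-smooth vector fields, i.e. sc-smooth sections `X¹ → TX`, `x ↦ (x, μ x)`. -/
def IsVectorField (X : ScRetract E) (μ : E → E) : Prop :=
  (∀ x ∈ X.pts 1, μ x ∈ X.tangentSpace x) ∧
  X.shift.SmoothOn X.scale.tangent (fun x => (x, μ x))

/-- Almost complex structures: sc-smooth `(1,1)`-tensor fields `J : TX → TX` with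
`J² = -id`. -/
def IsAlmostComplex (X : ScRetract E) (J : E → E →ₗ[ℝ] E) : Prop :=
  X.tangent.SmoothOn X.scale.tangent (fun p => (p.1, J p.1 p.2)) ∧
  ∀ x ∈ X.pts 1,
    (∀ v ∈ X.tangentSpace x, J x v ∈ X.tangentSpace x) ∧
    IsScZero X.scale X.scale (X.tangentSpace x) (J x) ∧
    ∀ v ∈ X.tangentSpace x, J x (J x v) = -v

/-- `(0,2)`-tensor fields: sc-smooth maps `TX ⊕ TX → ℝ` that are bilinear and sc-continuous on
the fibres. -/
def IsTensorField02 (X : ScRetract E) (B : E → E →ₗ[ℝ] E →ₗ[ℝ] ℝ) : Prop :=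
  X.whitney.SmoothOn (ScScale.const ℝ) (fun p => B p.1 p.2.1 p.2.2) ∧
  ∀ x ∈ X.pts 1, IsScZero (X.scale.prod X.scale) (ScScale.const ℝ)
    ((X.tangentSpace x : Set E) ×ˢ (X.tangentSpace x : Set E)) (fun p => B x p.1 p.2)

/-- For every `x ∈ X₁`, `v ↦ B x v ·` is a topological vector space isomorphism from `TₓX` onto
its continuous dual. -/
def IsStronglyNondegenerate (X : ScRetract E) (B : E → E →ₗ[ℝ] E →ₗ[ℝ] ℝ) : Prop :=
  ∀ x ∈ X.pts 1, ∃ Φ : X.TanSp x ≃L[ℝ] (X.TanSp x →L[ℝ] ℝ),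
    ∀ v w : X.TanSp x, Φ v w = B x (X.incl x v) (X.incl x w)

/-- Strong Riemannian metrics. -/
def IsStrongRiemannianMetric (X : ScRetract E) (g : E → E →ₗ[ℝ] E →ₗ[ℝ] ℝ) : Prop :=
  X.IsTensorField02 g ∧
  (∀ x ∈ X.pts 1, ∀ v ∈ X.tangentSpace x, ∀ w ∈ X.tangentSpace x, g x v w = g x w v) ∧
  X.IsStronglyNondegenerate g ∧
  (∀ x ∈ X.pts 1, ∀ v ∈ X.tangentSpace x, v ≠ 0 → 0 < g x v v)

/-- `g` is compatible with `J`: `g(Jv, Jw) = g(v, w)`. -/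
def IsCompatible (X : ScRetract E) (J : E → E →ₗ[ℝ] E) (g : E → E →ₗ[ℝ] E →ₗ[ℝ] ℝ) : Prop :=
  ∀ x ∈ X.pts 1, ∀ v ∈ X.tangentSpace x, ∀ w ∈ X.tangentSpace x,
    g x v w = g x (J x v) (J x w)

/-- sc-differential 2-forms. -/
def IsTwoForm (X : ScRetract E) (ω : E → E →ₗ[ℝ] E →ₗ[ℝ] ℝ) : Prop :=
  X.whitney.SmoothOn (ScScale.const ℝ) (fun p => ω p.1 p.2.1 p.2.2) ∧
  ∀ x ∈ X.pts 1, ∀ v ∈ X.tangentSpace x, ω x v v = 0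

/-- The Lie bracket `[μ, ν](p) = Dν(p) μ(p) - Dμ(p) ν(p)`, `p ∈ X₂`, of vector fields
`X¹ → TX`; with this sign it is the commutator of derivations. -/
def lieBracket (X : ScRetract E) (μ ν : E → E) (p : E) : E :=
  X.shift.deriv X.scale ν p (μ p) - X.shift.deriv X.scale μ p (ν p)

/-- The value `dω(μ₀, μ₁, μ₂)(p)`, `p ∈ X₂`, of the exterior derivative of a 2-form. -/
def extDeriv (X : ScRetract E) (ω : E → E →ₗ[ℝ] E →ₗ[ℝ] ℝ) (μ₀ μ₁ μ₂ : E → E) (p : E) : ℝ :=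
  X.shift.deriv (ScScale.const ℝ) (fun x => ω x (μ₁ x) (μ₂ x)) p (μ₀ p)
  - X.shift.deriv (ScScale.const ℝ) (fun x => ω x (μ₀ x) (μ₂ x)) p (μ₁ p)
  + X.shift.deriv (ScScale.const ℝ) (fun x => ω x (μ₀ x) (μ₁ x)) p (μ₂ p)
  - ω p (X.lieBracket μ₀ μ₁ p) (μ₂ p)
  + ω p (X.lieBracket μ₀ μ₂ p) (μ₁ p)
  - ω p (X.lieBracket μ₁ μ₂ p) (μ₀ p)

/-- `dω = 0`. -/
def IsClosedForm (X : ScRetract E) (ω : E → E →ₗ[ℝ] E →ₗ[ℝ] ℝ) : Prop :=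
  ∀ μ₀ μ₁ μ₂ : E → E, X.IsVectorField μ₀ → X.IsVectorField μ₁ → X.IsVectorField μ₂ →
    ∀ p ∈ X.pts 2, X.extDeriv ω μ₀ μ₁ μ₂ p = 0

/-- Strong symplectic forms. -/
def IsStrongSymplecticForm (X : ScRetract E) (ω : E → E →ₗ[ℝ] E →ₗ[ℝ] ℝ) : Prop :=
  X.IsTwoForm ω ∧ X.IsClosedForm ω ∧ X.IsStronglyNondegenerate ω

end ScRetract

/-- The fundamental form `ω(v, w) = g(Jv, w)`. -/
def fundamentalForm {E : Type*} [AddCommGroup E] [Module ℝ E] (J : E → E →ₗ[ℝ] E)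
    (g : E → E →ₗ[ℝ] E →ₗ[ℝ] ℝ) : E → E →ₗ[ℝ] E →ₗ[ℝ] ℝ :=
  fun x => (g x).comp (J x)

/-! ## Weighted Sobolev spaces on the real line -/

/-- `g` is the `j`-th weak derivative of `f`. -/
def IsWeakDeriv (j : ℕ) (f g : ℝ → ℝ) : Prop :=
  LocallyIntegrable g ∧ ∀ φ : ℝ → ℝ, ContDiff ℝ (⊤ : ℕ∞) φ → HasCompactSupport φ →
    ∫ s, f s * iteratedDeriv j φ s = (-1) ^ j * ∫ s, g s * φ s

/-- The choices in the construction of `Γₙᵏ`: the exponents `δₘ`, the function `β` and the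
orthonormal functions `γ₁, …, γₖ`. -/
structure GammaData (k : ℕ) where
  δ : ℕ → ℝ
  δ_strictMono : StrictMono δ
  δ_zero : δ 0 = 0
  β : ℝ → ℝ
  β_smooth : ContDiff ℝ (⊤ : ℕ∞) β
  β_odd : ∀ s, β (-s) = -β s
  β_abs_le : ∀ s, |β s| ≤ 1
  β_one : ∀ s, 1 ≤ s → β s = 1
  γ : Fin k → ℝ → ℝ
  γ_smooth : ∀ j, ContDiff ℝ (⊤ : ℕ∞) (γ j)
  γ_compact : ∀ j, HasCompactSupport (γ j)
  γ_orthonormal : ∀ i j, ∫ s, γ i s * γ j s = if i = j then 1 else 0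

namespace GammaData

variable {k : ℕ}

/-- The weight `e^{δₘ s β(s)}`. -/
def weight (D : GammaData k) (m : ℕ) (s : ℝ) : ℝ≥0∞ :=
  ENNReal.ofReal (Real.exp (D.δ m * s * D.β s))

/-- `(∫ (|g₀|² + … + |gₘ|²) e^{δₘ s β(s)} ds)^{1/2}`. -/
def weightedNorm (D : GammaData k) (m : ℕ) (g : ℕ → ℝ → ℝ) : ℝ≥0∞ :=
  (∫⁻ s, (∑ j ∈ Finset.range (m + 1), ‖g j s‖ₑ ^ 2) * D.weight m s) ^ (1 / 2 : ℝ)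

/-- The norm of `f` in `W^{m,δₘ}`, which is `∞` if `f ∉ W^{m,δₘ}`.  Weak derivatives are unique up
to null sets, so that the infimum is over at most one value. -/
def sobolevNorm (D : GammaData k) (m : ℕ) (f : Lp ℝ 2 (volume : Measure ℝ)) : ℝ≥0∞ :=
  ⨅ (g : ℕ → ℝ → ℝ) (_ : ∀ j ≤ m, IsWeakDeriv j f (g j)), D.weightedNorm m g

theorem measurable_weight (D : GammaData k) (m : ℕ) : Measurable (D.weight m) := by
  have := D.β_smooth.continuous.measurable
  unfold weight
  fun_prop

theorem weightedNorm_eq (D : GammaData k) (m : ℕ) (g : ℕ → ℝ → ℝ) :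
    D.weightedNorm m g = (∫⁻ s, ((∑ j ∈ Finset.range (m + 1), ‖g j s‖ₑ ^ (2 : ℝ)) ^ (1 / 2 : ℝ)
      * D.weight m s ^ (1 / 2 : ℝ)) ^ (2 : ℝ)) ^ (1 / 2 : ℝ) := by
  unfold weightedNorm
  congr 2 with s
  rw [ENNReal.mul_rpow_of_nonneg _ _ (by norm_num), ← ENNReal.rpow_mul, ← ENNReal.rpow_mul]
  norm_num

theorem weightedNorm_add_le (D : GammaData k) (m : ℕ) (g h : ℕ → ℝ → ℝ)
    (hg : ∀ j ≤ m, AEMeasurable (g j)) (hh : ∀ j ≤ m, AEMeasurable (h j)) :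
    D.weightedNorm m (g + h) ≤ D.weightedNorm m g + D.weightedNorm m h := by
  have key : ∀ u : ℕ → ℝ → ℝ, (∀ j ≤ m, AEMeasurable (u j)) → AEMeasurable (fun s =>
      (∑ j ∈ Finset.range (m + 1), ‖u j s‖ₑ ^ (2 : ℝ)) ^ (1 / 2 : ℝ)
        * D.weight m s ^ (1 / 2 : ℝ)) := by
    intro u hu
    refine AEMeasurable.mul (AEMeasurable.pow_const (Finset.aemeasurable_fun_sum _ fun j hj => ?_) _)
      ((D.measurable_weight m).pow_const _).aemeasurable
    exact (hu j (by simpa [Nat.lt_succ_iff] using hj)).enorm.pow_const _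
  rw [weightedNorm_eq, weightedNorm_eq, weightedNorm_eq]
  refine le_trans ?_ (ENNReal.lintegral_Lp_add_le (key g hg) (key h hh) (by norm_num))
  gcongr with s
  simp only [Pi.add_apply]
  rw [← add_mul]
  gcongr
  refine le_trans ?_ (ENNReal.Lp_add_le (Finset.range (m + 1)) (fun j => ‖g j s‖ₑ)
    (fun j => ‖h j s‖ₑ) (p := 2) (by norm_num))
  gcongr
  exact enorm_add_le _ _

theorem weightedNorm_smul (D : GammaData k) (m : ℕ) (c : ℝ) (g : ℕ → ℝ → ℝ) :
    D.weightedNorm m (c • g) = ‖c‖ₑ * D.weightedNorm m g := by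
  unfold weightedNorm
  have h1 : ∀ s, (∑ j ∈ Finset.range (m + 1), ‖(c • g) j s‖ₑ ^ 2) * D.weight m s
      = ‖c‖ₑ ^ 2 * ((∑ j ∈ Finset.range (m + 1), ‖g j s‖ₑ ^ 2) * D.weight m s) := by
    intro s
    simp only [Pi.smul_apply, smul_eq_mul, enorm_mul, mul_pow, ← Finset.mul_sum, mul_assoc]
  simp only [h1]
  rw [lintegral_const_mul' _ _ (by simp), ENNReal.mul_rpow_of_nonneg _ _ (by norm_num)]
  congr 1
  rw [← ENNReal.rpow_natCast, ← ENNReal.rpow_mul]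
  norm_num

theorem locallyIntegrable_coe (f : Lp ℝ 2 (volume : Measure ℝ)) :
    LocallyIntegrable (f : ℝ → ℝ) :=
  (Lp.memLp f).locallyIntegrable (by norm_num)

theorem integrable_mul_test {f φ : ℝ → ℝ} (hf : LocallyIntegrable f) (hφ : Continuous φ)
    (hc : HasCompactSupport φ) : Integrable (fun s => f s * φ s) := by
  simpa [mul_comm] using hf.integrable_smul_left_of_hasCompactSupport hφ hc

theorem _root_.IsWeakDeriv.congr {j : ℕ} {f f' g : ℝ → ℝ} (h : IsWeakDeriv j f g)
    (hf : f =ᵐ[volume] f') : IsWeakDeriv j f' g := by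
  refine ⟨h.1, fun φ h1 h2 => ?_⟩
  rw [← h.2 φ h1 h2]
  refine integral_congr_ae ?_
  filter_upwards [hf] with s hs
  rw [hs]

theorem continuous_iteratedDeriv {φ : ℝ → ℝ} (h : ContDiff ℝ (⊤ : ℕ∞) φ) (j : ℕ) :
    Continuous (iteratedDeriv j φ) :=
  h.continuous_iteratedDeriv j (by exact_mod_cast le_top)

theorem hasCompactSupport_iteratedDeriv {φ : ℝ → ℝ} (h : HasCompactSupport φ) (j : ℕ) :
    HasCompactSupport (iteratedDeriv j φ) := by
  induction j with
  | zero => simpa using h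
  | succ j ih => rw [iteratedDeriv_succ]; exact ih.deriv

theorem _root_.IsWeakDeriv.add {j : ℕ} {f f' g g' : ℝ → ℝ} (hf : LocallyIntegrable f)
    (hf' : LocallyIntegrable f') (h : IsWeakDeriv j f g)
    (h' : IsWeakDeriv j f' g') : IsWeakDeriv j (f + f') (g + g') := by
  refine ⟨h.1.add h'.1, fun φ h1 h2 => ?_⟩
  have hc := continuous_iteratedDeriv h1 j
  have hs := hasCompactSupport_iteratedDeriv h2 j
  simp only [Pi.add_apply, add_mul]
  rw [integral_add (integrable_mul_test hf hc hs) (integrable_mul_test hf' hc hs),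
    integral_add (integrable_mul_test h.1 h1.continuous h2)
      (integrable_mul_test h'.1 h1.continuous h2), h.2 φ h1 h2, h'.2 φ h1 h2, mul_add]

theorem _root_.IsWeakDeriv.smul {j : ℕ} {f g : ℝ → ℝ} (c : ℝ)
    (h : IsWeakDeriv j f g) : IsWeakDeriv j (c • f) (c • g) := by
  refine ⟨h.1.smul c, fun φ h1 h2 => ?_⟩
  simp only [Pi.smul_apply, smul_eq_mul, mul_assoc, integral_const_mul]
  rw [h.2 φ h1 h2]
  ring

theorem _root_.IsWeakDeriv.ae_eq {f g : ℝ → ℝ} (hf : LocallyIntegrable f)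
    (h : IsWeakDeriv 0 f g) : f =ᵐ[volume] g := by
  refine ae_eq_of_integral_contDiff_smul_eq hf h.1 fun φ h1 h2 => ?_
  simpa [mul_comm] using h.2 φ h1 h2

theorem sobolevNorm_add_le (D : GammaData k) (m : ℕ) (f f' : Lp ℝ 2 (volume : Measure ℝ)) :
    D.sobolevNorm m (f + f') ≤ D.sobolevNorm m f + D.sobolevNorm m f' := by
  unfold sobolevNorm
  simp only [ENNReal.iInf_add, ENNReal.add_iInf]
  refine le_iInf fun g' => le_iInf fun hg' => le_iInf fun g => le_iInf fun hg => ?_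
  refine (iInf₂_le (g + g') fun j hj => ?_).trans (D.weightedNorm_add_le m g g'
    (fun j hj => (hg j hj).1.aestronglyMeasurable.aemeasurable)
    (fun j hj => (hg' j hj).1.aestronglyMeasurable.aemeasurable))
  exact ((hg j hj).add (locallyIntegrable_coe f) (locallyIntegrable_coe f') (hg' j hj)).congr
    (Lp.coeFn_add f f').symm

theorem sobolevNorm_smul_le (D : GammaData k) (m : ℕ) (c : ℝ)
    (f : Lp ℝ 2 (volume : Measure ℝ)) :
    D.sobolevNorm m (c • f) ≤ ‖c‖ₑ * D.sobolevNorm m f := by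
  rcases eq_or_ne c 0 with rfl | hc
  · refine (iInf₂_le (0 : ℕ → ℝ → ℝ) fun j _ => ?_).trans (by simp [weightedNorm])
    refine IsWeakDeriv.congr (f := 0) ⟨locallyIntegrable_zero, by simp⟩ ?_
    rw [zero_smul]
    exact (Lp.coeFn_zero ℝ 2 volume).symm
  · unfold sobolevNorm
    simp only [ENNReal.mul_iInf_of_ne (a := ‖c‖ₑ) (by simpa using hc) (by simp)]
    refine le_iInf fun g => le_iInf fun hg => ?_
    refine (iInf₂_le (c • g) fun j hj => ?_).trans (D.weightedNorm_smul m c g).le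
    exact ((hg j hj).smul c).congr (Lp.coeFn_smul c f).symm

theorem weight_le_succ (D : GammaData k) (m : ℕ) (s : ℝ) : D.weight m s ≤
    ENNReal.ofReal (Real.exp (D.δ (m + 1) - D.δ m)) * D.weight (m + 1) s := by
  unfold weight
  rw [← ENNReal.ofReal_mul (Real.exp_pos _).le, ← Real.exp_add]
  refine ENNReal.ofReal_le_ofReal (Real.exp_le_exp.2 ?_)
  have h1 : D.δ m < D.δ (m + 1) := D.δ_strictMono m.lt_succ_self
  have h2 : -1 ≤ s * D.β s := by
    rcases le_or_gt 1 |s| with hs | hs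
    · rcases le_abs.1 hs with h | h
      · rw [D.β_one s h]; linarith
      · have := D.β_odd s
        rw [D.β_one _ h] at this
        nlinarith
    · have : |s * D.β s| ≤ 1 := by
        rw [abs_mul]
        exact mul_le_one₀ hs.le (abs_nonneg _) (D.β_abs_le s)
      exact (abs_le.1 this).1
  nlinarith

theorem weightedNorm_le_succ (D : GammaData k) (m : ℕ) (g : ℕ → ℝ → ℝ) : D.weightedNorm m g ≤
    ENNReal.ofReal (Real.exp (D.δ (m + 1) - D.δ m)) ^ (1 / 2 : ℝ)
      * D.weightedNorm (m + 1) g := by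
  unfold weightedNorm
  rw [← ENNReal.mul_rpow_of_nonneg _ _ (by norm_num), ← lintegral_const_mul' _ _ (by simp)]
  refine ENNReal.rpow_le_rpow (lintegral_mono fun s => ?_) (by norm_num)
  rw [mul_left_comm]
  refine mul_le_mul' (Finset.sum_le_sum_of_subset (by simp)) (D.weight_le_succ m s)

/-- The scale `L²(ℝ) = E₀ ⊇ E₁ ⊇ …`, `Eₘ = W^{m,δₘ}`. -/
def sobolevScale (D : GammaData k) : ScScale (Lp ℝ 2 (volume : Measure ℝ)) where
  nrm := D.sobolevNorm
  nrm_add_le := D.sobolevNorm_add_le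
  nrm_smul m c f := by
    refine (D.sobolevNorm_smul_le m c f).antisymm ?_
    rcases eq_or_ne c 0 with rfl | hc
    · simp
    · have h := D.sobolevNorm_smul_le m c⁻¹ (c • f)
      rw [inv_smul_smul₀ hc] at h
      calc ‖c‖ₑ * D.sobolevNorm m f ≤ ‖c‖ₑ * (‖c⁻¹‖ₑ * D.sobolevNorm m (c • f)) := by gcongr
        _ = D.sobolevNorm m (c • f) := by
          rw [← mul_assoc, ← enorm_mul, mul_inv_cancel₀ hc]; simp
  eq_zero_of_nrm m f h := by
    have hlow : ∀ g : ℕ → ℝ → ℝ, (∀ j ≤ m, IsWeakDeriv j f (g j)) →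
        (∫⁻ s, ‖f s‖ₑ ^ 2 * D.weight m s) ^ (1 / 2 : ℝ) ≤ D.weightedNorm m g := by
      intro g hg
      unfold weightedNorm
      refine ENNReal.rpow_le_rpow (lintegral_mono_ae ?_) (by norm_num)
      filter_upwards [(hg 0 (Nat.zero_le m)).ae_eq (locallyIntegrable_coe f)] with s hs
      rw [hs]
      gcongr
      exact Finset.single_le_sum (f := fun j => ‖g j s‖ₑ ^ 2) (fun _ _ => bot_le) (by simp)
    have h0 : (∫⁻ s, ‖f s‖ₑ ^ 2 * D.weight m s) ^ (1 / 2 : ℝ) ≤ D.sobolevNorm m f :=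
      le_iInf fun g => le_iInf fun hg => hlow g hg
    have hm : AEMeasurable (fun s => ‖f s‖ₑ ^ 2 * D.weight m s) :=
      ((Lp.memLp f).1.enorm.pow_const 2).mul (D.measurable_weight m).aemeasurable
    rw [h, nonpos_iff_eq_zero, ENNReal.rpow_eq_zero_iff_of_pos (by norm_num),
      lintegral_eq_zero_iff' hm] at h0
    refine (Lp.eq_zero_iff_ae_eq_zero).2 ?_
    filter_upwards [h0] with s hs
    simpa [weight, (Real.exp_pos _).not_ge] using hs
  nrm_le_succ m := by
    refine ⟨(ENNReal.ofReal (Real.exp (D.δ (m + 1) - D.δ m)) ^ (1 / 2 : ℝ)).toNNReal, fun f => ?_⟩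
    rw [ENNReal.coe_toNNReal (by simp)]
    unfold sobolevNorm
    simp only [ENNReal.mul_iInf_of_ne
      (a := ENNReal.ofReal (Real.exp (D.δ (m + 1) - D.δ m)) ^ (1 / 2 : ℝ))
      (by simp [Real.exp_pos]) (by simp)]
    exact le_iInf fun g => le_iInf fun hg => (iInf₂_le g fun j hj => hg j (by omega)).trans
      (D.weightedNorm_le_succ m g)

/-! ## The retracts `Γₙᵏ` -/

theorem memLp_translate (D : GammaData k) (j : Fin k) (c : ℝ) :
    MemLp (fun s => D.γ j (s + c)) 2 (volume : Measure ℝ) := by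
  refine Continuous.memLp_of_hasCompactSupport (by have := (D.γ_smooth j).continuous; fun_prop) ?_
  exact (D.γ_compact j).comp_homeomorph (Homeomorph.addRight c)

/-- The translated function `γⱼ(· + e^{1/t}) ∈ L²(ℝ)`. -/
def translate (D : GammaData k) (j : Fin k) (t : ℝ) : Lp ℝ 2 (volume : Measure ℝ) :=
  (D.memLp_translate j (Real.exp (1 / t))).toLp

open Classical in
/-- The projection `π_t`: zero for `t ≤ 0`, and the orthogonal projection onto the span of
`γ₁(· + e^{1/t}), …, γₖ(· + e^{1/t})` for `t > 0`. -/
def proj (D : GammaData k) (t : ℝ) (f : Lp ℝ 2 (volume : Measure ℝ)) :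
    Lp ℝ 2 (volume : Measure ℝ) :=
  if t ≤ 0 then 0 else ∑ j : Fin k, inner ℝ f (D.translate j t) • D.translate j t

end GammaData

/-- The ambient space `ℝⁿ ⊕ ℝ ⊕ L²(ℝ)`. -/
abbrev GammaAmbient (n : ℕ) : Type :=
  EuclideanSpace ℝ (Fin n) × ℝ × Lp ℝ 2 (volume : Measure ℝ)

/-- `Γₙᵏ = r(ℝⁿ ⊕ ℝ ⊕ L²(ℝ))`, `r(x, t, f) = (x, t, π_t f)`. -/
def Gamma (n : ℕ) {k : ℕ} (D : GammaData k) :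
    ScRetract (GammaAmbient n) where
  scale := (ScScale.const (EuclideanSpace ℝ (Fin n))).prod
    ((ScScale.const ℝ).prod D.sobolevScale)
  U := Set.univ
  r p := (p.1, p.2.1, D.proj p.2.1 p.2.2)

end

noncomputable section

open Filter Topology

universe u v w z

/-! ## Relative smallness of extended nonnegative functions -/

/-! Consider the functions `xᵢ`, `t` and `cⱼ(x, t, f) = ⟨γⱼ(· + e^{1/t}), f⟩`, with `cⱼ = 0` for `t
≤ 0`. Their differentials identify the tangent space of `X` at a point with `ℝⁿ⁺¹⁺ᵏ` if `t > 0` and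
with `ℝⁿ⁺¹ × 0` if `t ≤ 0`. Even-dimensionality makes `n + 1` and `k` even, so there are skew
matrices `J₀`, `J₁` of these sizes with square `-1`. All structures are pulled back along the
coordinates: `J` is the block matrix of `J₀` and `J₁`, `g` is the Euclidean metric, and `ω` has the
constant matrix `Jᵀ`. The block form keeps `J` inside `ℝⁿ⁺¹ × 0` where `t ≤ 0`. The algebraic
identities are identities of matrices, and strong nondegeneracy is plain nondegeneracy because the
tangent spaces are finite-dimensional.

The analysis lies in the sc-smoothness. As `t → 0⁺`, the functions `γⱼ(· + u)` with `u = e^{1/t}`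
escape to `-∞`. Their norm on level `m` grows at most like `e^{δₘ u / 2}`, while pairing with them
is bounded on level `m` by a multiple of `e^{-δₘ u / 2}`. In `⟨γⱼ, ·⟩ γⱼ` the two effects cancel,
which gives uniform bounds and, as a fixed `f` has small tails, strong continuity at `t = 0`. A
derivative in `t` produces factors `t⁻ᵖ e^{q/t} ≤ u^{p+q}`; these are beaten by `e^{-(δₘ₊₁ - δₘ) u /
2}`, which is gained by measuring the argument one level higher. One level for each derivative is
exactly what sc-smoothness permits (`rankOne_bound`, `famDeriv_rankOne`, `isFam_rankOne_shift`,
`IsFam.isSc`). The frame itself is not continuous at `t = 0`; only its products with coordinates are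
sc-smooth (`isSc_form_smul_frame`), and the block form of `J` produces only such products
(`isSc_synth`).

The form `ω` is closed because it has constant coefficients with respect to exact one-forms.
Concretely, the derivative along `h` of a coordinate `θ(μ)` of a vector field is `θ(Dμ h)` plus the
Hessian of the coordinate at `(h, μ)`, which is symmetric on tangent vectors
(`exists_symm_isScDerivAt_form`). In `dω` the first kind of terms cancels against the brackets, the
second by symmetry (`isClosedForm_of_eq`). -/

/-- `u = o(v)` along `l`, for functions with values in `[0,∞]`. -/
def IsSmall {α : Type*} (l : Filter α) (u v : α → ℝ≥0∞) : Prop :=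
  ∀ ε : ℝ≥0, 0 < ε → ∀ᶠ h in l, u h ≤ ε * v h

namespace IsSmall

variable {α : Type*} {l : Filter α} {u u' v w : α → ℝ≥0∞}

theorem mono (h : IsSmall l u v) (hu : ∀ᶠ a in l, u' a ≤ u a) : IsSmall l u' v := fun ε hε => by
  filter_upwards [h ε hε, hu] with a h1 h2 using h2.trans h1

theorem add (h : IsSmall l u v) (h' : IsSmall l u' v) : IsSmall l (fun a => u a + u' a) v := by
  intro ε hε
  filter_upwards [h (ε / 2) (half_pos hε), h' (ε / 2) (half_pos hε)] with a h1 h2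
  refine (add_le_add h1 h2).trans_eq ?_
  rw [← add_mul, ← ENNReal.coe_add, add_halves]

theorem const_mul (h : IsSmall l u v) (C : ℝ≥0) : IsSmall l (fun a => C * u a) v := by
  intro ε hε
  filter_upwards [h (ε / (C + 1)) (by positivity)] with a h1
  calc (C : ℝ≥0∞) * u a ≤ C * ((ε / (C + 1) : ℝ≥0) * v a) := by gcongr
    _ = ((C * (ε / (C + 1)) : ℝ≥0) : ℝ≥0∞) * v a := by push_cast; rw [mul_assoc]
    _ ≤ ε * v a := by
      gcongr
      rw [mul_div_assoc', div_le_iff₀ (by positivity), mul_comm]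
      gcongr
      simp

theorem trans_le (h : IsSmall l u v) (C : ℝ≥0) (hv : ∀ᶠ a in l, v a ≤ C * w a) :
    IsSmall l u w := by
  intro ε hε
  filter_upwards [h (ε / (C + 1)) (by positivity), hv] with a h1 h2
  calc u a ≤ (ε / (C + 1) : ℝ≥0) * (C * w a) := h1.trans (by gcongr)
    _ = (((ε / (C + 1)) * C : ℝ≥0) : ℝ≥0∞) * w a := by push_cast; rw [mul_assoc]
    _ ≤ ε * w a := by
      gcongr
      rw [div_mul_eq_mul_div, div_le_iff₀ (by positivity)]
      gcongr
      simp

theorem of_tendsto (h : Tendsto w l (𝓝 0)) (hu : ∀ᶠ a in l, u a ≤ w a * v a) :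
    IsSmall l u v := by
  intro ε hε
  have := h.eventually (gt_mem_nhds (show (0 : ℝ≥0∞) < ε by exact_mod_cast hε))
  filter_upwards [this, hu] with a h1 h2
  exact h2.trans (by gcongr)

end IsSmall

/-! ## Operators between scales -/

namespace ScScale

variable {E : Type*} [AddCommGroup E] [Module ℝ E]

theorem mem_level (S : ScScale E) {m : ℕ} {x : E} : x ∈ S.level m ↔ S.nrm m x < ∞ := Iff.rfl

theorem nrm_neg (S : ScScale E) (m : ℕ) (x : E) : S.nrm m (-x) = S.nrm m x := by
  have := S.nrm_smul m (-1) x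
  simpa using this

theorem nrm_sub_le (S : ScScale E) (m : ℕ) (x y : E) :
    S.nrm m (x - y) ≤ S.nrm m x + S.nrm m y := by
  rw [sub_eq_add_neg, ← S.nrm_neg m y]
  exact S.nrm_add_le m _ _

theorem level_succ_le (S : ScScale E) (m : ℕ) : S.level (m + 1) ≤ S.level m := by
  intro x hx
  obtain ⟨C, hC⟩ := S.nrm_le_succ m
  exact (hC x).trans_lt (ENNReal.mul_lt_top ENNReal.coe_lt_top hx)

theorem nrm_zero_le (S : ScScale E) (m : ℕ) : ∃ C : ℝ≥0, ∀ x, S.nrm 0 x ≤ C * S.nrm m x := by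
  induction m with
  | zero => exact ⟨1, fun x => by simp⟩
  | succ m ih =>
    obtain ⟨C, hC⟩ := ih
    obtain ⟨C', hC'⟩ := S.nrm_le_succ m
    refine ⟨C * C', fun x => (hC x).trans ?_⟩
    push_cast
    rw [mul_assoc]
    gcongr
    exact hC' x

/-- Increments `h → 0` in `E₁` with `x + h ∈ U`. -/
def incr (S : ScScale E) (U : Set E) (x : E) : Filter E :=
  comap (S.nrm 1) (𝓝 0) ⊓ 𝓟 {h | x + h ∈ U}

/-- Points `y → x` in the `m`-th norm with `y ∈ U`. -/
def near (S : ScScale E) (m : ℕ) (U : Set E) (x : E) : Filter E :=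
  comap (fun y => S.nrm m (y - x)) (𝓝 0) ⊓ 𝓟 U

theorem tendsto_incr (S : ScScale E) (U : Set E) (x : E) :
    Tendsto (S.nrm 1) (S.incr U x) (𝓝 0) := tendsto_comap.mono_left inf_le_left

theorem eventually_incr_mem (S : ScScale E) (U : Set E) (x : E) :
    ∀ᶠ h in S.incr U x, x + h ∈ U := mem_inf_of_right (mem_principal_self _)

theorem eventually_incr_level (S : ScScale E) (U : Set E) (x : E) :
    ∀ᶠ h in S.incr U x, h ∈ S.level 1 :=
  (S.tendsto_incr U x).eventually (gt_mem_nhds ENNReal.zero_lt_top)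

theorem tendsto_near (S : ScScale E) (m : ℕ) (U : Set E) (x : E) :
    Tendsto (fun y => S.nrm m (y - x)) (S.near m U x) (𝓝 0) :=
  tendsto_comap.mono_left inf_le_left

theorem eventually_near_mem (S : ScScale E) (m : ℕ) (U : Set E) (x : E) :
    ∀ᶠ y in S.near m U x, y ∈ U := mem_inf_of_right (mem_principal_self _)

theorem eventually_incr_iff (S : ScScale E) (U : Set E) (x : E) (p : E → Prop) :
    (∀ᶠ h in S.incr U x, p h) ↔
      ∃ δ : ℝ≥0, 0 < δ ∧ ∀ h, S.nrm 1 h ≤ δ → x + h ∈ U → p h := by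
  rw [incr, eventually_inf_principal, eventually_comap]
  constructor
  · intro h
    obtain ⟨δ, hδ, hd⟩ := ENNReal.nhds_zero_basis_Iic.mem_iff.1 h
    obtain ⟨δ', h0, hlt⟩ := ENNReal.lt_iff_exists_nnreal_btwn.1 hδ
    exact ⟨δ', by exact_mod_cast h0, fun a ha hU => hd (ha.trans hlt.le) a rfl hU⟩
  · rintro ⟨δ, hδ, hd⟩
    filter_upwards [ge_mem_nhds (show (0 : ℝ≥0∞) < δ by exact_mod_cast hδ)] with b hb a ha hU
    exact hd a (ha ▸ hb) hU

theorem tendsto_near_iff (S : ScScale E) (m : ℕ) (U : Set E) (x : E) (p : E → ℝ≥0∞) :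
    Tendsto p (S.near m U x) (𝓝 0) ↔ ∀ ε : ℝ≥0∞, 0 < ε → ∃ δ : ℝ≥0∞, 0 < δ ∧
      ∀ y ∈ U, S.nrm m (y - x) < δ → p y < ε := by
  rw [near, ENNReal.nhds_zero_basis.tendsto_right_iff]
  refine forall₂_congr fun ε hε => ?_
  rw [eventually_inf_principal, eventually_comap]
  constructor
  · intro h
    obtain ⟨δ, hδ, hd⟩ := ENNReal.nhds_zero_basis.mem_iff.1 h
    exact ⟨δ, hδ, fun y hy hlt => hd hlt y rfl hy⟩
  · rintro ⟨δ, hδ, hd⟩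
    filter_upwards [gt_mem_nhds hδ] with b hb a ha hU
    exact hd a hU (ha ▸ hb)

end ScScale

section

variable {E : Type*} {F : Type*} {G : Type*} {H : Type*}
  [AddCommGroup E] [Module ℝ E] [AddCommGroup F] [Module ℝ F]
  [AddCommGroup G] [Module ℝ G] [AddCommGroup H] [Module ℝ H]

/-- `L` is bounded with respect to the `m`-th norms, for all `m`. -/
def IsScOp (S : ScScale E) (T : ScScale F) (L : E →ₗ[ℝ] F) : Prop :=
  ∀ m, ∃ C : ℝ≥0, ∀ x, T.nrm m (L x) ≤ C * S.nrm m x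

/-- The bilinear map `B` is bounded with respect to the `m`-th norms, for all `m`. -/
def IsScBilin (S : ScScale E) (T : ScScale F) (R : ScScale G) (B : E →ₗ[ℝ] F →ₗ[ℝ] G) : Prop :=
  ∀ m, ∃ C : ℝ≥0, ∀ x y, R.nrm m (B x y) ≤ C * (S.nrm m x * T.nrm m y)

variable {S : ScScale E} {T : ScScale F} {R : ScScale G} {Q : ScScale H}

namespace IsScOp

theorem map_level {L : E →ₗ[ℝ] F} (h : IsScOp S T L) {m : ℕ} {x : E} (hx : x ∈ S.level m) :
    L x ∈ T.level m := by
  obtain ⟨C, hC⟩ := h m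
  exact (hC x).trans_lt (ENNReal.mul_lt_top ENNReal.coe_lt_top hx)

theorem comp {L : F →ₗ[ℝ] G} {K : E →ₗ[ℝ] F} (hL : IsScOp T R L) (hK : IsScOp S T K) :
    IsScOp S R (L ∘ₗ K) := by
  intro m
  obtain ⟨C, hC⟩ := hL m
  obtain ⟨D, hD⟩ := hK m
  refine ⟨C * D, fun x => (hC _).trans ?_⟩
  push_cast
  rw [mul_assoc]
  gcongr
  exact hD x

theorem id : IsScOp S S LinearMap.id := fun m => ⟨1, fun x => by simp⟩

theorem shift_incl : IsScOp S.shift S LinearMap.id := fun m => S.nrm_le_succ m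

theorem shift {L : E →ₗ[ℝ] F} (h : IsScOp S T L) : IsScOp S.shift T.shift L := fun m => h (m + 1)

theorem fst : IsScOp (S.prod T) S (LinearMap.fst ℝ E F) :=
  fun m => ⟨1, fun x => by
    rw [ENNReal.coe_one, one_mul]; exact le_max_left (S.nrm m x.1) (T.nrm m x.2)⟩

theorem snd : IsScOp (S.prod T) T (LinearMap.snd ℝ E F) :=
  fun m => ⟨1, fun x => by
    rw [ENNReal.coe_one, one_mul]; exact le_max_right (S.nrm m x.1) (T.nrm m x.2)⟩

theorem prod {L : E →ₗ[ℝ] F} {K : E →ₗ[ℝ] G} (hL : IsScOp S T L) (hK : IsScOp S R K) :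
    IsScOp S (T.prod R) (L.prod K) := by
  intro m
  obtain ⟨C, hC⟩ := hL m
  obtain ⟨D, hD⟩ := hK m
  refine ⟨max C D, fun x => max_le ((hC x).trans ?_) ((hD x).trans ?_)⟩
  · gcongr; exact le_max_left _ _
  · gcongr; exact le_max_right _ _

theorem add {L K : E →ₗ[ℝ] F} (hL : IsScOp S T L) (hK : IsScOp S T K) : IsScOp S T (L + K) := by
  intro m
  obtain ⟨C, hC⟩ := hL m
  obtain ⟨D, hD⟩ := hK m
  refine ⟨C + D, fun x => (T.nrm_add_le m _ _).trans ?_⟩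
  push_cast
  rw [add_mul]
  exact add_le_add (hC x) (hD x)

theorem smul {L : E →ₗ[ℝ] F} (hL : IsScOp S T L) (c : ℝ) : IsScOp S T (c • L) := by
  intro m
  obtain ⟨C, hC⟩ := hL m
  refine ⟨‖c‖₊ * C, fun x => ?_⟩
  rw [LinearMap.smul_apply, T.nrm_smul]
  push_cast
  rw [mul_assoc]
  exact mul_le_mul' le_rfl (hC x)

theorem prodMap {L : E →ₗ[ℝ] G} {K : F →ₗ[ℝ] H} (hL : IsScOp S R L) (hK : IsScOp T Q K) :
    IsScOp (S.prod T) (R.prod Q) (L.prodMap K) :=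
  (hL.comp fst).prod (hK.comp snd)

theorem tangent {L : E →ₗ[ℝ] F} (h : IsScOp S T L) : IsScOp S.tangent T.tangent (L.prodMap L) :=
  h.shift.prodMap h

end IsScOp

theorem IsScBilin.shift {B : E →ₗ[ℝ] F →ₗ[ℝ] G} (h : IsScBilin S T R B) :
    IsScBilin S.shift T.shift R.shift B := fun m => h (m + 1)

/-! ## sc⁰ -/

theorem isScZero_iff {U : Set E} {f : E → F} : IsScZero S T U f ↔ ∀ m, ∀ x ∈ U, x ∈ S.level m →
    f x ∈ T.level m ∧ Tendsto (fun y => T.nrm m (f y - f x)) (S.near m U x) (𝓝 0) := by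
  simp only [ScScale.tendsto_near_iff]
  rfl

theorem IsScZero.congr {U : Set E} {f g : E → F} (h : IsScZero S T U f) (hfg : ∀ x ∈ U, f x = g x) :
    IsScZero S T U g := by
  intro m x hx hm
  obtain ⟨h1, h2⟩ := h m x hx hm
  refine ⟨hfg x hx ▸ h1, fun ε hε => ?_⟩
  obtain ⟨δ, hδ, hd⟩ := h2 ε hε
  exact ⟨δ, hδ, fun y hy hlt => by rw [← hfg x hx, ← hfg y hy]; exact hd y hy hlt⟩

theorem tendsto_zero_of_le {α : Type*} {l : Filter α} {u v : α → ℝ≥0∞} (h : Tendsto v l (𝓝 0))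
    (huv : ∀ᶠ a in l, u a ≤ v a) : Tendsto u l (𝓝 0) :=
  tendsto_of_tendsto_of_tendsto_of_le_of_le' tendsto_const_nhds h (.of_forall fun _ => bot_le) huv

theorem tendsto_const_mul_zero {α : Type*} {l : Filter α} {v : α → ℝ≥0∞} (h : Tendsto v l (𝓝 0))
    {C : ℝ≥0∞} (hC : C ≠ ∞) : Tendsto (fun a => C * v a) l (𝓝 0) := by
  simpa using ENNReal.Tendsto.const_mul h (.inr hC)

theorem IsScZero.op_comp {U : Set E} {f : E → F} (h : IsScZero S T U f) {L : F →ₗ[ℝ] G}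
    (hL : IsScOp T R L) : IsScZero S R U (fun x => L (f x)) := by
  rw [isScZero_iff] at h ⊢
  intro m x hx hm
  obtain ⟨h1, h2⟩ := h m x hx hm
  refine ⟨hL.map_level h1, ?_⟩
  obtain ⟨C, hC⟩ := hL m
  refine tendsto_zero_of_le (tendsto_const_mul_zero h2 (C := C) ENNReal.coe_ne_top)
    (.of_forall fun y => ?_)
  rw [← map_sub]
  exact hC _

theorem tendsto_near_comp {L : E →ₗ[ℝ] F} (hL : IsScOp S T L) {U : Set E} {V : Set F}
    (hUV : Set.MapsTo L U V) (m : ℕ) (x : E) :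
    Tendsto L (S.near m U x) (T.near m V (L x)) := by
  refine tendsto_inf.2 ⟨tendsto_comap_iff.2 ?_, tendsto_principal.2 ?_⟩
  · obtain ⟨C, hC⟩ := hL m
    refine tendsto_zero_of_le (tendsto_const_mul_zero (S.tendsto_near m U x) (C := C)
      ENNReal.coe_ne_top) (.of_forall fun y => ?_)
    simp only [Function.comp, ← map_sub]
    exact hC _
  · filter_upwards [S.eventually_near_mem m U x] with y hy using hUV hy

theorem IsScZero.comp_op {V : Set F} {f : F → G} (h : IsScZero T R V f) {L : E →ₗ[ℝ] F}
    (hL : IsScOp S T L) {U : Set E} (hUV : Set.MapsTo L U V) :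
    IsScZero S R U (fun x => f (L x)) := by
  rw [isScZero_iff] at h ⊢
  intro m x hx hm
  obtain ⟨h1, h2⟩ := h m (L x) (hUV hx) (hL.map_level hm)
  exact ⟨h1, h2.comp (tendsto_near_comp hL hUV m x)⟩

theorem isScZero_op {L : E →ₗ[ℝ] F} (hL : IsScOp S T L) (U : Set E) : IsScZero S T U L := by
  rw [isScZero_iff]
  intro m x hx hm
  refine ⟨hL.map_level hm, ?_⟩
  obtain ⟨C, hC⟩ := hL m
  refine tendsto_zero_of_le (tendsto_const_mul_zero (S.tendsto_near m U x) (C := C)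
    ENNReal.coe_ne_top) (.of_forall fun y => ?_)
  rw [← map_sub]
  exact hC _

theorem IsScZero.prodMk {U : Set E} {f : E → F} {g : E → G} (hf : IsScZero S T U f)
    (hg : IsScZero S R U g) : IsScZero S (T.prod R) U (fun x => (f x, g x)) := by
  rw [isScZero_iff] at hf hg ⊢
  intro m x hx hm
  obtain ⟨h1, h2⟩ := hf m x hx hm
  obtain ⟨h3, h4⟩ := hg m x hx hm
  refine ⟨show max (T.nrm m (f x)) (R.nrm m (g x)) < ∞ from max_lt h1 h3, ?_⟩
  have := h2.max h4
  rwa [max_self] at this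

theorem IsScZero.bilin {U : Set E} {f : E → F} {g : E → G} (hf : IsScZero S T U f)
    (hg : IsScZero S R U g) {B : F →ₗ[ℝ] G →ₗ[ℝ] H} (hB : IsScBilin T R Q B) :
    IsScZero S Q U (fun x => B (f x) (g x)) := by
  rw [isScZero_iff] at hf hg ⊢
  intro m x hx hm
  obtain ⟨h1, h2⟩ := hf m x hx hm
  obtain ⟨h3, h4⟩ := hg m x hx hm
  obtain ⟨C, hC⟩ := hB m
  refine ⟨(hC _ _).trans_lt (ENNReal.mul_lt_top ENNReal.coe_lt_top (ENNReal.mul_lt_top h1 h3)), ?_⟩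
  have key : Tendsto (fun y => (C : ℝ≥0∞) * (T.nrm m (f y - f x) *
      (R.nrm m (g y - g x) + R.nrm m (g x)) + T.nrm m (f x) * R.nrm m (g y - g x)))
      (S.near m U x) (𝓝 0) := by
    refine tendsto_const_mul_zero ?_ ENNReal.coe_ne_top
    have h5 := ENNReal.Tendsto.mul h2 (.inr (by simpa using h3.ne))
      (h4.add (tendsto_const_nhds (x := R.nrm m (g x)))) (.inr (by simp))
    simpa using h5.add (tendsto_const_mul_zero h4 h1.ne)
  refine tendsto_zero_of_le key (.of_forall fun y => ?_)
  have : B (f y) (g y) - B (f x) (g x) = B (f y - f x) (g y) + B (f x) (g y - g x) := by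
    simp only [map_sub, LinearMap.sub_apply]; abel
  rw [this, mul_add]
  refine (Q.nrm_add_le m _ _).trans (add_le_add ((hC _ _).trans ?_) (hC _ _))
  gcongr
  refine le_trans (le_of_eq ?_) (R.nrm_add_le m _ _)
  rw [sub_add_cancel]

/-! ## Linearizations -/

theorem isScDerivAt_iff {U : Set E} {f : E → F} {x : E} {A : E →ₗ[ℝ] F} :
    IsScDerivAt S T U f x A ↔ (∃ C : ℝ≥0, ∀ h ∈ S.level 0, T.nrm 0 (A h) ≤ C * S.nrm 0 h) ∧
      IsSmall (S.incr U x) (fun h => T.nrm 0 (f (x + h) - f x - A h)) (S.nrm 1) := by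
  simp only [IsSmall, ScScale.eventually_incr_iff]
  rfl

namespace IsScDerivAt

variable {U : Set E} {f : E → F} {x : E} {A : E →ₗ[ℝ] F}

theorem isSmall (h : IsScDerivAt S T U f x A) :
    IsSmall (S.incr U x) (fun h => T.nrm 0 (f (x + h) - f x - A h)) (S.nrm 1) :=
  (isScDerivAt_iff.1 h).2

theorem bound_one (h : IsScDerivAt S T U f x A) :
    ∃ C : ℝ≥0, ∀ k ∈ S.level 1, T.nrm 0 (A k) ≤ C * S.nrm 1 k := by
  obtain ⟨C, hC⟩ := h.1
  obtain ⟨D, hD⟩ := S.nrm_le_succ 0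
  refine ⟨C * D, fun k hk => (hC k (S.level_succ_le 0 hk)).trans ?_⟩
  push_cast
  rw [mul_assoc]
  gcongr
  exact hD k

theorem lipschitz (h : IsScDerivAt S T U f x A) :
    ∃ C : ℝ≥0, ∀ᶠ k in S.incr U x, T.nrm 0 (f (x + k) - f x) ≤ C * S.nrm 1 k := by
  obtain ⟨C, hC⟩ := h.bound_one
  refine ⟨1 + C, ?_⟩
  filter_upwards [h.isSmall 1 one_pos, S.eventually_incr_level U x] with k h1 h2
  have h3 : f (x + k) - f x = (f (x + k) - f x - A k) + A k := by abel
  rw [h3]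
  push_cast
  rw [add_mul]
  exact (T.nrm_add_le 0 _ _).trans (add_le_add h1 (hC k h2))

theorem tendsto (h : IsScDerivAt S T U f x A) :
    Tendsto (fun k => T.nrm 0 (f (x + k) - f x)) (S.incr U x) (𝓝 0) := by
  obtain ⟨C, hC⟩ := h.lipschitz
  exact tendsto_zero_of_le (tendsto_const_mul_zero (S.tendsto_incr U x) ENNReal.coe_ne_top) hC

theorem congr (h : IsScDerivAt S T U f x A) {g : E → F} (hx : f x = g x)
    (hfg : ∀ y ∈ U, f y = g y) : IsScDerivAt S T U g x A := by
  rw [isScDerivAt_iff]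
  refine ⟨h.1, h.isSmall.mono ?_⟩
  filter_upwards [S.eventually_incr_mem U x] with k hk
  rw [hfg _ hk, hx]

theorem op_comp (h : IsScDerivAt S T U f x A) {L : F →ₗ[ℝ] G} (hL : IsScOp T R L) :
    IsScDerivAt S R U (fun x => L (f x)) x (L ∘ₗ A) := by
  rw [isScDerivAt_iff]
  obtain ⟨C, hC⟩ := hL 0
  obtain ⟨D, hD⟩ := h.1
  refine ⟨⟨C * D, fun k hk => (hC _).trans ?_⟩, (h.isSmall.const_mul C).mono
    (.of_forall fun k => ?_)⟩
  · push_cast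
    rw [mul_assoc]
    gcongr
    exact hD k hk
  · rw [LinearMap.comp_apply, ← map_sub, ← map_sub]
    exact hC _

theorem comp_op {V : Set F} {f : F → G} {L : E →ₗ[ℝ] F} {x : E} {A : F →ₗ[ℝ] G}
    (h : IsScDerivAt T R V f (L x) A) (hL : IsScOp S T L) {U : Set E} (hUV : Set.MapsTo L U V) :
    IsScDerivAt S R U (fun x => f (L x)) x (A ∘ₗ L) := by
  rw [isScDerivAt_iff]
  obtain ⟨C, hC⟩ := hL 0
  obtain ⟨D, hD⟩ := h.1
  obtain ⟨C', hC'⟩ := hL 1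
  refine ⟨⟨D * C, fun k hk => (hD _ (hL.map_level hk)).trans ?_⟩, ?_⟩
  · push_cast
    rw [mul_assoc]
    gcongr
    exact hC k
  · have ht : Tendsto L (S.incr U x) (T.incr V (L x)) := by
      refine tendsto_inf.2 ⟨tendsto_comap_iff.2 ?_, tendsto_principal.2 ?_⟩
      · exact tendsto_zero_of_le (tendsto_const_mul_zero (S.tendsto_incr U x) (C := C')
          ENNReal.coe_ne_top) (.of_forall hC')
      · filter_upwards [S.eventually_incr_mem U x] with y hy
        rw [← map_add]
        exact hUV hy
    have h2 : IsSmall (S.incr U x) (fun k => R.nrm 0 (f (L x + L k) - f (L x) - A (L k)))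
        (fun k => T.nrm 1 (L k)) := fun ε hε => ht.eventually (h.isSmall ε hε)
    simp only [map_add]
    exact h2.trans_le C' (.of_forall hC')

theorem op {L : E →ₗ[ℝ] F} (hL : IsScOp S T L) (U : Set E) (x : E) :
    IsScDerivAt S T U L x L := by
  rw [isScDerivAt_iff]
  obtain ⟨C, hC⟩ := hL 0
  refine ⟨⟨C, fun k _ => hC k⟩, fun ε hε => .of_forall fun k => ?_⟩
  simp [T.nrm_zero]

theorem prodMk (h : IsScDerivAt S T U f x A) {g : E → G} {A' : E →ₗ[ℝ] G}
    (h' : IsScDerivAt S R U g x A') :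
    IsScDerivAt S (T.prod R) U (fun x => (f x, g x)) x (A.prod A') := by
  rw [isScDerivAt_iff]
  obtain ⟨C, hC⟩ := h.1
  obtain ⟨D, hD⟩ := h'.1
  refine ⟨⟨max C D, fun k hk => max_le ((hC k hk).trans ?_) ((hD k hk).trans ?_)⟩, fun ε hε => ?_⟩
  · gcongr; exact le_max_left _ _
  · gcongr; exact le_max_right _ _
  · filter_upwards [h.isSmall ε hε, h'.isSmall ε hε] with k h1 h2 using max_le h1 h2

theorem bilin (h : IsScDerivAt S T U f x A) {g : E → G} {A' : E →ₗ[ℝ] G}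
    (h' : IsScDerivAt S R U g x A') {B : F →ₗ[ℝ] G →ₗ[ℝ] H} (hB : IsScBilin T R Q B)
    (hf : f x ∈ T.level 0) (hg : g x ∈ R.level 0) :
    IsScDerivAt S Q U (fun x => B (f x) (g x)) x (B (f x) ∘ₗ A' + B.flip (g x) ∘ₗ A) := by
  rw [isScDerivAt_iff]
  obtain ⟨C, hC⟩ := hB 0
  obtain ⟨D, hD⟩ := h.1
  obtain ⟨D', hD'⟩ := h'.1
  lift T.nrm 0 (f x) to ℝ≥0 using (ne_of_lt hf) with a ha
  lift R.nrm 0 (g x) to ℝ≥0 using (ne_of_lt hg) with b hb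
  refine ⟨⟨C * (a * D') + C * (D * b), fun k hk => ?_⟩, ?_⟩
  · simp only [LinearMap.add_apply, LinearMap.comp_apply, LinearMap.flip_apply]
    refine (Q.nrm_add_le 0 _ _).trans ?_
    push_cast
    rw [add_mul]
    refine add_le_add ((hC _ _).trans ?_) ((hC _ _).trans ?_)
    · rw [← ha, mul_assoc, mul_assoc]
      gcongr
      exact hD' k hk
    · rw [← hb, mul_assoc, mul_assoc, mul_comm (b : ℝ≥0∞), ← mul_assoc (D : ℝ≥0∞)]
      gcongr
      exact hD k hk
  · obtain ⟨M, hM⟩ := h.bound_one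
    have t1 : IsSmall (S.incr U x) (fun k => ((C * (1 + b) : ℝ≥0) : ℝ≥0∞) *
        T.nrm 0 (f (x + k) - f x - A k)) (S.nrm 1) := h.isSmall.const_mul _
    have t2 : IsSmall (S.incr U x) (fun k => ((C * a : ℝ≥0) : ℝ≥0∞) *
        R.nrm 0 (g (x + k) - g x - A' k)) (S.nrm 1) := h'.isSmall.const_mul _
    -- The mixed term `B (A k) (g (x + k) - g x)`: its first factor is `O(‖k‖₁)` and its second
    -- tends to zero.
    have t3 : IsSmall (S.incr U x) (fun k => (((C * M : ℝ≥0) : ℝ≥0∞) *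
        R.nrm 0 (g (x + k) - g x)) * S.nrm 1 k) (S.nrm 1) :=
      .of_tendsto (tendsto_const_mul_zero h'.tendsto ENNReal.coe_ne_top) (.of_forall fun _ => le_rfl)
    refine ((t1.add t2).add t3).mono ?_
    filter_upwards [h'.tendsto.eventually (gt_mem_nhds one_pos), S.eventually_incr_level U x]
      with k hk1 hk2
    have e : B (f (x + k)) (g (x + k)) - B (f x) (g x) - (B (f x) ∘ₗ A' + B.flip (g x) ∘ₗ A) k
        = B (f (x + k) - f x - A k) (g (x + k)) + B (f x) (g (x + k) - g x - A' k)
          + B (A k) (g (x + k) - g x) := by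
      simp only [map_sub, LinearMap.sub_apply, LinearMap.add_apply, LinearMap.comp_apply,
        LinearMap.flip_apply]
      abel
    have hgk : R.nrm 0 (g (x + k)) ≤ 1 + b := by
      have : g (x + k) = (g (x + k) - g x) + g x := by abel
      rw [this]
      exact (R.nrm_add_le 0 _ _).trans (add_le_add hk1.le hb.ge)
    rw [e]
    refine (Q.nrm_add_le 0 _ _).trans (add_le_add ((Q.nrm_add_le 0 _ _).trans (add_le_add
      ((hC _ _).trans ?_) ((hC _ _).trans ?_))) ((hC _ _).trans ?_))
    · push_cast
      rw [mul_assoc, mul_comm (1 + (b : ℝ≥0∞))]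
      gcongr
    · rw [← ha]
      push_cast
      rw [mul_assoc]
    · push_cast
      rw [mul_assoc, mul_assoc, mul_comm (R.nrm 0 (g (x + k) - g x)), ← mul_assoc (M : ℝ≥0∞)]
      gcongr
      exact hM k hk2

theorem add (h : IsScDerivAt S T U f x A) {g : E → F} {A' : E →ₗ[ℝ] F}
    (h' : IsScDerivAt S T U g x A') : IsScDerivAt S T U (fun x => f x + g x) x (A + A') := by
  have := (h.prodMk h').op_comp (L := LinearMap.fst ℝ F F + LinearMap.snd ℝ F F)
    (IsScOp.fst.add IsScOp.snd)
  exact this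

theorem smul (h : IsScDerivAt S T U f x A) (c : ℝ) :
    IsScDerivAt S T U (fun x => c • f x) x (c • A) := by
  exact h.op_comp (L := c • LinearMap.id) (IsScOp.id.smul c)

theorem sum {ι : Type*} (s : Finset ι) {f : ι → E → F} {A : ι → E →ₗ[ℝ] F}
    (h : ∀ i ∈ s, IsScDerivAt S T U (f i) x (A i)) :
    IsScDerivAt S T U (fun x => ∑ i ∈ s, f i x) x (∑ i ∈ s, A i) := by
  classical
  induction s using Finset.induction_on with
  | empty =>
    simp only [Finset.sum_empty]
    exact op (L := (0 : E →ₗ[ℝ] F)) (fun m => ⟨0, fun x => by simp [T.nrm_zero]⟩) U x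
  | insert i s hi ih =>
    simp only [Finset.sum_insert hi]
    exact (h i (by simp)).add (ih fun j hj => h j (by simp [hj]))

/-- Linearizations at a point are unique on `E₁`. -/
theorem unique {A' : E →ₗ[ℝ] F} (h : IsScDerivAt S T U f x A) (h' : IsScDerivAt S T U f x A')
    (hU : ∀ k ∈ S.level 1, x + k ∈ U) {k : E} (hk : k ∈ S.level 1) : A k = A' k := by
  rw [← sub_eq_zero]
  refine T.eq_zero_of_nrm 0 _ ?_
  lift S.nrm 1 k to ℝ≥0 using (ne_of_lt hk) with a ha
  have key : ∀ ε : ℝ≥0, 0 < ε → T.nrm 0 (A k - A' k) ≤ ε * (a + 1) := by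
    intro ε hε
    have h1 := (h.isSmall (ε / 2) (half_pos hε)).and (h'.isSmall (ε / 2) (half_pos hε))
    obtain ⟨δ, hδ, hd⟩ := (S.eventually_incr_iff U x _).1 h1
    -- Both linearizations approximate the same increment in the direction `c • k`, which is short
    -- enough for the estimate; homogeneity then removes `c`. Dividing by `a + 1` instead of `a`
    -- includes the case `‖k‖₁ = 0`.
    set c : ℝ≥0 := δ / (a + 1) with hc
    have hc0 : 0 < c := by positivity
    have hck : S.nrm 1 ((c : ℝ) • k) = c * a := by
      rw [S.nrm_smul, ← ha]
      simp [enorm]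
    have hle : S.nrm 1 ((c : ℝ) • k) ≤ δ := by
      rw [hck, hc]
      norm_cast
      rw [div_mul_eq_mul_div, div_le_iff₀ (by positivity)]
      gcongr
      simp
    obtain ⟨h2, h3⟩ := hd _ hle (hU _ ((S.level 1).smul_mem _ hk))
    have e : (c : ℝ) • (A k - A' k) = (f (x + (c : ℝ) • k) - f x - A' ((c : ℝ) • k))
        - (f (x + (c : ℝ) • k) - f x - A ((c : ℝ) • k)) := by
      rw [smul_sub, map_smul, map_smul]; abel
    have h4 : (c : ℝ≥0∞) * T.nrm 0 (A k - A' k) ≤ c * (ε * (a + 1)) := by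
      calc (c : ℝ≥0∞) * T.nrm 0 (A k - A' k) = T.nrm 0 ((c : ℝ) • (A k - A' k)) := by
            rw [T.nrm_smul]; simp [enorm]
        _ ≤ (ε / 2 : ℝ≥0) * (c * a) + (ε / 2 : ℝ≥0) * (c * a) := by
            rw [e, ← hck]
            exact (T.nrm_sub_le 0 _ _).trans (add_le_add h3 h2)
        _ = c * (ε * a) := by
            rw [← add_mul, ← ENNReal.coe_add, add_halves]; ring
        _ ≤ c * (ε * (a + 1)) := by gcongr; simp
    rwa [ENNReal.mul_le_mul_iff_right (by exact_mod_cast hc0.ne') ENNReal.coe_ne_top] at h4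
  by_contra hne
  obtain ⟨r, hr0, hr⟩ := ENNReal.lt_iff_exists_nnreal_btwn.1 (pos_iff_ne_zero.2 hne)
  have hr0' : 0 < r := by exact_mod_cast hr0
  have := key (r / (a + 1)) (by positivity)
  have e : ((r / (a + 1) : ℝ≥0) : ℝ≥0∞) * (a + 1) = r := by
    norm_cast
    field_simp
  rw [e] at this
  exact absurd hr this.not_gt

end IsScDerivAt

end

/-! ## Calculus of scᵏ maps -/

theorem tangentSet_mapsTo {E F : Type*} [AddCommGroup E] [Module ℝ E] [AddCommGroup F] [Module ℝ F]
    {S : ScScale E} {T : ScScale F} {L : E →ₗ[ℝ] F} (hL : IsScOp S T L) {U : Set E} {V : Set F}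
    (hUV : Set.MapsTo L U V) :
    Set.MapsTo (L.prodMap L) (S.tangentSet U) (T.tangentSet V) :=
  fun _ hp => ⟨hUV hp.1, hL.map_level hp.2.1, hL.map_level hp.2.2⟩

namespace IsSc

/-- The tangent map lives on `E × E`, so the step from `k` to `k + 1` changes the spaces. This and
the following rules are therefore recursions on `k` that quantify over all spaces and scales. -/
theorem congr : ∀ {k : ℕ} {E : Type u} {F : Type v} [AddCommGroup E] [Module ℝ E]
    [AddCommGroup F] [Module ℝ F] {S : ScScale E} {T : ScScale F} {U : Set E} {f g : E → F},
    IsSc k S T U f → (∀ x ∈ U, f x = g x) → IsSc k S T U g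
  | 0, _, _, _, _, _, _, _, _, _, _, _, h, hfg => IsScZero.congr h hfg
  | k + 1, _, _, _, _, _, _, _, _, _, _, _, h, hfg => by
    obtain ⟨h0, Df, h1, h2⟩ := h
    refine ⟨h0.congr hfg, Df, fun x hx hx1 => (h1 x hx hx1).congr (hfg x hx) hfg,
      congr h2 fun p hp => ?_⟩
    rw [hfg p.1 hp.1]

theorem op_comp : ∀ {k : ℕ} {E : Type u} {F : Type v} {G : Type w} [AddCommGroup E] [Module ℝ E]
    [AddCommGroup F] [Module ℝ F] [AddCommGroup G] [Module ℝ G]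
    {S : ScScale E} {T : ScScale F} {R : ScScale G} {U : Set E} {f : E → F},
    IsSc k S T U f → ∀ {L : F →ₗ[ℝ] G}, IsScOp T R L → IsSc k S R U (fun x => L (f x))
  | 0, _, _, _, _, _, _, _, _, _, _, _, _, _, _, h, _, hL => IsScZero.op_comp h hL
  | k + 1, _, _, _, _, _, _, _, _, _, _, _, _, _, _, h, L, hL => by
    obtain ⟨h0, Df, h1, h2⟩ := h
    exact ⟨h0.op_comp hL, fun x => L ∘ₗ Df x, fun x hx hx1 => (h1 x hx hx1).op_comp hL,
      op_comp h2 hL.tangent⟩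

theorem comp_op : ∀ {k : ℕ} {E : Type u} {F : Type v} {G : Type w} [AddCommGroup E] [Module ℝ E]
    [AddCommGroup F] [Module ℝ F] [AddCommGroup G] [Module ℝ G]
    {S : ScScale E} {T : ScScale F} {R : ScScale G} {V : Set F} {f : F → G},
    IsSc k T R V f → ∀ {L : E →ₗ[ℝ] F}, IsScOp S T L → ∀ {U : Set E}, Set.MapsTo L U V →
      IsSc k S R U (fun x => f (L x))
  | 0, _, _, _, _, _, _, _, _, _, _, _, _, _, _, h, _, hL, _, hUV => IsScZero.comp_op h hL hUV
  | k + 1, _, _, _, _, _, _, _, _, _, _, _, _, _, _, h, L, hL, _, hUV => by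
    obtain ⟨h0, Df, h1, h2⟩ := h
    exact ⟨h0.comp_op hL hUV, fun x => Df (L x) ∘ₗ L,
      fun x hx hx1 => (h1 (L x) (hUV hx) (hL.map_level hx1)).comp_op hL hUV,
      comp_op h2 hL.tangent (tangentSet_mapsTo hL hUV)⟩

theorem op : ∀ (k : ℕ) {E : Type u} {F : Type v} [AddCommGroup E] [Module ℝ E]
    [AddCommGroup F] [Module ℝ F] {S : ScScale E} {T : ScScale F} {L : E →ₗ[ℝ] F},
    IsScOp S T L → ∀ U : Set E, IsSc k S T U L
  | 0, _, _, _, _, _, _, _, _, _, hL, U => isScZero_op hL U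
  | k + 1, _, _, _, _, _, _, _, _, L, hL, U =>
    ⟨isScZero_op hL U, fun _ => L, fun x _ _ => .op hL U x, op k hL.tangent _⟩

theorem prodMk : ∀ {k : ℕ} {E : Type u} {F : Type v} {G : Type w} [AddCommGroup E] [Module ℝ E]
    [AddCommGroup F] [Module ℝ F] [AddCommGroup G] [Module ℝ G]
    {S : ScScale E} {T : ScScale F} {R : ScScale G} {U : Set E} {f : E → F} {g : E → G},
    IsSc k S T U f → IsSc k S R U g → IsSc k S (T.prod R) U (fun x => (f x, g x))
  | 0, _, _, _, _, _, _, _, _, _, _, _, _, _, _, _, hf, hg => IsScZero.prodMk hf hg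
  | k + 1, _, F, G, _, _, _, _, _, _, _, T, R, _, _, _, hf, hg => by
    obtain ⟨h0, Df, h1, h2⟩ := hf
    obtain ⟨h0', Dg, h1', h2'⟩ := hg
    refine ⟨h0.prodMk h0', fun x => (Df x).prod (Dg x),
      fun x hx hx1 => (h1 x hx hx1).prodMk (h1' x hx hx1), ?_⟩
    -- Pairing the tangent maps gives `((f, Df), (g, Dg))`, whereas the tangent map of the pair is
    -- `((f, g), (Df, Dg))`. The linear map exchanges the two middle entries.
    refine op_comp (prodMk h2 h2')
      (L := (((LinearMap.fst ℝ F F).comp (LinearMap.fst ℝ (F × F) (G × G))).prod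
        ((LinearMap.fst ℝ G G).comp (LinearMap.snd ℝ (F × F) (G × G)))).prod
        (((LinearMap.snd ℝ F F).comp (LinearMap.fst ℝ (F × F) (G × G))).prod
        ((LinearMap.snd ℝ G G).comp (LinearMap.snd ℝ (F × F) (G × G))))) ?_
    have a1 : IsScOp (T.tangent.prod R.tangent) T.tangent (LinearMap.fst ℝ (F × F) (G × G)) := .fst
    have a2 : IsScOp (T.tangent.prod R.tangent) R.tangent (LinearMap.snd ℝ (F × F) (G × G)) := .snd
    exact (((IsScOp.fst (S := T.shift) (T := T)).comp a1).prod
      ((IsScOp.fst (S := R.shift) (T := R)).comp a2)).prod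
      (((IsScOp.snd (S := T.shift) (T := T)).comp a1).prod
      ((IsScOp.snd (S := R.shift) (T := R)).comp a2))

theorem add {k : ℕ} {E : Type u} {F : Type v} [AddCommGroup E] [Module ℝ E]
    [AddCommGroup F] [Module ℝ F] {S : ScScale E} {T : ScScale F} {U : Set E} {f g : E → F}
    (hf : IsSc k S T U f) (hg : IsSc k S T U g) : IsSc k S T U (fun x => f x + g x) :=
  (hf.prodMk hg).op_comp (L := LinearMap.fst ℝ F F + LinearMap.snd ℝ F F)
    (IsScOp.fst.add IsScOp.snd)

theorem smul {k : ℕ} {E : Type u} {F : Type v} [AddCommGroup E] [Module ℝ E]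
    [AddCommGroup F] [Module ℝ F] {S : ScScale E} {T : ScScale F} {U : Set E} {f : E → F}
    (hf : IsSc k S T U f) (c : ℝ) : IsSc k S T U (fun x => c • f x) :=
  hf.op_comp (L := c • LinearMap.id) (IsScOp.id.smul c)

theorem sum {k : ℕ} {E : Type u} {F : Type v} [AddCommGroup E] [Module ℝ E]
    [AddCommGroup F] [Module ℝ F] {S : ScScale E} {T : ScScale F} {U : Set E} {ι : Type*}
    (s : Finset ι) {f : ι → E → F} (hf : ∀ i ∈ s, IsSc k S T U (f i)) :
    IsSc k S T U (fun x => ∑ i ∈ s, f i x) := by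
  classical
  induction s using Finset.induction_on with
  | empty =>
    simp only [Finset.sum_empty]
    exact op k (L := (0 : E →ₗ[ℝ] F)) (fun m => ⟨0, fun x => by simp [T.nrm_zero]⟩) U
  | insert i s hi ih =>
    simp only [Finset.sum_insert hi]
    exact (hf i (by simp)).add (ih fun j hj => hf j (by simp [hj]))

/-- The product rule. -/
theorem bilin : ∀ {k : ℕ} {E : Type u} {F : Type v} {G : Type w} {H : Type z} [AddCommGroup E]
    [Module ℝ E] [AddCommGroup F] [Module ℝ F] [AddCommGroup G] [Module ℝ G] [AddCommGroup H]
    [Module ℝ H] {S : ScScale E} {T : ScScale F} {R : ScScale G} {Q : ScScale H} {U : Set E}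
    {f : E → F} {g : E → G}, IsSc k S T U f → IsSc k S R U g → ∀ {B : F →ₗ[ℝ] G →ₗ[ℝ] H},
    IsScBilin T R Q B → IsSc k S Q U (fun x => B (f x) (g x))
  | 0, _, _, _, _, _, _, _, _, _, _, _, _, _, _, _, _, _, _, _, hf, hg, _, hB =>
    IsScZero.bilin hf hg hB
  | k + 1, E, F, G, H, _, _, _, _, _, _, _, _, S, T, R, Q, U, f, g, hf, hg, B, hB => by
    obtain ⟨h0, Df, h1, h2⟩ := hf
    obtain ⟨h0', Dg, h1', h2'⟩ := hg
    refine ⟨h0.bilin h0' hB, fun x => B (f x) ∘ₗ Dg x + B.flip (g x) ∘ₗ Df x,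
      fun x hx hx1 => (h1 x hx hx1).bilin (h1' x hx hx1) hB
        (h0 0 x hx (S.level_succ_le 0 hx1)).1 (h0' 0 x hx (S.level_succ_le 0 hx1)).1, ?_⟩
    have f1 : IsSc k S.tangent T.shift (S.tangentSet U) (fun p => f p.1) :=
      op_comp h2 (L := LinearMap.fst ℝ F F) (IsScOp.fst (T := T))
    have g1 : IsSc k S.tangent R.shift (S.tangentSet U) (fun p => g p.1) :=
      op_comp h2' (L := LinearMap.fst ℝ G G) (IsScOp.fst (T := R))
    have f2 : IsSc k S.tangent T (S.tangentSet U) (fun p => Df p.1 p.2) :=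
      op_comp h2 (L := LinearMap.snd ℝ F F) (IsScOp.snd (S := T.shift))
    have g2 : IsSc k S.tangent R (S.tangentSet U) (fun p => Dg p.1 p.2) :=
      op_comp h2' (L := LinearMap.snd ℝ G G) (IsScOp.snd (S := R.shift))
    -- The base component of the tangent map is measured one level higher, so there the product is
    -- taken in the shifted scales. In the fibre component the undifferentiated factor is brought
    -- back to the original scale by the inclusion.
    exact (bilin f1 g1 hB.shift).prodMk ((bilin (f1.op_comp IsScOp.shift_incl) g2 hB).add
      (bilin f2 (g1.op_comp IsScOp.shift_incl) hB))

end IsSc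

theorem isScBilin_smul {F : Type*} [AddCommGroup F] [Module ℝ F] (T : ScScale F) :
    IsScBilin (ScScale.const ℝ) T T (LinearMap.lsmul ℝ F) :=
  fun m => ⟨1, fun c x => by
    rw [ENNReal.coe_one, one_mul]
    exact (T.nrm_smul m c x).le⟩

theorem IsSc.smul_fun {k : ℕ} {E : Type u} {F : Type v} [AddCommGroup E] [Module ℝ E]
    [AddCommGroup F] [Module ℝ F] {S : ScScale E} {T : ScScale F} {U : Set E} {c : E → ℝ}
    {f : E → F} (hc : IsSc k S (ScScale.const ℝ) U c) (hf : IsSc k S T U f) :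
    IsSc k S T U (fun x => c x • f x) := hc.bilin hf (isScBilin_smul T)

/-! ## Families of operators -/

section Families

variable {E : Type u} {F : Type v} [AddCommGroup E] [Module ℝ E] [AddCommGroup F] [Module ℝ F]

/-- Boundedness on every level, uniformly in the parameter. -/
def UnifBdd (S : ScScale E) (T : ScScale F) (A : ℝ → E →ₗ[ℝ] F) : Prop :=
  ∀ m, ∃ C : ℝ≥0, ∀ t x, T.nrm m (A t x) ≤ C * S.nrm m x

/-- Strong continuity on every level. -/
def StrongCont (S : ScScale E) (T : ScScale F) (A : ℝ → E →ₗ[ℝ] F) : Prop :=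
  ∀ m t, ∀ x ∈ S.level m, Tendsto (fun s => T.nrm m (A s x - A t x)) (𝓝 t) (𝓝 0)

/-- `A'` is the derivative of `A` in the norms of operators from level `m + 1` to level `m`. -/
def FamDeriv (S : ScScale E) (T : ScScale F) (A A' : ℝ → E →ₗ[ℝ] F) : Prop :=
  ∀ m t, ∀ ε : ℝ≥0, 0 < ε → ∀ᶠ τ in 𝓝 (0 : ℝ), ∀ x,
    T.nrm m (A (t + τ) x - A t x - τ • A' t x) ≤ ε * ‖τ‖ₑ * S.nrm (m + 1) x

variable {S : ScScale E} {T : ScScale F} {A A' B B' : ℝ → E →ₗ[ℝ] F}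

theorem UnifBdd.mono (h : UnifBdd S T A) : UnifBdd S.shift T A := by
  intro m
  obtain ⟨C, hC⟩ := h m
  obtain ⟨D, hD⟩ := S.nrm_le_succ m
  refine ⟨C * D, fun t x => (hC t x).trans ?_⟩
  push_cast
  rw [mul_assoc]
  gcongr
  exact hD x

theorem StrongCont.mono (h : StrongCont S T A) : StrongCont S.shift T A :=
  fun m t x hx => h m t x (S.level_succ_le m hx)

theorem FamDeriv.mono (h : FamDeriv S T A A') : FamDeriv S.shift T A A' := by
  intro m t ε hε
  obtain ⟨D, hD⟩ := S.nrm_le_succ (m + 1)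
  filter_upwards [h m t (ε / (D + 1)) (by positivity)] with τ hτ x
  refine (hτ x).trans ?_
  calc ((ε / (D + 1) : ℝ≥0) : ℝ≥0∞) * ‖τ‖ₑ * S.nrm (m + 1) x
      ≤ ((ε / (D + 1) : ℝ≥0) : ℝ≥0∞) * ‖τ‖ₑ * (D * S.nrm (m + 1 + 1) x) := by gcongr; exact hD x
    _ = ((ε / (D + 1) * D : ℝ≥0) : ℝ≥0∞) * ‖τ‖ₑ * S.nrm (m + 1 + 1) x := by push_cast; ring
    _ ≤ ε * ‖τ‖ₑ * S.nrm (m + 1 + 1) x := by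
      gcongr
      rw [div_mul_eq_mul_div, div_le_iff₀ (by positivity)]
      gcongr
      simp

theorem UnifBdd.shift (h : UnifBdd S T A) : UnifBdd S.shift T.shift A := fun m => h (m + 1)

theorem StrongCont.shift (h : StrongCont S T A) : StrongCont S.shift T.shift A := fun m => h (m + 1)

theorem FamDeriv.shift (h : FamDeriv S T A A') : FamDeriv S.shift T.shift A A' :=
  fun m => h (m + 1)

theorem UnifBdd.add (h : UnifBdd S T A) (h' : UnifBdd S T B) : UnifBdd S T (A + B) := by
  intro m
  obtain ⟨C, hC⟩ := h m
  obtain ⟨D, hD⟩ := h' m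
  refine ⟨C + D, fun t x => (T.nrm_add_le m _ _).trans ?_⟩
  push_cast
  rw [add_mul]
  exact add_le_add (hC t x) (hD t x)

theorem StrongCont.add (h : StrongCont S T A) (h' : StrongCont S T B) : StrongCont S T (A + B) := by
  intro m t x hx
  have := (h m t x hx).add (h' m t x hx)
  rw [add_zero] at this
  refine tendsto_zero_of_le this (.of_forall fun s => ?_)
  have e : (A + B) s x - (A + B) t x = (A s x - A t x) + (B s x - B t x) := by
    simp only [Pi.add_apply, LinearMap.add_apply]; abel
  rw [e]
  exact T.nrm_add_le m _ _

theorem FamDeriv.add (h : FamDeriv S T A A') (h' : FamDeriv S T B B') :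
    FamDeriv S T (A + B) (A' + B') := by
  intro m t ε hε
  filter_upwards [h m t (ε / 2) (half_pos hε), h' m t (ε / 2) (half_pos hε)] with τ h1 h2 x
  have e : (A + B) (t + τ) x - (A + B) t x - τ • (A' + B') t x
      = (A (t + τ) x - A t x - τ • A' t x) + (B (t + τ) x - B t x - τ • B' t x) := by
    simp only [Pi.add_apply, LinearMap.add_apply, smul_add]; abel
  rw [e]
  refine (T.nrm_add_le m _ _).trans ((add_le_add (h1 x) (h2 x)).trans_eq ?_)
  rw [← add_mul, ← add_mul, ← ENNReal.coe_add, add_halves]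

theorem UnifBdd.smul (h : UnifBdd S T A) (c : ℝ) : UnifBdd S T (c • A) := by
  intro m
  obtain ⟨C, hC⟩ := h m
  refine ⟨‖c‖₊ * C, fun t x => ?_⟩
  rw [Pi.smul_apply, LinearMap.smul_apply, T.nrm_smul]
  push_cast
  rw [mul_assoc]
  exact mul_le_mul' le_rfl (hC t x)

theorem StrongCont.smul (h : StrongCont S T A) (c : ℝ) : StrongCont S T (c • A) := by
  intro m t x hx
  refine tendsto_zero_of_le (tendsto_const_mul_zero (h m t x hx) (C := ‖c‖ₑ) (by simp))
    (.of_forall fun s => ?_)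
  simp only [Pi.smul_apply, LinearMap.smul_apply]
  rw [← smul_sub, T.nrm_smul]

theorem FamDeriv.smul (h : FamDeriv S T A A') (c : ℝ) : FamDeriv S T (c • A) (c • A') := by
  intro m t ε hε
  filter_upwards [h m t (ε / (‖c‖₊ + 1)) (by positivity)] with τ h1 x
  have e : (c • A) (t + τ) x - (c • A) t x - τ • (c • A') t x
      = c • (A (t + τ) x - A t x - τ • A' t x) := by
    simp only [Pi.smul_apply, LinearMap.smul_apply, smul_sub, smul_comm τ c]
  rw [e, T.nrm_smul]
  calc ‖c‖ₑ * T.nrm m (A (t + τ) x - A t x - τ • A' t x)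
      ≤ ‖c‖₊ * (((ε / (‖c‖₊ + 1) : ℝ≥0) : ℝ≥0∞) * ‖τ‖ₑ * S.nrm (m + 1) x) :=
        mul_le_mul' le_rfl (h1 x)
    _ = ((‖c‖₊ * (ε / (‖c‖₊ + 1)) : ℝ≥0) : ℝ≥0∞) * ‖τ‖ₑ * S.nrm (m + 1) x := by
      push_cast; ring
    _ ≤ ε * ‖τ‖ₑ * S.nrm (m + 1) x := by
      gcongr
      rw [mul_div_assoc', div_le_iff₀ (by positivity), mul_comm]
      gcongr
      simp

/-- `A` is `k` times differentiable, where each derivative loses one level. -/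
def IsFam : ℕ → ScScale E → ScScale F → (ℝ → E →ₗ[ℝ] F) → Prop
  | 0, S, T, A => UnifBdd S T A ∧ StrongCont S T A
  | k + 1, S, T, A => UnifBdd S T A ∧ StrongCont S T A ∧
      ∃ A', FamDeriv S T A A' ∧ IsFam k S.shift T A'

namespace IsFam

theorem unifBdd {k : ℕ} (h : IsFam k S T A) : UnifBdd S T A := by
  cases k <;> exact h.1

theorem mono {k : ℕ} (h : IsFam k S T A) : IsFam k S.shift T A := by
  induction k generalizing S A with
  | zero => exact ⟨h.1.mono, h.2.mono⟩
  | succ k ih =>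
    obtain ⟨h1, h2, A', h3, h4⟩ := h
    exact ⟨h1.mono, h2.mono, A', h3.mono, ih h4⟩

theorem shift {k : ℕ} (h : IsFam k S T A) : IsFam k S.shift T.shift A := by
  induction k generalizing S A with
  | zero => exact ⟨h.1.shift, h.2.shift⟩
  | succ k ih =>
    obtain ⟨h1, h2, A', h3, h4⟩ := h
    exact ⟨h1.shift, h2.shift, A', h3.shift, ih h4⟩

theorem of_succ {k : ℕ} (h : IsFam (k + 1) S T A) : IsFam k S T A := by
  induction k generalizing S A with
  | zero => exact ⟨h.1, h.2.1⟩
  | succ k ih =>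
    obtain ⟨h1, h2, A', h3, h4⟩ := h
    exact ⟨h1, h2, A', h3, ih h4⟩

theorem add {k : ℕ} (h : IsFam k S T A) (h' : IsFam k S T B) : IsFam k S T (A + B) := by
  induction k generalizing S A B with
  | zero => exact ⟨h.1.add h'.1, h.2.add h'.2⟩
  | succ k ih =>
    obtain ⟨h1, h2, A', h3, h4⟩ := h
    obtain ⟨h1', h2', B', h3', h4'⟩ := h'
    exact ⟨h1.add h1', h2.add h2', A' + B', h3.add h3', ih h4 h4'⟩

theorem smul {k : ℕ} (h : IsFam k S T A) (c : ℝ) : IsFam k S T (c • A) := by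
  induction k generalizing S A with
  | zero => exact ⟨h.1.smul c, h.2.smul c⟩
  | succ k ih =>
    obtain ⟨h1, h2, A', h3, h4⟩ := h
    exact ⟨h1.smul c, h2.smul c, c • A', h3.smul c, ih h4⟩

end IsFam

/-- Uniform boundedness controls the change of the vector, strong continuity at the fixed vector the
change of the parameter. Continuity in operator norm is not needed, and `π_t` does not have it at `t
= 0` when `k > 0`. -/
theorem IsFam.isScZero (h : UnifBdd S T A) (h' : StrongCont S T A) (U : Set (ℝ × E)) :
    IsScZero ((ScScale.const ℝ).prod S) T U (fun p => A p.1 p.2) := by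
  rw [isScZero_iff]
  intro m p hp hm
  have hp2 : p.2 ∈ S.level m := (le_max_right _ _).trans_lt (show max _ _ < ∞ from hm)
  obtain ⟨C, hC⟩ := h m
  refine ⟨(hC _ _).trans_lt (ENNReal.mul_lt_top ENNReal.coe_lt_top hp2), ?_⟩
  have hn := ((ScScale.const ℝ).prod S).tendsto_near m U p
  have t1 : Tendsto (fun y : ℝ × E => S.nrm m (y.2 - p.2))
      (((ScScale.const ℝ).prod S).near m U p) (𝓝 0) :=
    tendsto_zero_of_le hn (.of_forall fun y => le_max_right _ _)
  have t2 : Tendsto (fun y : ℝ × E => y.1) (((ScScale.const ℝ).prod S).near m U p) (𝓝 p.1) := by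
    rw [tendsto_iff_edist_tendsto_0]
    refine tendsto_zero_of_le hn (.of_forall fun y => ?_)
    rw [edist_eq_enorm_sub]
    exact le_max_left (‖y.1 - p.1‖ₑ) (S.nrm m (y.2 - p.2))
  have := (tendsto_const_mul_zero t1 (C := C) ENNReal.coe_ne_top).add
    ((h' m p.1 p.2 hp2).comp t2)
  rw [add_zero] at this
  refine tendsto_zero_of_le this (.of_forall fun y => ?_)
  have e : A y.1 y.2 - A p.1 p.2 = A y.1 (y.2 - p.2) + (A y.1 p.2 - A p.1 p.2) := by
    rw [map_sub]; abel
  rw [e]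
  exact (T.nrm_add_le m _ _).trans (add_le_add (hC _ _) le_rfl)

/-- The chain rule for `y ↦ A (c y) (f y)`, if the linearization of `f` is bounded on level one. -/
theorem FamDeriv.isScDerivAt_comp {V : Type*} [AddCommGroup V] [Module ℝ V] {R : ScScale V}
    (hb : UnifBdd S T A) (hb' : UnifBdd S.shift T A') (hd : FamDeriv S T A A') {U : Set V}
    {f : V → E} {x : V} {Df : V →ₗ[ℝ] E} (hf : IsScDerivAt R S U f x Df) (hx : f x ∈ S.level 1)
    (hD : ∃ C : ℝ≥0, ∀ k ∈ R.level 1, S.nrm 1 (Df k) ≤ C * R.nrm 1 k) {c : V →ₗ[ℝ] ℝ}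
    (hc : IsScOp R (ScScale.const ℝ) c) :
    IsScDerivAt R T U (fun y => A (c y) (f y)) x
      (A (c x) ∘ₗ Df + c.smulRight (A' (c x) (f x))) := by
  rw [isScDerivAt_iff]
  obtain ⟨C, hC⟩ := hb 0
  obtain ⟨C', hC'⟩ := hb' 0
  obtain ⟨M, hM⟩ := hf.1
  obtain ⟨M₁, hM₁⟩ := hD
  obtain ⟨K, hK⟩ := hc 0
  obtain ⟨K₁, hK₁⟩ := hc 1
  change ∀ t x, T.nrm 0 (A' t x) ≤ C' * S.nrm 1 x at hC'
  change ∀ y, ‖c y‖ₑ ≤ K * R.nrm 0 y at hK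
  change ∀ y, ‖c y‖ₑ ≤ K₁ * R.nrm 1 y at hK₁
  lift S.nrm 1 (f x) to ℝ≥0 using (ne_of_lt hx) with a ha
  refine ⟨⟨C * M + K * (C' * a), fun k hk => ?_⟩, ?_⟩
  · refine (T.nrm_add_le 0 _ _).trans ?_
    push_cast
    rw [add_mul]
    refine add_le_add ((hC _ _).trans ?_) ?_
    · rw [mul_assoc]
      gcongr
      exact hM k hk
    · rw [LinearMap.smulRight_apply, T.nrm_smul, mul_right_comm]
      refine mul_le_mul' (hK k) ?_
      rw [ha]
      exact hC' _ _
  · have tc : Tendsto (fun k => c k) (R.incr U x) (𝓝 0) := by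
      rw [tendsto_iff_edist_tendsto_0]
      refine tendsto_zero_of_le (tendsto_const_mul_zero (R.tendsto_incr U x) (C := K₁)
        ENNReal.coe_ne_top) (.of_forall fun k => ?_)
      rw [edist_zero_right]
      exact hK₁ k
    have tc' : Tendsto (fun k => ‖c k‖ₑ) (R.incr U x) (𝓝 0) := by
      have := (continuous_enorm.tendsto (0 : ℝ)).comp tc
      rwa [enorm_zero] at this
    have t1 : IsSmall (R.incr U x) (fun k => C * S.nrm 0 (f (x + k) - f x - Df k)) (R.nrm 1) :=
      hf.isSmall.const_mul C
    have t2 : IsSmall (R.incr U x)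
        (fun k => T.nrm 0 (A (c x + c k) (f x) - A (c x) (f x) - c k • A' (c x) (f x)))
        (R.nrm 1) := by
      have : IsSmall (R.incr U x)
        (fun k => T.nrm 0 (A (c x + c k) (f x) - A (c x) (f x) - c k • A' (c x) (f x)))
        (fun k => ‖c k‖ₑ * a) := by
        intro ε hε
        filter_upwards [tc.eventually (hd 0 (c x) ε hε)] with k hk
        rw [ha, ← mul_assoc]
        exact hk _
      refine this.trans_le (K₁ * a) (.of_forall fun k => ?_)
      push_cast
      rw [mul_right_comm]
      gcongr
      exact hK₁ k
    -- The change of `A` applied to `Df k` costs one level, which is why `Df` has to be bounded on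
    -- level one. The factor `‖c k‖ₑ → 0` makes this term small.
    have t3 : IsSmall (R.incr U x)
        (fun k => (((C' + 1) * M₁ : ℝ≥0) * ‖c k‖ₑ) * R.nrm 1 k) (R.nrm 1) :=
      .of_tendsto (tendsto_const_mul_zero tc' ENNReal.coe_ne_top) (.of_forall fun _ => le_rfl)
    refine ((t1.add t2).add t3).mono ?_
    filter_upwards [tc.eventually (hd 0 (c x) 1 one_pos), R.eventually_incr_level U x] with k hk hk1
    have e : A (c (x + k)) (f (x + k)) - A (c x) (f x)
        - (A (c x) ∘ₗ Df + c.smulRight (A' (c x) (f x))) k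
        = A (c (x + k)) (f (x + k) - f x - Df k)
          + (A (c x + c k) (f x) - A (c x) (f x) - c k • A' (c x) (f x))
          + ((A (c x + c k) (Df k) - A (c x) (Df k) - c k • A' (c x) (Df k))
            + c k • A' (c x) (Df k)) := by
      simp only [map_add, map_sub, LinearMap.add_apply, LinearMap.comp_apply,
        LinearMap.smulRight_apply]
      abel
    rw [e]
    refine (T.nrm_add_le 0 _ _).trans (add_le_add ((T.nrm_add_le 0 _ _).trans
      (add_le_add (hC _ _) le_rfl)) ?_)
    refine (T.nrm_add_le 0 _ _).trans ((add_le_add (hk _) ((T.nrm_smul 0 _ _).trans_le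
      (mul_le_mul' le_rfl (hC' _ _)))).trans ?_)
    calc ((1 : ℝ≥0) : ℝ≥0∞) * ‖c k‖ₑ * S.nrm (0 + 1) (Df k) + ‖c k‖ₑ * (C' * S.nrm 1 (Df k))
        = (C' + 1) * ‖c k‖ₑ * S.nrm 1 (Df k) := by
          rw [ENNReal.coe_one, zero_add]; ring
      _ ≤ (C' + 1) * ‖c k‖ₑ * (M₁ * R.nrm 1 k) := by gcongr; exact hM₁ k hk1
      _ = (((C' + 1) * M₁ : ℝ≥0) * ‖c k‖ₑ) * R.nrm 1 k := by push_cast; ring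

theorem FamDeriv.isScDerivAt (hb : UnifBdd S T A) (hb' : UnifBdd S.shift T A')
    (hd : FamDeriv S T A A') (U : Set (ℝ × E)) {p : ℝ × E} (hp : p.2 ∈ S.level 1) :
    IsScDerivAt ((ScScale.const ℝ).prod S) T U (fun p => A p.1 p.2) p
      (A p.1 ∘ₗ LinearMap.snd ℝ ℝ E + (LinearMap.fst ℝ ℝ E).smulRight (A' p.1 p.2)) :=
  hd.isScDerivAt_comp hb hb' (f := fun p : ℝ × E => p.2) (.op (IsScOp.snd) U p) hp
    ⟨1, fun k _ => by
      rw [ENNReal.coe_one, one_mul]; exact le_max_right (‖k.1‖ₑ) (S.nrm 1 k.2)⟩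
    (c := LinearMap.fst ℝ ℝ E) IsScOp.fst

end Families

/-- The tangent map sends `((t, x), (τ, y))` to `(A t x, A t y + τ A' t x)`. Since `x` is measured
one level higher in the tangent scale, it suffices that `A'` is a family on `S.shift`. Every term is
again a family composed with linear maps, or a product of such. -/
theorem IsFam.isSc : ∀ {k : ℕ} {E : Type u} {F : Type v} [AddCommGroup E] [Module ℝ E]
    [AddCommGroup F] [Module ℝ F] {S : ScScale E} {T : ScScale F} {A : ℝ → E →ₗ[ℝ] F},
    IsFam k S T A → ∀ U : Set (ℝ × E),
    IsSc k ((ScScale.const ℝ).prod S) T U (fun p => A p.1 p.2)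
  | 0, _, _, _, _, _, _, _, _, _, h, U => IsFam.isScZero h.1 h.2 U
  | k + 1, E, F, _, _, _, _, S, T, A, h, U => by
    have hk := h.of_succ
    obtain ⟨h1, h2, A', h3, h4⟩ := h
    refine ⟨IsFam.isScZero h1 h2 U,
      fun p => A p.1 ∘ₗ LinearMap.snd ℝ ℝ E + (LinearMap.fst ℝ ℝ E).smulRight (A' p.1 p.2),
      fun p _ hp1 => h3.isScDerivAt h1 h4.unifBdd U
        ((le_max_right _ _).trans_lt (show max _ _ < ∞ from hp1)), ?_⟩
    have e1 : IsSc k ((ScScale.const ℝ).prod S).tangent T.shift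
        (((ScScale.const ℝ).prod S).tangentSet U) (fun p => A p.1.1 p.1.2) :=
      (hk.shift.isSc Set.univ).comp_op (L := LinearMap.fst ℝ (ℝ × E) (ℝ × E))
        (IsScOp.fst (S := ((ScScale.const ℝ).prod S).shift)) fun _ _ => trivial
    have e2 : IsSc k ((ScScale.const ℝ).prod S).tangent T
        (((ScScale.const ℝ).prod S).tangentSet U) (fun p => A p.1.1 p.2.2) :=
      (hk.isSc Set.univ).comp_op
        (L := ((LinearMap.fst ℝ ℝ E).comp (LinearMap.fst ℝ (ℝ × E) (ℝ × E))).prod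
          ((LinearMap.snd ℝ ℝ E).comp (LinearMap.snd ℝ (ℝ × E) (ℝ × E))))
        (((IsScOp.fst (S := ScScale.const ℝ) (T := S.shift)).comp
          (IsScOp.fst (S := ((ScScale.const ℝ).prod S).shift))).prod
          (IsScOp.snd.comp (IsScOp.snd (S := ((ScScale.const ℝ).prod S).shift))))
        fun _ _ => trivial
    have e3 : IsSc k ((ScScale.const ℝ).prod S).tangent T
        (((ScScale.const ℝ).prod S).tangentSet U) (fun p => A' p.1.1 p.1.2) :=
      (h4.isSc Set.univ).comp_op (L := LinearMap.fst ℝ (ℝ × E) (ℝ × E))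
        (IsScOp.fst (S := ((ScScale.const ℝ).prod S).shift)) fun _ _ => trivial
    have e4 : IsSc k ((ScScale.const ℝ).prod S).tangent (ScScale.const ℝ)
        (((ScScale.const ℝ).prod S).tangentSet U) (fun p => p.2.1) :=
      IsSc.op k (L := (LinearMap.fst ℝ ℝ E).comp (LinearMap.snd ℝ (ℝ × E) (ℝ × E)))
        (IsScOp.fst.comp (IsScOp.snd (S := ((ScScale.const ℝ).prod S).shift))) _
    exact e1.prodMk (e2.add (e4.smul_fun e3))

/-! ## The levels as normed spaces -/

namespace ScScale

variable {F : Type*} [AddCommGroup F] [Module ℝ F]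

/-- The level `Fₘ` as a normed space. -/
def Lev (T : ScScale F) (m : ℕ) : Type _ := ↥(T.level m)

variable (T : ScScale F) (m : ℕ)

instance : AddCommGroup (T.Lev m) := inferInstanceAs (AddCommGroup ↥(T.level m))

instance : Module ℝ (T.Lev m) := inferInstanceAs (Module ℝ ↥(T.level m))

/-- The inclusion `Fₘ → F`. -/
def levIncl : T.Lev m →ₗ[ℝ] F := (T.level m).subtype

theorem levIncl_mem (v : T.Lev m) : T.levIncl m v ∈ T.level m :=
  Subtype.prop (p := (· ∈ T.level m)) v

theorem levIncl_injective : Function.Injective (T.levIncl m) :=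
  Submodule.subtype_injective (T.level m)

instance : Norm (T.Lev m) := ⟨fun v => (T.nrm m (T.levIncl m v)).toReal⟩

theorem lev_core : NormedSpace.Core ℝ (T.Lev m) where
  norm_nonneg _ := ENNReal.toReal_nonneg
  norm_smul c v := by
    change (T.nrm m (T.levIncl m (c • v))).toReal = _ * (T.nrm m (T.levIncl m v)).toReal
    rw [map_smul, T.nrm_smul, ENNReal.toReal_mul]
    simp
  norm_triangle v w := by
    change (T.nrm m (T.levIncl m (v + w))).toReal ≤
      (T.nrm m (T.levIncl m v)).toReal + (T.nrm m (T.levIncl m w)).toReal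
    have hv : T.nrm m (T.levIncl m v) < ∞ := T.levIncl_mem m v
    have hw : T.nrm m (T.levIncl m w) < ∞ := T.levIncl_mem m w
    rw [← ENNReal.toReal_add hv.ne hw.ne, map_add]
    exact ENNReal.toReal_mono (ENNReal.add_lt_top.2 ⟨hv, hw⟩).ne (T.nrm_add_le _ _ _)
  norm_eq_zero_iff v := by
    change (T.nrm m (T.levIncl m v)).toReal = 0 ↔ _
    have hv : T.nrm m (T.levIncl m v) < ∞ := T.levIncl_mem m v
    rw [ENNReal.toReal_eq_zero_iff]
    constructor
    · rintro (h | h)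
      · exact T.levIncl_injective m ((T.eq_zero_of_nrm m _ h).trans (map_zero _).symm)
      · exact absurd h hv.ne
    · rintro rfl
      left
      rw [map_zero, T.nrm_zero]

instance : NormedAddCommGroup (T.Lev m) := NormedAddCommGroup.ofCore (T.lev_core m)

instance : NormedSpace ℝ (T.Lev m) := NormedSpace.ofCore (T.lev_core m)

theorem lev_norm (v : T.Lev m) : ‖v‖ = (T.nrm m (T.levIncl m v)).toReal := rfl

theorem lev_enorm (v : T.Lev m) : ‖v‖ₑ = T.nrm m (T.levIncl m v) := by
  rw [← ofReal_norm, lev_norm]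
  exact ENNReal.ofReal_toReal (ne_of_lt (T.levIncl_mem m v))

variable {T m}

/-- An element of finite `m`-th norm, as a point of the normed space `Fₘ`. -/
def toLev (x : F) (hx : x ∈ T.level m) : T.Lev m := ⟨x, hx⟩

@[simp]
theorem levIncl_toLev (x : F) (hx : x ∈ T.level m) : T.levIncl m (toLev x hx) = x := rfl

end ScScale

/-! ## Differentiable curves in a scale -/

/-- `b'` is the derivative of the curve `b` on every level. -/
def HasScaleDeriv {F : Type*} [AddCommGroup F] [Module ℝ F] (T : ScScale F) (b b' : ℝ → F) : Prop :=
  ∀ m u, ∀ ε : ℝ≥0, 0 < ε → ∀ᶠ τ in 𝓝 (0 : ℝ), T.nrm m (b (u + τ) - b u - τ • b' u) ≤ ε * ‖τ‖ₑ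

theorem HasScaleDeriv.hasDerivAt {F : Type*} [AddCommGroup F] [Module ℝ F] {T : ScScale F}
    {b b' : ℝ → F} (h : HasScaleDeriv T b b') {m : ℕ} (hb : ∀ u, b u ∈ T.level m)
    (hb' : ∀ u, b' u ∈ T.level m) (u : ℝ) :
    HasDerivAt (fun u => ScScale.toLev (b u) (hb u)) (ScScale.toLev (b' u) (hb' u)) u := by
  rw [hasDerivAt_iff_isLittleO_nhds_zero, Asymptotics.isLittleO_iff]
  intro c hc
  filter_upwards [h m u ⟨c, hc.le⟩ hc] with τ hτ
  rw [← ENNReal.ofReal_le_ofReal_iff (by positivity), ofReal_norm, T.lev_enorm,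
    ENNReal.ofReal_mul hc.le, ofReal_norm]
  simp only [map_sub, map_smul, ScScale.levIncl_toLev]
  refine hτ.trans (mul_le_mul' (le_of_eq ?_) le_rfl)
  exact (ENNReal.ofReal_eq_coe_nnreal hc.le).symm

/-! ## Families of operators of rank one -/

section RankOne

variable {H : Type u} [NormedAddCommGroup H] [InnerProductSpace ℝ H]
  {F : Type v} [AddCommGroup F] [Module ℝ F]

/-- The operators `t⁻ᵖ e^{q/t} ⟨a(e^{1/t}), ·⟩ b(e^{1/t})`, extended by zero to `t ≤ 0`. -/
def rankOne (a : ℝ → H) (b : ℝ → F) (p q : ℕ) (t : ℝ) : H →ₗ[ℝ] F :=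
  if 0 < t then ((1 / t) ^ p * Real.exp (1 / t) ^ q) •
    (innerₛₗ ℝ (a (Real.exp (1 / t)))).smulRight (b (Real.exp (1 / t))) else 0

theorem rankOne_of_pos (a : ℝ → H) (b : ℝ → F) (p q : ℕ) {t : ℝ} (ht : 0 < t) (x : H) :
    rankOne a b p q t x = ((1 / t) ^ p * Real.exp (1 / t) ^ q) •
      inner ℝ (a (Real.exp (1 / t))) x • b (Real.exp (1 / t)) := by
  simp [rankOne, ht]

theorem rankOne_of_nonpos (a : ℝ → H) (b : ℝ → F) (p q : ℕ) {t : ℝ} (ht : t ≤ 0) :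
    rankOne a b p q t = 0 := by
  simp [rankOne, ht.not_gt]

/-- The derivative of `rankOne a b p q`. -/
def rankOneDeriv (a a' : ℝ → H) (b b' : ℝ → F) (p q : ℕ) : ℝ → H →ₗ[ℝ] F :=
  (-(p : ℝ)) • rankOne a b (p + 1) q + (-(q : ℝ)) • rankOne a b (p + 2) q
    + (-1 : ℝ) • rankOne a' b (p + 2) (q + 1) + (-1 : ℝ) • rankOne a b' (p + 2) (q + 1)

theorem rankOneDeriv_of_nonpos (a a' : ℝ → H) (b b' : ℝ → F) (p q : ℕ) {t : ℝ} (ht : t ≤ 0) :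
    rankOneDeriv a a' b b' p q t = 0 := by
  simp [rankOneDeriv, rankOne_of_nonpos _ _ _ _ ht]

/-- Curves of vectors `a(u)` such that `⟨a(u), ·⟩` decays like `e^{-δₘ u / 2}` on level `m`. -/
structure IsDecaying (δ : ℕ → ℝ) (S : ScScale H) (a : ℝ → H) : Prop where
  bound : ∀ m, ∃ C : ℝ≥0, ∀ u, 0 ≤ u → ∀ x,
    ‖inner ℝ (a u) x‖ₑ ≤ C * ENNReal.ofReal (Real.exp (-(δ m * u / 2))) * S.nrm m x
  tail : ∀ m, ∀ x ∈ S.level m,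
    Tendsto (fun u => ENNReal.ofReal (Real.exp (δ m * u / 2)) * ‖inner ℝ (a u) x‖ₑ) atTop (𝓝 0)

/-- Curves of vectors which grow at most like `e^{δₘ u / 2}` on level `m`. -/
structure IsGrowing (δ : ℕ → ℝ) (T : ScScale F) (b : ℝ → F) : Prop where
  mem : ∀ m u, b u ∈ T.level m
  bound : ∀ m, ∃ C : ℝ≥0, ∀ u, 0 ≤ u →
    T.nrm m (b u) ≤ C * ENNReal.ofReal (Real.exp (δ m * u / 2))

theorem inv_le_exp_inv (t : ℝ) : 1 / t ≤ Real.exp (1 / t) :=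
  (by linarith : 1 / t ≤ 1 / t + 1).trans (Real.add_one_le_exp _)

/-- The constant comes from keeping only the `N`-th term of the series of `e^{cx}`. -/
theorem pow_mul_exp_neg_le {c : ℝ} (hc : 0 < c) (N : ℕ) {x : ℝ} (hx : 0 ≤ x) :
    x ^ N * Real.exp (-(c * x)) ≤ N.factorial / c ^ N := by
  have h := Real.pow_div_factorial_le_exp (c * x) (by positivity) N
  rw [Real.exp_neg, ← div_eq_mul_inv, div_le_div_iff₀ (Real.exp_pos _) (by positivity)]
  rw [div_le_iff₀ (by positivity), mul_pow] at h
  linarith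

variable {δ : ℕ → ℝ} {S : ScScale H} {T : ScScale F} {a a' : ℝ → H} {b b' : ℝ → F}

/-- With `u = e^{1/t}` the scalar factor is at most `u^{p+q}`, pairing with `a(u)` decays according
to the level `m'` of the argument, and `b(u)` grows according to the level `m` of the value.
Everything below comes from comparing `δ m'` with `δ m`. -/
theorem rankOne_bound (ha : IsDecaying δ S a) (hb : IsGrowing δ T b) (m m' : ℕ) :
    ∃ C : ℝ≥0, ∀ p q t, 0 < t → ∀ x, T.nrm m (rankOne a b p q t x) ≤
      C * ENNReal.ofReal (Real.exp (1 / t) ^ (p + q)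
        * Real.exp (-((δ m' - δ m) / 2 * Real.exp (1 / t)))) * S.nrm m' x := by
  obtain ⟨C, hC⟩ := ha.bound m'
  obtain ⟨D, hD⟩ := hb.bound m
  refine ⟨C * D, fun p q t ht x => ?_⟩
  rw [rankOne_of_pos a b p q ht, T.nrm_smul, T.nrm_smul]
  set X := Real.exp (1 / t) with hX
  have hX0 : 0 < X := Real.exp_pos _
  have h1 : ‖(1 / t) ^ p * X ^ q‖ₑ ≤ ENNReal.ofReal (X ^ (p + q)) := by
    rw [← ofReal_norm, Real.norm_of_nonneg (by positivity), pow_add]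
    refine ENNReal.ofReal_le_ofReal ?_
    gcongr
    exact inv_le_exp_inv t
  have h2 : Real.exp (-((δ m' - δ m) / 2 * X))
      = Real.exp (-(δ m' * X / 2)) * Real.exp (δ m * X / 2) := by
    rw [← Real.exp_add]; congr 1; ring
  rw [h2, ENNReal.ofReal_mul (by positivity), ENNReal.ofReal_mul (by positivity)]
  calc _ ≤ ENNReal.ofReal (X ^ (p + q)) * ((C * ENNReal.ofReal (Real.exp (-(δ m' * X / 2)))
        * S.nrm m' x) * (D * ENNReal.ofReal (Real.exp (δ m * X / 2)))) := by
        gcongr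
        · exact hC X hX0.le x
        · exact hD X hX0.le
    _ = _ := by push_cast; ring

/-- One spare level gives exponential decay in `u = e^{1/t}`, hence a bound for `u^{p+q+2}` times
the decaying factor. Two of these powers are traded for `t²` through `1 ≤ u t`. Quadratic vanishing
is what makes the derivative at `t = 0` equal to zero. -/
theorem rankOne_bound_sq (hδ : StrictMono δ) (ha : IsDecaying δ S a) (hb : IsGrowing δ T b)
    (p q m : ℕ) : ∃ C : ℝ≥0, ∀ t, 0 < t → ∀ x, T.nrm m (rankOne a b p q t x) ≤
      C * ENNReal.ofReal (t ^ 2) * S.nrm (m + 1) x := by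
  obtain ⟨C, hC⟩ := rankOne_bound ha hb m (m + 1)
  set c := (δ (m + 1) - δ m) / 2 with hc
  have hc0 : 0 < c := half_pos (sub_pos.2 (hδ m.lt_succ_self))
  set M := ((p + q + 2).factorial : ℝ) / c ^ (p + q + 2) with hM
  have hM0 : 0 ≤ M := by positivity
  refine ⟨C * M.toNNReal, fun t ht x => (hC p q t ht x).trans ?_⟩
  push_cast
  rw [mul_assoc (C : ℝ≥0∞) (M.toNNReal : ℝ≥0∞)]
  refine mul_le_mul' (mul_le_mul' le_rfl ?_) le_rfl
  rw [show ((M.toNNReal : ℝ≥0) : ℝ≥0∞) = ENNReal.ofReal M from rfl, ← ENNReal.ofReal_mul hM0]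
  refine ENNReal.ofReal_le_ofReal ?_
  set X := Real.exp (1 / t) with hX
  have hX0 : 0 < X := Real.exp_pos _
  have h1 := pow_mul_exp_neg_le hc0 (p + q + 2) hX0.le
  have h2 : 1 ≤ X * t := by
    have := inv_le_exp_inv t
    rwa [div_le_iff₀ ht] at this
  calc X ^ (p + q) * Real.exp (-(c * X))
      ≤ X ^ (p + q) * Real.exp (-(c * X)) * (X * t) ^ 2 :=
        le_mul_of_one_le_right (by positivity) (one_le_pow₀ h2)
    _ = X ^ (p + q + 2) * Real.exp (-(c * X)) * t ^ 2 := by ring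
    _ ≤ M * t ^ 2 := by gcongr

/-- On equal levels growth and decay cancel exactly. Nothing is left to absorb a scalar factor,
hence `p = q = 0`. -/
theorem unifBdd_rankOne_zero (ha : IsDecaying δ S a) (hb : IsGrowing δ T b) :
    UnifBdd S T (rankOne a b 0 0) := by
  intro m
  obtain ⟨C, hC⟩ := rankOne_bound ha hb m m
  refine ⟨C, fun t x => ?_⟩
  rcases lt_or_ge 0 t with ht | ht
  · simpa using hC 0 0 t ht x
  · simp [rankOne_of_nonpos a b 0 0 ht, T.nrm_zero]

theorem unifBdd_rankOne_shift (hδ : StrictMono δ) (ha : IsDecaying δ S a) (hb : IsGrowing δ T b)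
    (p q : ℕ) : UnifBdd S.shift T (rankOne a b p q) := by
  intro m
  obtain ⟨C, hC⟩ := rankOne_bound ha hb m (m + 1)
  set c := (δ (m + 1) - δ m) / 2 with hc
  have hc0 : 0 < c := half_pos (sub_pos.2 (hδ m.lt_succ_self))
  refine ⟨C * (((p + q).factorial : ℝ) / c ^ (p + q)).toNNReal, fun t x => ?_⟩
  rcases lt_or_ge 0 t with ht | ht
  · refine (hC p q t ht x).trans ?_
    push_cast
    refine mul_le_mul' (mul_le_mul' le_rfl (ENNReal.ofReal_le_ofReal ?_)) le_rfl
    exact pow_mul_exp_neg_le hc0 (p + q) (Real.exp_pos _).le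
  · simp [rankOne_of_nonpos a b p q ht, T.nrm_zero]

theorem hasDerivAt_one_div {t : ℝ} (ht : t ≠ 0) :
    HasDerivAt (fun t : ℝ => 1 / t) (-(1 / t) ^ 2) t := by
  simp only [one_div]
  exact (hasDerivAt_inv ht).congr_deriv (by rw [inv_pow])

theorem hasDerivAt_exp_inv {t : ℝ} (ht : t ≠ 0) :
    HasDerivAt (fun t : ℝ => Real.exp (1 / t)) (-(1 / t) ^ 2 * Real.exp (1 / t)) t := by
  exact (hasDerivAt_one_div ht).exp.congr_deriv (by ring)

theorem hasDerivAt_coeff (p q : ℕ) {t : ℝ} (ht : t ≠ 0) :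
    HasDerivAt (fun t : ℝ => (1 / t) ^ p * Real.exp (1 / t) ^ q)
      (-(p : ℝ) * ((1 / t) ^ (p + 1) * Real.exp (1 / t) ^ q)
        - q * ((1 / t) ^ (p + 2) * Real.exp (1 / t) ^ q)) t := by
  refine (((hasDerivAt_one_div ht).pow p).mul ((hasDerivAt_exp_inv ht).pow q)).congr_deriv ?_
  rcases p with _ | p <;> rcases q with _ | q <;> simp <;> ring

/-- The operators of `rankOne` for positive `t`, as continuous operators to level `m`. -/
def rankOneLev (a : ℝ → H) {m : ℕ} (b : ℝ → T.Lev m) (p q : ℕ) (t : ℝ) : H →L[ℝ] T.Lev m :=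
  ((1 / t) ^ p * Real.exp (1 / t) ^ q) •
    ContinuousLinearMap.smulRightL ℝ H (T.Lev m) (innerSL ℝ (a (Real.exp (1 / t))))
      (b (Real.exp (1 / t)))

theorem levIncl_rankOneLev (a : ℝ → H) {m : ℕ} (b : ℝ → T.Lev m) (p q : ℕ) {t : ℝ} (ht : 0 < t)
    (x : H) : T.levIncl m (rankOneLev a b p q t x)
      = rankOne a (fun u => T.levIncl m (b u)) p q t x := by
  rw [rankOne_of_pos _ _ _ _ ht, ← map_smul, ← map_smul]
  rfl

/-- The derivative of `e^{1/t}` is `-t⁻² e^{1/t}`. Hence differentiating `a` or `b` raises `p` by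
two and `q` by one, and the scalar factor contributes the two terms with `p + 1` and `p + 2`. -/
theorem hasDerivAt_rankOneLev {m : ℕ} {b b' : ℝ → T.Lev m}
    (ha : ∀ u, HasDerivAt a (a' u) u) (hb : ∀ u, HasDerivAt b (b' u) u) (p q : ℕ) {t : ℝ}
    (ht : t ≠ 0) : HasDerivAt (rankOneLev a b p q)
      ((-(p : ℝ)) • rankOneLev a b (p + 1) q t + (-(q : ℝ)) • rankOneLev a b (p + 2) q t
    + (-1 : ℝ) • rankOneLev a' b (p + 2) (q + 1) t
    + (-1 : ℝ) • rankOneLev a b' (p + 2) (q + 1) t) t := by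
  have h1 := hasDerivAt_exp_inv ht
  have h2 : HasDerivAt (fun t => innerSL ℝ (a (Real.exp (1 / t)))) _ t :=
    (innerSL ℝ (E := H)).hasFDerivAt.comp_hasDerivAt t ((ha _).scomp t h1)
  have h3 := (hb _).scomp t h1
  have h4 := (ContinuousLinearMap.smulRightL ℝ H (T.Lev m)).hasDerivAt_of_bilinear (fun _ => h2) (fun _ => h3)
  have h5 := (hasDerivAt_coeff p q ht).smul h4
  refine h5.congr_deriv ?_
  simp only [rankOneLev, Function.comp, map_smul, smul_add, smul_smul, _root_.smul_apply,
    sub_smul]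
  module

theorem tendsto_rankOne_of_pos (ha : ∀ u, HasDerivAt a (a' u) u) (hb : IsGrowing δ T b)
    (hb' : IsGrowing δ T b') (hbb' : HasScaleDeriv T b b') (p q m : ℕ) {t : ℝ} (ht : 0 < t)
    (x : H) : Tendsto (fun s => T.nrm m (rankOne a b p q s x - rankOne a b p q t x))
      (𝓝 t) (𝓝 0) := by
  have h := (hasDerivAt_rankOneLev ha (hbb'.hasDerivAt (hb.mem m) (hb'.mem m)) p q ht.ne').continuousAt
  have h1 := (h.clm_apply (continuousAt_const (y := x)))
  have h2 := tendsto_iff_edist_tendsto_0.1 h1.tendsto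
  refine tendsto_zero_of_le h2 ?_
  filter_upwards [lt_mem_nhds ht] with s hs
  rw [edist_eq_enorm_sub, T.lev_enorm, map_sub, levIncl_rankOneLev _ _ _ _ hs,
    levIncl_rankOneLev _ _ _ _ ht]
  simp

theorem eventually_rankOne_of_neg (a : ℝ → H) (b : ℝ → F) (p q : ℕ) {t : ℝ} (ht : t < 0) :
    ∀ᶠ s in 𝓝 t, rankOne a b p q s = 0 := by
  filter_upwards [gt_mem_nhds ht] with s hs using rankOne_of_nonpos _ _ _ _ hs.le

/-- For `t < 0` the family vanishes nearby and for `t > 0` it is differentiable, so only the limit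
from the right at `0` is a condition. The source scale is left free in order to serve both with and
without loss of a level. -/
theorem strongCont_rankOne_of_zero (ha : ∀ u, HasDerivAt a (a' u) u) (hb : IsGrowing δ T b)
    (hb' : IsGrowing δ T b') (hbb' : HasScaleDeriv T b b') (p q : ℕ) {R : ScScale H}
    (h0 : ∀ m, ∀ x ∈ R.level m, Tendsto (fun s => T.nrm m (rankOne a b p q s x)) (𝓝[>] 0) (𝓝 0)) :
    StrongCont R T (rankOne a b p q) := by
  intro m t x hx
  rcases lt_trichotomy t 0 with ht | rfl | ht
  · refine tendsto_const_nhds.congr' ?_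
    filter_upwards [eventually_rankOne_of_neg a b p q ht] with s hs
    rw [hs, rankOne_of_nonpos _ _ _ _ ht.le]
    simp [T.nrm_zero]
  · rw [← nhdsLE_sup_nhdsGT, tendsto_sup]
    constructor
    · refine tendsto_const_nhds.congr' ?_
      filter_upwards [self_mem_nhdsWithin] with s hs
      rw [rankOne_of_nonpos _ _ _ _ hs, rankOne_of_nonpos _ _ _ _ le_rfl]
      simp [T.nrm_zero]
    · simpa [rankOne_of_nonpos a b p q le_rfl] using h0 m x hx
  · exact tendsto_rankOne_of_pos ha hb hb' hbb' p q m ht x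

theorem tendsto_exp_inv : Tendsto (fun t : ℝ => Real.exp (1 / t)) (𝓝[>] 0) atTop := by
  simp only [one_div]
  exact Real.tendsto_exp_atTop.comp tendsto_inv_nhdsGT_zero

/-- No level is lost here, so the operators need not tend to zero in norm. For a fixed vector the
limit at `t = 0` comes from the tail condition: what `a(u)` sees of `x` vanishes even after
multiplication by `e^{δₘ u / 2}`. -/
theorem strongCont_rankOne_zero (hd : IsDecaying δ S a) (ha : ∀ u, HasDerivAt a (a' u) u)
    (hb : IsGrowing δ T b) (hb' : IsGrowing δ T b') (hbb' : HasScaleDeriv T b b') :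
    StrongCont S T (rankOne a b 0 0) := by
  refine strongCont_rankOne_of_zero ha hb hb' hbb' 0 0 fun m x hx => ?_
  obtain ⟨C, hC⟩ := hb.bound m
  refine tendsto_zero_of_le (tendsto_const_mul_zero ((hd.tail m x hx).comp tendsto_exp_inv)
    (C := C) ENNReal.coe_ne_top) ?_
  filter_upwards [self_mem_nhdsWithin] with s hs
  rw [rankOne_of_pos _ _ _ _ hs, T.nrm_smul, T.nrm_smul]
  simp only [pow_zero, mul_one, enorm_one, one_mul, Function.comp]
  rw [← mul_assoc, mul_comm]
  gcongr
  exact hC _ (Real.exp_pos _).le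

theorem strongCont_rankOne_shift (hδ : StrictMono δ) (hd : IsDecaying δ S a)
    (ha : ∀ u, HasDerivAt a (a' u) u) (hb : IsGrowing δ T b) (hb' : IsGrowing δ T b')
    (hbb' : HasScaleDeriv T b b') (p q : ℕ) : StrongCont S.shift T (rankOne a b p q) := by
  refine strongCont_rankOne_of_zero ha hb hb' hbb' p q fun m x hx => ?_
  obtain ⟨C, hC⟩ := rankOne_bound_sq hδ hd hb p q m
  have hx' : S.nrm (m + 1) x < ∞ := hx
  have ht : Tendsto (fun t : ℝ => ENNReal.ofReal (t ^ 2)) (𝓝[>] 0) (𝓝 0) := by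
    have : Continuous (fun t : ℝ => ENNReal.ofReal (t ^ 2)) :=
      ENNReal.continuous_ofReal.comp (by fun_prop)
    simpa using (this.tendsto 0).mono_left (nhdsWithin_le_nhds (s := Set.Ioi 0))
  refine tendsto_zero_of_le (tendsto_const_mul_zero ht (C := C * S.nrm (m + 1) x)
    (ENNReal.mul_ne_top ENNReal.coe_ne_top hx'.ne)) ?_
  filter_upwards [self_mem_nhdsWithin] with s hs
  exact (hC s hs x).trans_eq (by ring)

/-- For `t < 0` the family is locally zero. At `t = 0` the quadratic bound makes the increment
`o(τ)`. For `t > 0` the classical derivative in the norm of operators from `H` to level `m`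
suffices, since by `hS` the norm of `H` is dominated by every level. -/
theorem famDeriv_rankOne (hδ : StrictMono δ) (hS : ∀ x, ‖x‖ₑ ≤ S.nrm 0 x) (hd : IsDecaying δ S a)
    (ha : ∀ u, HasDerivAt a (a' u) u) (hb : IsGrowing δ T b) (hb' : IsGrowing δ T b')
    (hbb' : HasScaleDeriv T b b') (p q : ℕ) :
    FamDeriv S T (rankOne a b p q) (rankOneDeriv a a' b b' p q) := by
  intro m t ε hε
  rcases lt_trichotomy t 0 with ht | rfl | ht
  · have : Tendsto (fun τ => t + τ) (𝓝 0) (𝓝 t) := by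
      have : Continuous fun τ : ℝ => t + τ := by fun_prop
      simpa using this.tendsto 0
    filter_upwards [this.eventually (eventually_rankOne_of_neg a b p q ht)] with τ hτ x
    rw [hτ, rankOne_of_nonpos _ _ _ _ ht.le, rankOneDeriv_of_nonpos _ _ _ _ _ _ ht.le]
    simp [T.nrm_zero]
  · obtain ⟨C, hC⟩ := rankOne_bound_sq hδ hd hb p q m
    have hm : Tendsto (fun τ : ℝ => (C : ℝ≥0∞) * ‖τ‖ₑ) (𝓝 0) (𝓝 0) := by
      have h1 := continuous_enorm.tendsto (0 : ℝ)
      rw [enorm_zero] at h1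
      exact tendsto_const_mul_zero h1 ENNReal.coe_ne_top
    filter_upwards [hm.eventually (gt_mem_nhds (show (0 : ℝ≥0∞) < ε by exact_mod_cast hε))]
      with τ hτ x
    rw [zero_add, rankOne_of_nonpos _ _ _ _ le_rfl, rankOneDeriv_of_nonpos _ _ _ _ _ _ le_rfl]
    simp only [LinearMap.zero_apply, sub_zero, smul_zero]
    rcases lt_or_ge 0 τ with h0 | h0
    · refine (hC τ h0 x).trans ?_
      have : ENNReal.ofReal (τ ^ 2) = ‖τ‖ₑ * ‖τ‖ₑ := by
        rw [← ofReal_norm, ← ENNReal.ofReal_mul (norm_nonneg _), ← sq]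
        simp
      rw [this, ← mul_assoc]
      gcongr
    · simp [rankOne_of_nonpos a b p q h0, T.nrm_zero]
  · have h := hasDerivAt_rankOneLev ha (hbb'.hasDerivAt (hb.mem m) (hb'.mem m)) p q ht.ne'
    obtain ⟨D, hD⟩ := S.nrm_zero_le (m + 1)
    rw [hasDerivAt_iff_isLittleO_nhds_zero, Asymptotics.isLittleO_iff] at h
    have hε' : 0 < ε / (D + 1) := by positivity
    have : Tendsto (fun τ => t + τ) (𝓝 0) (𝓝 t) := by
      have : Continuous fun τ : ℝ => t + τ := by fun_prop
      simpa using this.tendsto 0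
    filter_upwards [h (show (0 : ℝ) < (ε / (D + 1) : ℝ≥0) from hε'),
      this.eventually (lt_mem_nhds ht)] with τ hτ ht' x
    have h1 := (ContinuousLinearMap.le_of_opNorm_le _ hτ x)
    rw [← ENNReal.ofReal_le_ofReal_iff (by positivity), ofReal_norm, T.lev_enorm,
      ENNReal.ofReal_mul (by positivity), ENNReal.ofReal_mul (by positivity),
      ofReal_norm, ofReal_norm, ENNReal.ofReal_coe_nnreal] at h1
    simp only [_root_.sub_apply, _root_.smul_apply,
      _root_.add_apply, map_sub, map_smul, map_add,
      levIncl_rankOneLev _ _ _ _ ht, levIncl_rankOneLev _ _ _ _ ht', ScScale.levIncl_toLev] at h1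
    simp only [rankOneDeriv, Pi.add_apply, Pi.smul_apply, LinearMap.add_apply, LinearMap.smul_apply]
    refine h1.trans ?_
    calc ((ε / (D + 1) : ℝ≥0) : ℝ≥0∞) * ‖τ‖ₑ * ‖x‖ₑ
        ≤ ((ε / (D + 1) : ℝ≥0) : ℝ≥0∞) * ‖τ‖ₑ * (D * S.nrm (m + 1) x) := by
          gcongr; exact (hS x).trans (hD x)
      _ = ((ε / (D + 1) * D : ℝ≥0) : ℝ≥0∞) * ‖τ‖ₑ * S.nrm (m + 1) x := by push_cast; ring
      _ ≤ ε * ‖τ‖ₑ * S.nrm (m + 1) x := by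
        gcongr
        rw [div_mul_eq_mul_div, div_le_iff₀ (by positivity)]
        gcongr
        simp

/-- A set of decaying curves which is closed under differentiation. -/
structure IsDecayingClass (δ : ℕ → ℝ) (S : ScScale H) (𝓐 : Set (ℝ → H)) : Prop where
  isDecaying : ∀ a ∈ 𝓐, IsDecaying δ S a
  deriv : ∀ a ∈ 𝓐, ∃ a' ∈ 𝓐, ∀ u, HasDerivAt a (a' u) u

/-- A set of growing curves which is closed under differentiation. -/
structure IsGrowingClass (δ : ℕ → ℝ) (T : ScScale F) (𝓑 : Set (ℝ → F)) : Prop where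
  isGrowing : ∀ b ∈ 𝓑, IsGrowing δ T b
  deriv : ∀ b ∈ 𝓑, ∃ b' ∈ 𝓑, HasScaleDeriv T b b'

variable {𝓐 : Set (ℝ → H)} {𝓑 : Set (ℝ → F)}

/-- The derivative is a combination of families of the same kind, with other `p`, `q` and with `a`,
`b` replaced by their derivatives in the two classes. The induction therefore runs over all of these
at once. -/
theorem isFam_rankOne_shift (hδ : StrictMono δ) (hS : ∀ x, ‖x‖ₑ ≤ S.nrm 0 x)
    (hA : IsDecayingClass δ S 𝓐) (hB : IsGrowingClass δ T 𝓑) (k p q : ℕ) (ha : a ∈ 𝓐)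
    (hb : b ∈ 𝓑) : IsFam k S.shift T (rankOne a b p q) := by
  induction k generalizing p q a b with
  | zero =>
    obtain ⟨a', -, h1⟩ := hA.deriv a ha
    obtain ⟨b', hb', h2⟩ := hB.deriv b hb
    exact ⟨unifBdd_rankOne_shift hδ (hA.isDecaying a ha) (hB.isGrowing b hb) p q,
      strongCont_rankOne_shift hδ (hA.isDecaying a ha) h1 (hB.isGrowing b hb)
        (hB.isGrowing b' hb') h2 p q⟩
  | succ k ih =>
    obtain ⟨a', ha', h1⟩ := hA.deriv a ha
    obtain ⟨b', hb', h2⟩ := hB.deriv b hb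
    refine ⟨unifBdd_rankOne_shift hδ (hA.isDecaying a ha) (hB.isGrowing b hb) p q,
      strongCont_rankOne_shift hδ (hA.isDecaying a ha) h1 (hB.isGrowing b hb)
        (hB.isGrowing b' hb') h2 p q, rankOneDeriv a a' b b' p q,
      (famDeriv_rankOne hδ hS (hA.isDecaying a ha) h1 (hB.isGrowing b hb)
        (hB.isGrowing b' hb') h2 p q).mono, ?_⟩
    exact ((((ih (p + 1) q ha hb).smul _).add ((ih (p + 2) q ha hb).smul _)).add
      ((ih (p + 2) (q + 1) ha' hb).smul _)).add ((ih (p + 2) (q + 1) ha hb').smul _) |>.mono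

/-- For `p = q = 0` the family itself needs no spare level; from the first derivative on, the
preceding lemma applies. -/
theorem isFam_rankOne_zero (hδ : StrictMono δ) (hS : ∀ x, ‖x‖ₑ ≤ S.nrm 0 x)
    (hA : IsDecayingClass δ S 𝓐) (hB : IsGrowingClass δ T 𝓑) (k : ℕ) (ha : a ∈ 𝓐)
    (hb : b ∈ 𝓑) : IsFam k S T (rankOne a b 0 0) := by
  obtain ⟨a', ha', h1⟩ := hA.deriv a ha
  obtain ⟨b', hb', h2⟩ := hB.deriv b hb
  have hbd := unifBdd_rankOne_zero (hA.isDecaying a ha) (hB.isGrowing b hb)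
  have hsc := strongCont_rankOne_zero (hA.isDecaying a ha) h1 (hB.isGrowing b hb)
    (hB.isGrowing b' hb') h2
  cases k with
  | zero => exact ⟨hbd, hsc⟩
  | succ k =>
    have ih : ∀ p q, ∀ a ∈ 𝓐, ∀ b ∈ 𝓑, IsFam k S.shift T (rankOne a b p q) :=
      fun p q a ha b hb => isFam_rankOne_shift hδ hS hA hB k p q ha hb
    refine ⟨hbd, hsc, rankOneDeriv a a' b b' 0 0,
      famDeriv_rankOne hδ hS (hA.isDecaying a ha) h1 (hB.isGrowing b hb)
        (hB.isGrowing b' hb') h2 0 0, ?_⟩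
    exact ((((ih (0 + 1) 0 a ha b hb).smul _).add ((ih (0 + 2) 0 a ha b hb).smul _)).add
      ((ih (0 + 2) (0 + 1) a' ha' b hb).smul _)).add ((ih (0 + 2) (0 + 1) a ha b' hb').smul _)

/-- Constant curves are growing curves in a constant scale. -/
theorem isGrowingClass_const {V : Type*} [NormedAddCommGroup V] [NormedSpace ℝ V]
    (hδ : ∀ m, 0 ≤ δ m) :
    IsGrowingClass δ (ScScale.const V) (Set.range fun v : V => fun _ : ℝ => v) where
  isGrowing := by
    rintro _ ⟨v, rfl⟩
    refine ⟨fun m u => show ‖v‖ₑ < ∞ from enorm_lt_top, fun m => ⟨‖v‖₊, fun u hu => ?_⟩⟩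
    refine le_mul_of_one_le_right' (a := ‖v‖ₑ) ?_
    rw [ENNReal.one_le_ofReal]
    exact Real.one_le_exp (by have := hδ m; positivity)
  deriv := by
    rintro _ ⟨v, rfl⟩
    refine ⟨_, ⟨0, rfl⟩, fun m u ε hε => .of_forall fun τ => ?_⟩
    simp [(ScScale.const V).nrm_zero]

end RankOne

/-! ## Test functions -/

/-- Smooth functions on the real line with compact support. -/
structure TestFn where
  toFun : ℝ → ℝ
  smooth : ContDiff ℝ (⊤ : ℕ∞) toFun
  compact : HasCompactSupport toFun

namespace TestFn

instance : CoeFun TestFn fun _ => ℝ → ℝ := ⟨toFun⟩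

theorem contDiffAt (a : TestFn) (n : ℕ) (s : ℝ) : ContDiffAt ℝ n a s :=
  (a.smooth.of_le (by exact_mod_cast le_top)).contDiffAt

/-- The derivative. -/
def deriv (a : TestFn) : TestFn where
  toFun := _root_.deriv a
  smooth := (contDiff_infty_iff_deriv.1 a.smooth).2
  compact := a.compact.deriv

/-- The translate `a(· + u)`. -/
def shift (a : TestFn) (u : ℝ) : TestFn where
  toFun s := a (s + u)
  smooth := a.smooth.comp (contDiff_id.add contDiff_const)
  compact := a.compact.comp_homeomorph (Homeomorph.addRight u)

/-- The remainder `a(· + τ) - a - τ a'`. -/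
def remainder (a : TestFn) (τ : ℝ) : TestFn where
  toFun s := a (s + τ) - a s - τ • a.deriv s
  smooth := ((a.shift τ).smooth.sub a.smooth).sub (a.deriv.smooth.const_smul τ)
  compact := ((a.shift τ).compact.sub a.compact).sub (a.deriv.compact.smul_left (f := fun _ => τ))

theorem hasDerivAt (a : TestFn) (s : ℝ) : HasDerivAt a (a.deriv s) s :=
  (a.smooth.differentiable (by simp) s).hasDerivAt

theorem hasDerivAt_iteratedDeriv (a : TestFn) (j : ℕ) (s : ℝ) :
    HasDerivAt (iteratedDeriv j a) (iteratedDeriv (j + 1) a s) s := by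
  rw [iteratedDeriv_succ]
  refine DifferentiableAt.hasDerivAt ?_
  exact (a.smooth.differentiable_iteratedDeriv j (by exact_mod_cast WithTop.coe_lt_top j)) s

theorem iteratedDeriv_deriv (a : TestFn) (j : ℕ) :
    iteratedDeriv j a.deriv = iteratedDeriv (j + 1) a := iteratedDeriv_succ'.symm

theorem iteratedDeriv_shift (a : TestFn) (j : ℕ) (u s : ℝ) :
    iteratedDeriv j (a.shift u) s = iteratedDeriv j a (s + u) :=
  congrFun (iteratedDeriv_comp_add_const j a.toFun u) s

theorem iteratedDeriv_remainder (a : TestFn) (j : ℕ) (τ s : ℝ) :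
    iteratedDeriv j (a.remainder τ) s
      = iteratedDeriv j a (s + τ) - iteratedDeriv j a s - τ • iteratedDeriv (j + 1) a s := by
  have h : (a.remainder τ).toFun = (a.shift τ).toFun - a.toFun - τ • a.deriv.toFun := rfl
  have h1 : ContDiffAt ℝ j ((a.shift τ).toFun - a.toFun) s :=
    ((a.shift τ).contDiffAt j s).sub (a.contDiffAt j s)
  have h2 : ContDiffAt ℝ j (τ • a.deriv.toFun) s := (a.deriv.contDiffAt j s).const_smul τ
  rw [h, iteratedDeriv_sub h1 h2,
    iteratedDeriv_sub ((a.shift τ).contDiffAt j s) (a.contDiffAt j s),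
    iteratedDeriv_const_smul_field, iteratedDeriv_shift, iteratedDeriv_deriv]

theorem exists_bound (a : TestFn) (m : ℕ) :
    ∃ B : ℝ, 0 ≤ B ∧ ∀ j ≤ m, ∀ s, |iteratedDeriv j a s| ≤ B := by
  have h : ∀ j, ∃ B, ∀ s, ‖iteratedDeriv j a s‖ ≤ B := fun j =>
    (GammaData.hasCompactSupport_iteratedDeriv a.compact j).exists_bound_of_continuous
      (GammaData.continuous_iteratedDeriv a.smooth j)
  choose B hB using h
  have hB0 : ∀ j, 0 ≤ B j := fun j => (norm_nonneg _).trans (hB j 0)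
  exact ⟨∑ j ∈ Finset.range (m + 1), B j, Finset.sum_nonneg fun j _ => hB0 j, fun j hj s =>
    (hB j s).trans (Finset.single_le_sum (fun j _ => hB0 j) (by simp; omega))⟩

theorem exists_radius (a : TestFn) :
    ∃ R : ℝ, 0 ≤ R ∧ ∀ j s, R < |s| → iteratedDeriv j a s = 0 := by
  obtain ⟨R, hR⟩ := a.compact.isCompact.isBounded.subset_closedBall 0
  refine ⟨max R 0, le_max_right _ _, fun j s hs => ?_⟩
  have hopen : IsOpen {s : ℝ | max R 0 < |s|} := isOpen_lt continuous_const continuous_abs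
  have hev : a.toFun =ᶠ[𝓝 s] fun _ => 0 := by
    filter_upwards [hopen.mem_nhds hs] with x hx
    by_contra hne
    have := hR (subset_tsupport a.toFun hne)
    rw [mem_closedBall_zero_iff, Real.norm_eq_abs] at this
    exact absurd (this.trans (le_max_left _ 0)) (not_le.2 hx)
  rw [hev.iteratedDeriv_eq j]
  simp

theorem memLp (a : TestFn) : MemLp a 2 (volume : Measure ℝ) :=
  a.smooth.continuous.memLp_of_hasCompactSupport a.compact

/-- The class of `a(· + u)` in `L²`. -/
def tr (a : TestFn) (u : ℝ) : Lp ℝ 2 (volume : Measure ℝ) := (a.shift u).memLp.toLp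

theorem coeFn_tr (a : TestFn) (u : ℝ) : a.tr u =ᵐ[volume] fun s => a (s + u) :=
  (a.shift u).memLp.coeFn_toLp

/-- Translation commutes with forming the Taylor remainder. Differentiability of the translates thus
becomes a norm estimate for a single translated test function. -/
theorem tr_remainder (a : TestFn) (u τ : ℝ) :
    a.tr (u + τ) - a.tr u - τ • a.deriv.tr u = (a.remainder τ).tr u := by
  refine Lp.ext ?_
  filter_upwards [Lp.coeFn_sub (a.tr (u + τ) - a.tr u) (τ • a.deriv.tr u),
    Lp.coeFn_sub (a.tr (u + τ)) (a.tr u), Lp.coeFn_smul τ (a.deriv.tr u), a.coeFn_tr (u + τ),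
    a.coeFn_tr u, a.deriv.coeFn_tr u, (a.remainder τ).coeFn_tr u] with s h1 h2 h3 h4 h5 h6 h7
  rw [h1, Pi.sub_apply, h2, Pi.sub_apply, h3, Pi.smul_apply, h4, h5, h6, h7]
  simp only [remainder]
  rw [show s + (u + τ) = s + u + τ by ring]

theorem isWeakDeriv (a : TestFn) (j : ℕ) : IsWeakDeriv j a (iteratedDeriv j a) := by
  refine ⟨(GammaData.continuous_iteratedDeriv a.smooth j).locallyIntegrable, fun φ h1 h2 => ?_⟩
  induction j generalizing a with
  | zero => simp
  | succ j ih =>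
    have hφ : Continuous (iteratedDeriv j φ) := GammaData.continuous_iteratedDeriv h1 j
    have hφ' : Continuous (iteratedDeriv (j + 1) φ) := GammaData.continuous_iteratedDeriv h1 (j + 1)
    let ψ : TestFn := ⟨φ, h1, h2⟩
    have hint : ∀ (b : TestFn) (g : ℝ → ℝ), Continuous g → Integrable (b.toFun * g) :=
      fun b g hg => (b.smooth.continuous.mul hg).integrable_of_hasCompactSupport
        b.compact.mul_right
    rw [integral_mul_deriv_eq_deriv_mul_of_integrable (fun s _ => a.hasDerivAt s)
      (fun s _ => ψ.hasDerivAt_iteratedDeriv j s) (hint a _ hφ') (hint a.deriv _ hφ)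
      (hint a _ hφ), ih a.deriv, iteratedDeriv_deriv, pow_succ]
    ring

/-- The mean value inequality is used twice: for `f'`, and then for `x ↦ f (s + x) - x f'(s)` on
`|x| ≤ |τ|`, whose derivative is at most `B |τ|`. The factor `1/2` of Taylor's formula is not
needed. -/
theorem abs_remainder_le {f f' f'' : ℝ → ℝ} (hf : ∀ s, HasDerivAt f (f' s) s)
    (hf' : ∀ s, HasDerivAt f' (f'' s) s) {B : ℝ} (hB : ∀ s, |f'' s| ≤ B) (s τ : ℝ) :
    |f (s + τ) - f s - τ • f' s| ≤ B * τ ^ 2 := by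
  have hlip : ∀ x y, |f' y - f' x| ≤ B * |y - x| := fun x y =>
    convex_univ.norm_image_sub_le_of_norm_hasDerivWithin_le
      (fun z _ => (hf' z).hasDerivWithinAt) (fun z _ => hB z) (Set.mem_univ x) (Set.mem_univ y)
  have hB0 : 0 ≤ B := (abs_nonneg _).trans (hB 0)
  have hd : ∀ x, HasDerivAt (fun x => f (s + x) - x • f' s) (f' (s + x) - f' s) x := by
    intro x
    have h1 := (hf (s + x)).comp_const_add s x
    have h2 : HasDerivAt (fun x : ℝ => x • f' s) (f' s) x := by
      simpa using (hasDerivAt_id x).smul_const (f' s)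
    exact h1.sub h2
  have := (convex_closedBall (0 : ℝ) |τ|).norm_image_sub_le_of_norm_hasDerivWithin_le
    (fun z _ => (hd z).hasDerivWithinAt) (C := B * |τ|) (x := 0) (y := τ)
    (fun z hz => ?_) (by simp) (by simp)
  · simp only [add_zero, zero_smul, sub_zero, Real.norm_eq_abs] at this
    rw [mul_assoc, ← abs_mul, ← sq, abs_sq] at this
    rwa [show f (s + τ) - f s - τ • f' s = f (s + τ) - τ • f' s - f s by ring]
  · refine (hlip s (s + z)).trans ?_
    rw [add_sub_cancel_left]
    rw [mem_closedBall_zero_iff, Real.norm_eq_abs] at hz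
    gcongr

end TestFn

/-! ## Estimates in the weighted Sobolev norms -/

namespace GammaData

variable {k : ℕ} (D : GammaData k)

theorem δ_nonneg (m : ℕ) : 0 ≤ D.δ m := D.δ_zero ▸ D.δ_strictMono.monotone (Nat.zero_le m)

theorem mul_β_le (s : ℝ) : s * D.β s ≤ |s| := by
  refine (le_abs_self _).trans ?_
  rw [abs_mul]
  exact mul_le_of_le_one_right (abs_nonneg s) (D.β_abs_le s)

/-- Outside `(-1, 1)` the product `s β(s)` equals `|s|`; inside, it is at least `-1`, which exceeds
`|s| - 2`. -/
theorem le_mul_β (s : ℝ) : |s| - 2 ≤ s * D.β s := by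
  rcases le_or_gt 1 |s| with hs | hs
  · rcases le_abs.1 hs with h | h
    · rw [D.β_one s h, abs_of_pos (by linarith)]; linarith
    · have := D.β_odd s
      rw [D.β_one _ h] at this
      rw [abs_of_neg (by linarith)]
      nlinarith
  · have : |s * D.β s| ≤ 1 := by
      rw [abs_mul]
      exact mul_le_one₀ hs.le (abs_nonneg _) (D.β_abs_le s)
    linarith [(abs_le.1 this).1]

/-- The weighted `L²` norm over a set. -/
def weightedL2 (m : ℕ) (f : ℝ → ℝ) (A : Set ℝ) : ℝ≥0∞ :=
  (∫⁻ s in A, ‖f s‖ₑ ^ 2 * D.weight m s) ^ (1 / 2 : ℝ)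

theorem weightedL2_le_sobolevNorm (m : ℕ) (f : Lp ℝ 2 (volume : Measure ℝ)) (A : Set ℝ) :
    D.weightedL2 m f A ≤ D.sobolevNorm m f := by
  refine le_iInf₂ fun g hg => ENNReal.rpow_le_rpow ?_ (by norm_num)
  refine (setLIntegral_le_lintegral A _).trans (lintegral_mono_ae ?_)
  filter_upwards [(hg 0 (Nat.zero_le m)).ae_eq (locallyIntegrable_coe f)] with s hs
  rw [hs]
  gcongr
  exact Finset.single_le_sum (f := fun j => ‖g j s‖ₑ ^ 2) (fun _ _ => bot_le) (by simp)

theorem weightedL2_zero (f : Lp ℝ 2 (volume : Measure ℝ)) :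
    D.weightedL2 0 f Set.univ = ‖f‖ₑ := by
  rw [Lp.enorm_def, eLpNorm_eq_lintegral_rpow_enorm_toReal (by norm_num) (by norm_num)]
  simp [weightedL2, weight, D.δ_zero]

theorem enorm_le_sobolevNorm (f : Lp ℝ 2 (volume : Measure ℝ)) : ‖f‖ₑ ≤ D.sobolevNorm 0 f :=
  D.weightedL2_zero f ▸ D.weightedL2_le_sobolevNorm 0 f Set.univ

theorem sobolevNorm_zero (f : Lp ℝ 2 (volume : Measure ℝ)) : D.sobolevNorm 0 f = ‖f‖ₑ := by
  refine le_antisymm ?_ (D.enorm_le_sobolevNorm f)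
  rw [← D.weightedL2_zero]
  refine (iInf₂_le (fun _ => (f : ℝ → ℝ)) fun j hj => ?_).trans_eq ?_
  · rw [Nat.le_zero.1 hj]
    exact ⟨locallyIntegrable_coe f, fun φ _ _ => by simp⟩
  · simp [weightedNorm, weightedL2]

/-- The translate is supported in `[-R - u, R - u]`, an interval of length `2R` on which `|s| ≤ R +
|u|`; hence the weight is at most `e^{δₘ (R + |u|)}`, and there are `m + 1` derivatives of size at
most `B`. As the norm is an infimum, inserting the classical derivatives gives an upper bound. -/
theorem sobolevNorm_tr_le (a : TestFn) (m : ℕ) {R B : ℝ} (hR0 : 0 ≤ R)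
    (hB : ∀ j ≤ m, ∀ s, |iteratedDeriv j a s| ≤ B)
    (hR : ∀ j s, R < |s| → iteratedDeriv j a s = 0) (u : ℝ) :
    D.sobolevNorm m (a.tr u) ≤ ENNReal.ofReal (B *
      (Real.sqrt ((m + 1) * (2 * R) * Real.exp (D.δ m * R)) * Real.exp (D.δ m * |u| / 2))) := by
  have hB0 : 0 ≤ B := (abs_nonneg _).trans (hB 0 (Nat.zero_le m) 0)
  have hδ := D.δ_nonneg m
  have hw : ∀ j ≤ m, IsWeakDeriv j (a.tr u) (iteratedDeriv j (a.shift u)) := fun j _ =>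
    ((a.shift u).isWeakDeriv j).congr (a.coeFn_tr u).symm
  refine (iInf₂_le (fun j => iteratedDeriv j (a.shift u)) hw).trans ?_
  set K : ℝ := (m + 1) * B ^ 2 * Real.exp (D.δ m * (R + |u|)) with hK
  have hpt : ∀ s, (∑ j ∈ Finset.range (m + 1), ‖iteratedDeriv j (a.shift u) s‖ₑ ^ 2)
      * D.weight m s ≤ (Set.Icc (-R - u) (R - u)).indicator (fun _ => ENNReal.ofReal K) s := by
    intro s
    by_cases hs : s ∈ Set.Icc (-R - u) (R - u)
    · rw [Set.indicator_of_mem hs]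
      have h1 : ∑ j ∈ Finset.range (m + 1), ‖iteratedDeriv j (a.shift u) s‖ₑ ^ 2
          ≤ ENNReal.ofReal ((m + 1) * B ^ 2) := by
        calc ∑ j ∈ Finset.range (m + 1), ‖iteratedDeriv j (a.shift u) s‖ₑ ^ 2
            ≤ ∑ j ∈ Finset.range (m + 1), ENNReal.ofReal (B ^ 2) := by
              refine Finset.sum_le_sum fun j hj => ?_
              rw [a.iteratedDeriv_shift, ← ofReal_norm, ← ENNReal.ofReal_pow (norm_nonneg _)]
              refine ENNReal.ofReal_le_ofReal ?_
              gcongr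
              exact hB j (by simpa [Nat.lt_succ_iff] using hj) _
          _ = ENNReal.ofReal ((m + 1) * B ^ 2) := by
              rw [Finset.sum_const, Finset.card_range, ← ENNReal.ofReal_nsmul]
              simp
      rw [hK, ENNReal.ofReal_mul (by positivity)]
      refine mul_le_mul' h1 (ENNReal.ofReal_le_ofReal (Real.exp_le_exp.2 ?_))
      have h2 : |s| ≤ R + |u| := by
        rw [abs_le]
        constructor
        · linarith [hs.1, le_abs_self u]
        · linarith [hs.2, neg_abs_le u]
      rw [mul_assoc]
      gcongr
      exact (D.mul_β_le s).trans h2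
    · rw [Set.indicator_of_notMem hs]
      have h1 : R < |s + u| := by
        by_contra hle
        rw [not_lt, abs_le] at hle
        exact hs ⟨by linarith [hle.1], by linarith [hle.2]⟩
      simp [a.iteratedDeriv_shift, hR _ _ h1]
  calc D.weightedNorm m (fun j => iteratedDeriv j (a.shift u))
      ≤ (∫⁻ s, (Set.Icc (-R - u) (R - u)).indicator (fun _ => ENNReal.ofReal K) s) ^ (1 / 2 : ℝ) :=
        ENNReal.rpow_le_rpow (lintegral_mono hpt) (by norm_num)
    _ = ENNReal.ofReal (K * (2 * R)) ^ (1 / 2 : ℝ) := by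
        rw [lintegral_indicator_const measurableSet_Icc, Real.volume_Icc,
          ← ENNReal.ofReal_mul (by positivity)]
        congr 3
        ring
    _ = ENNReal.ofReal (Real.sqrt (K * (2 * R))) := by
        rw [ENNReal.ofReal_rpow_of_nonneg (by positivity) (by norm_num), Real.sqrt_eq_rpow]
    _ = _ := by
        congr 1
        rw [show K * (2 * R) = B ^ 2 * (((m + 1) * (2 * R) * Real.exp (D.δ m * R))
          * Real.exp (D.δ m * |u| / 2) ^ 2) by
            rw [← Real.exp_nat_mul, hK, mul_add, Real.exp_add]; push_cast; ring_nf]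
        rw [Real.sqrt_mul (by positivity), Real.sqrt_mul (by positivity), Real.sqrt_sq hB0,
          Real.sqrt_sq (by positivity)]

theorem tr_mem_level (a : TestFn) (m : ℕ) (u : ℝ) : a.tr u ∈ D.sobolevScale.level m := by
  obtain ⟨B, hB0, hB⟩ := a.exists_bound m
  obtain ⟨R, hR0, hR⟩ := a.exists_radius
  exact (D.sobolevNorm_tr_le a m hR0 hB hR u).trans_lt ENNReal.ofReal_lt_top

theorem isGrowing_tr (a : TestFn) : IsGrowing D.δ D.sobolevScale a.tr where
  mem m u := D.tr_mem_level a m u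
  bound m := by
    obtain ⟨B, hB0, hB⟩ := a.exists_bound m
    obtain ⟨R, hR0, hR⟩ := a.exists_radius
    refine ⟨(B * Real.sqrt ((m + 1) * (2 * R) * Real.exp (D.δ m * R))).toNNReal, fun u hu => ?_⟩
    refine (D.sobolevNorm_tr_le a m hR0 hB hR u).trans_eq ?_
    rw [abs_of_nonneg hu, ← mul_assoc, ENNReal.ofReal_mul (by positivity)]
    rfl

theorem hasScaleDeriv_tr (a : TestFn) : HasScaleDeriv D.sobolevScale a.tr a.deriv.tr := by
  intro m u ε hε
  -- The remainder of the `j`-th derivative is controlled by derivative `j + 2`, and `j` runs up to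
  -- `m`.
  obtain ⟨B, hB0, hB⟩ := a.exists_bound (m + 2)
  obtain ⟨R, hR0, hR⟩ := a.exists_radius
  set K := Real.sqrt ((m + 1) * (2 * (R + 1)) * Real.exp (D.δ m * (R + 1)))
    * Real.exp (D.δ m * |u| / 2) with hK
  have hK0 : 0 ≤ K := by positivity
  have hlim : Tendsto (fun τ : ℝ => B * K * |τ|) (𝓝 0) (𝓝 0) := by
    have : Continuous fun τ : ℝ => B * K * |τ| := by fun_prop
    simpa using this.tendsto 0
  -- For `|τ| ≤ 1` the remainder is supported within radius `R + 1`, independently of `τ`.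
  filter_upwards [Metric.closedBall_mem_nhds (0 : ℝ) one_pos,
    hlim.eventually (ge_mem_nhds (show (0 : ℝ) < ε from hε))] with τ hτ hτ'
  rw [mem_closedBall_zero_iff, Real.norm_eq_abs] at hτ
  rw [a.tr_remainder]
  refine (D.sobolevNorm_tr_le (a.remainder τ) m (R := R + 1) (B := B * τ ^ 2) (by positivity)
    (fun j hj s => ?_) (fun j s hs => ?_) u).trans ?_
  · rw [a.iteratedDeriv_remainder]
    exact TestFn.abs_remainder_le (a.hasDerivAt_iteratedDeriv j)
      (a.hasDerivAt_iteratedDeriv (j + 1)) (hB (j + 2) (by omega)) s τ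
  · have h1 : R < |s + τ| := by
      have := abs_sub_abs_le_abs_sub s (-τ)
      rw [abs_neg, sub_neg_eq_add] at this
      linarith
    have h2 : R < |s| := by linarith
    rw [a.iteratedDeriv_remainder, hR j _ h1, hR j s h2, hR (j + 1) s h2]
    simp
  · rw [← hK, ← ofReal_norm, ← ENNReal.ofReal_coe_nnreal, ← ENNReal.ofReal_mul ε.coe_nonneg]
    refine ENNReal.ofReal_le_ofReal ?_
    calc B * τ ^ 2 * K = B * K * |τ| * |τ| := by rw [← sq_abs]; ring
      _ ≤ ε * ‖τ‖ := by rw [Real.norm_eq_abs]; gcongr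

theorem isGrowingClass_tr : IsGrowingClass D.δ D.sobolevScale (Set.range TestFn.tr) where
  isGrowing := by rintro _ ⟨a, rfl⟩; exact D.isGrowing_tr a
  deriv := by rintro _ ⟨a, rfl⟩; exact ⟨_, ⟨a.deriv, rfl⟩, D.hasScaleDeriv_tr a⟩

theorem _root_.TestFn.hasDerivAt_tr (a : TestFn) (D : GammaData k) (u : ℝ) :
    HasDerivAt a.tr (a.deriv.tr u) u := by
  rw [hasDerivAt_iff_isLittleO_nhds_zero, Asymptotics.isLittleO_iff]
  intro c hc
  lift c to ℝ≥0 using hc.le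
  filter_upwards [D.hasScaleDeriv_tr a 0 u c hc] with τ hτ
  have h1 := (D.enorm_le_sobolevNorm _).trans hτ
  rw [← ofReal_norm, ← ofReal_norm, ← ENNReal.ofReal_coe_nnreal, ← ENNReal.ofReal_mul hc.le,
    ENNReal.ofReal_le_ofReal_iff (by positivity)] at h1
  exact h1

/-- Cauchy–Schwarz on the support of the translate, where the weight is at least `e^{δₘ (u - R -
2)}`. The right side keeps the weighted norm over the half-line `s ≤ R - u` only. One estimate then
yields both the uniform decay and, by `tendsto_weightedL2_Iic`, the tail condition. -/
theorem enorm_inner_tr_le (a : TestFn) : ∃ R : ℝ, ∀ m, ∃ C : ℝ≥0, ∀ u,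
    ∀ f : Lp ℝ 2 (volume : Measure ℝ), ‖inner ℝ (a.tr u) f‖ₑ ≤
      C * ENNReal.ofReal (Real.exp (-(D.δ m * u / 2))) * D.weightedL2 m f (Set.Iic (R - u)) := by
  obtain ⟨B, hB0, hB⟩ := a.exists_bound 0
  obtain ⟨R, hR0, hR⟩ := a.exists_radius
  refine ⟨R, fun m => ?_⟩
  have hδ := D.δ_nonneg m
  refine ⟨(B * Real.sqrt (2 * R) * Real.exp (D.δ m * (R + 2) / 2)).toNNReal, fun u f => ?_⟩
  set I := Set.Icc (-R - u) (R - u) with hI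
  have hfm : AEMeasurable (fun s => ‖f s‖ₑ) (volume.restrict I) :=
    (Lp.memLp f).1.enorm.restrict
  have h1 : ‖inner ℝ (a.tr u) f‖ₑ ≤ ∫⁻ s in I, ENNReal.ofReal B * ‖f s‖ₑ := by
    rw [L2.inner_def, ← lintegral_indicator measurableSet_Icc]
    refine (enorm_integral_le_lintegral_enorm _).trans (lintegral_mono_ae ?_)
    filter_upwards [a.coeFn_tr u] with s hs
    rw [hs]
    by_cases hsI : s ∈ I
    · rw [Set.indicator_of_mem hsI]
      simp only [RCLike.inner_apply, conj_trivial, enorm_mul]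
      rw [mul_comm]
      gcongr
      rw [← ofReal_norm]
      refine ENNReal.ofReal_le_ofReal ?_
      simpa using hB 0 le_rfl (s + u)
    · have h1 : R < |s + u| := by
        by_contra hle
        rw [not_lt, abs_le] at hle
        exact hsI ⟨by linarith [hle.1], by linarith [hle.2]⟩
      have := hR 0 _ h1
      rw [iteratedDeriv_zero] at this
      simp [this]
  have h2 : ∫⁻ s in I, ENNReal.ofReal B * ‖f s‖ₑ ≤
      ENNReal.ofReal (B * Real.sqrt (2 * R)) * (∫⁻ s in I, ‖f s‖ₑ ^ 2) ^ (1 / 2 : ℝ) := by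
    have := ENNReal.lintegral_mul_le_Lp_mul_Lq (volume.restrict I)
      (Real.HolderConjugate.two_two) (f := fun _ => ENNReal.ofReal B) aemeasurable_const hfm
    refine this.trans ?_
    simp only [ENNReal.rpow_ofNat]
    gcongr
    rw [lintegral_const, Measure.restrict_apply_univ, hI, Real.volume_Icc, ← ENNReal.ofReal_pow hB0,
      ← ENNReal.ofReal_mul (by positivity),
      ENNReal.ofReal_rpow_of_nonneg (by nlinarith [sq_nonneg B]) (by norm_num), ← Real.sqrt_eq_rpow,
      Real.sqrt_mul (by positivity), Real.sqrt_sq hB0]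
    refine ENNReal.ofReal_le_ofReal ?_
    ring_nf
    rfl
  have h3 : (∫⁻ s in I, ‖f s‖ₑ ^ 2) ^ (1 / 2 : ℝ) ≤
      ENNReal.ofReal (Real.exp (-(D.δ m * (u - R - 2) / 2)))
        * D.weightedL2 m f (Set.Iic (R - u)) := by
    have e : ENNReal.ofReal (Real.exp (-(D.δ m * (u - R - 2) / 2)))
        = ENNReal.ofReal (Real.exp (-(D.δ m * (u - R - 2)))) ^ (1 / 2 : ℝ) := by
      rw [ENNReal.ofReal_rpow_of_nonneg (Real.exp_pos _).le (by norm_num), ← Real.exp_mul]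
      congr 2
      ring
    rw [e, weightedL2, ← ENNReal.mul_rpow_of_nonneg _ _ (by norm_num)]
    refine ENNReal.rpow_le_rpow ?_ (by norm_num)
    rw [← lintegral_const_mul' _ _ ENNReal.ofReal_ne_top]
    refine le_trans ?_ (lintegral_mono_set (Set.Icc_subset_Iic_self (a := -R - u)))
    refine setLIntegral_mono' measurableSet_Icc fun s hs => ?_
    rw [mul_left_comm]
    refine le_mul_of_one_le_right' ?_
    rw [weight, ← ENNReal.ofReal_mul (Real.exp_pos _).le, ← Real.exp_add, ENNReal.one_le_ofReal]
    refine Real.one_le_exp ?_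
    -- On the support `s ≤ R - u`, hence `|s| ≥ u - R`; the `2` is the loss in `le_mul_β`.
    have h4 : u - R - 2 ≤ s * D.β s := by
      have := D.le_mul_β s
      have h5 := neg_abs_le s
      linarith [hs.2]
    have := mul_le_mul_of_nonneg_left h4 hδ
    linarith
  refine h1.trans (h2.trans ((mul_le_mul' le_rfl h3).trans_eq ?_))
  rw [← mul_assoc]
  congr 1
  change _ = ENNReal.ofReal _ * _
  rw [← ENNReal.ofReal_mul (by positivity), ← ENNReal.ofReal_mul (by positivity), mul_assoc _
    (Real.exp _) (Real.exp _), ← Real.exp_add]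
  congr 3
  ring

theorem tendsto_weightedL2_Iic (m : ℕ) {f : Lp ℝ 2 (volume : Measure ℝ)}
    (hf : f ∈ D.sobolevScale.level m) (R : ℝ) :
    Tendsto (fun u => D.weightedL2 m f (Set.Iic (R - u))) atTop (𝓝 0) := by
  have hfin : ∫⁻ s, ‖f s‖ₑ ^ 2 * D.weight m s ≠ ∞ := by
    have h := (D.weightedL2_le_sobolevNorm m f Set.univ).trans_lt hf
    rw [weightedL2, Measure.restrict_univ, ENNReal.rpow_lt_top_iff_of_pos (by norm_num)] at h
    exact h.ne
  have hm : Measurable (fun s => ‖f s‖ₑ ^ 2 * D.weight m s) :=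
    ((Lp.stronglyMeasurable f).enorm.pow_const 2).mul (D.measurable_weight m)
  have h := tendsto_lintegral_filter_of_dominated_convergence (μ := volume) (l := atTop)
    (F := fun u => (Set.Iic (R - u)).indicator fun s => ‖f s‖ₑ ^ 2 * D.weight m s)
    (f := fun _ => 0) (fun s => ‖f s‖ₑ ^ 2 * D.weight m s)
    (.of_forall fun u => hm.indicator measurableSet_Iic)
    (.of_forall fun u => .of_forall fun s => Set.indicator_le_self _ _ s) hfin
    (.of_forall fun s => ?_)
  · simp only [lintegral_indicator measurableSet_Iic, lintegral_zero] at h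
    have := h.ennrpow_const (1 / 2)
    rwa [ENNReal.zero_rpow_of_pos (by norm_num)] at this
  · refine tendsto_const_nhds.congr' ?_
    filter_upwards [eventually_gt_atTop (R - s)] with u hu
    rw [Set.indicator_of_notMem]
    simp only [Set.mem_Iic, not_le]
    linarith

theorem isDecaying_tr (a : TestFn) : IsDecaying D.δ D.sobolevScale a.tr := by
  obtain ⟨R, hR⟩ := D.enorm_inner_tr_le a
  refine ⟨fun m => ?_, fun m f hf => ?_⟩
  · obtain ⟨C, hC⟩ := hR m
    refine ⟨C, fun u _ f => (hC u f).trans ?_⟩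
    gcongr
    exact D.weightedL2_le_sobolevNorm m f _
  · obtain ⟨C, hC⟩ := hR m
    refine tendsto_zero_of_le (tendsto_const_mul_zero (D.tendsto_weightedL2_Iic m hf R) (C := C)
      ENNReal.coe_ne_top) (.of_forall fun u => ?_)
    calc _ ≤ ENNReal.ofReal (Real.exp (D.δ m * u / 2)) * (C *
          ENNReal.ofReal (Real.exp (-(D.δ m * u / 2))) * D.weightedL2 m f (Set.Iic (R - u))) := by
          gcongr; exact hC u f
      _ = C * (ENNReal.ofReal (Real.exp (D.δ m * u / 2)) *
          ENNReal.ofReal (Real.exp (-(D.δ m * u / 2)))) * D.weightedL2 m f (Set.Iic (R - u)) := by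
          ring
      _ = _ := by
          rw [← ENNReal.ofReal_mul (Real.exp_pos _).le, ← Real.exp_add]
          simp

theorem isDecayingClass_tr : IsDecayingClass D.δ D.sobolevScale (Set.range TestFn.tr) where
  isDecaying := by rintro _ ⟨a, rfl⟩; exact D.isDecaying_tr a
  deriv := by rintro _ ⟨a, rfl⟩; exact ⟨_, ⟨a.deriv, rfl⟩, a.hasDerivAt_tr D⟩

/-- Test functions belong to every level, so `E₁` is dense in `E₀`. This makes linearizations unique
on all of `E₀`. -/
theorem dense_tr (f : Lp ℝ 2 (volume : Measure ℝ)) {ε : ℝ≥0∞} (hε : 0 < ε) :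
    ∃ a : TestFn, ‖f - a.tr 0‖ₑ < ε := by
  have h := Lp.dense_hasCompactSupport_contDiff (F := ℝ) (E := ℝ)
    (μ := (volume : Measure ℝ)) (p := 2) (by norm_num)
  obtain ⟨g, hg, φ, h1, h2, h3⟩ := h.inter_open_nonempty (Metric.eball f ε) Metric.isOpen_eball
    ⟨f, Metric.mem_eball_self hε⟩
  refine ⟨⟨φ, h3, h2⟩, ?_⟩
  have : g = TestFn.tr ⟨φ, h3, h2⟩ 0 := by
    refine Lp.ext ?_
    filter_upwards [h1, TestFn.coeFn_tr ⟨φ, h3, h2⟩ 0] with s h4 h5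
    rw [h4, h5, add_zero]
  rw [← this, ← edist_eq_enorm_sub, edist_comm]
  exact hg

end GammaData

/-! ### Finite sums of families and composition with linear maps -/

theorem IsFam.zero {E : Type u} {F : Type v} [AddCommGroup E] [Module ℝ E] [AddCommGroup F]
    [Module ℝ F] (S : ScScale E) (T : ScScale F) (k : ℕ) :
    IsFam k S T (0 : ℝ → E →ₗ[ℝ] F) := by
  have h1 : ∀ S : ScScale E, UnifBdd S T (0 : ℝ → E →ₗ[ℝ] F) :=
    fun S m => ⟨0, fun t x => by simp [T.nrm_zero]⟩
  have h2 : ∀ S : ScScale E, StrongCont S T (0 : ℝ → E →ₗ[ℝ] F) :=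
    fun S m t x _ => by simp [T.nrm_zero]
  induction k generalizing S with
  | zero => exact ⟨h1 S, h2 S⟩
  | succ k ih =>
    exact ⟨h1 S, h2 S, 0, fun m t ε _ => .of_forall fun τ x => by simp [T.nrm_zero], ih _⟩

theorem IsFam.sum {E : Type u} {F : Type v} [AddCommGroup E] [Module ℝ E] [AddCommGroup F]
    [Module ℝ F] {S : ScScale E} {T : ScScale F} {k : ℕ} {ι : Type*} (s : Finset ι)
    {A : ι → ℝ → E →ₗ[ℝ] F} (h : ∀ i ∈ s, IsFam k S T (A i)) : IsFam k S T (∑ i ∈ s, A i) := by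
  classical
  induction s using Finset.induction_on with
  | empty => simpa using IsFam.zero S T k
  | insert i s hi ih =>
    rw [Finset.sum_insert hi]
    exact (h i (by simp)).add (ih fun j hj => h j (by simp [hj]))

theorem FamDeriv.sum {E : Type u} {F : Type v} [AddCommGroup E] [Module ℝ E] [AddCommGroup F]
    [Module ℝ F] {S : ScScale E} {T : ScScale F} {ι : Type*} (s : Finset ι)
    {A A' : ι → ℝ → E →ₗ[ℝ] F} (h : ∀ i ∈ s, FamDeriv S T (A i) (A' i)) :
    FamDeriv S T (∑ i ∈ s, A i) (∑ i ∈ s, A' i) := by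
  classical
  induction s using Finset.induction_on with
  | empty =>
    exact fun m t ε _ => .of_forall fun τ x => by simp [T.nrm_zero]
  | insert i s hi ih =>
    rw [Finset.sum_insert hi, Finset.sum_insert hi]
    exact (h i (by simp)).add (ih fun j hj => h j (by simp [hj]))

theorem IsFam.isSc_comp {V : Type w} {E : Type u} {F : Type v} [AddCommGroup V] [Module ℝ V]
    [AddCommGroup E] [Module ℝ E] [AddCommGroup F] [Module ℝ F] {R : ScScale V} {S : ScScale E}
    {T : ScScale F} {k : ℕ} {A : ℝ → E →ₗ[ℝ] F} (h : IsFam k S T A) {c : V →ₗ[ℝ] ℝ}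
    (hc : IsScOp R (ScScale.const ℝ) c) {L : V →ₗ[ℝ] E} (hL : IsScOp R S L) (U : Set V) :
    IsSc k R T U (fun p => A (c p) (L p)) :=
  (h.isSc Set.univ).comp_op (hc.prod hL) fun _ _ => trivial

namespace TestFn

/-- Translation invariance of the integral: the Gram matrices of the translated functions and of
their derivatives do not depend on `u`. -/
theorem inner_tr (a b : TestFn) (u : ℝ) : inner ℝ (a.tr u) (b.tr u) = ∫ s, a s * b s := by
  rw [L2.inner_def, ← integral_add_right_eq_self (fun s => a s * b s) u]
  refine integral_congr_ae ?_
  filter_upwards [a.coeFn_tr u, b.coeFn_tr u] with s h1 h2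
  rw [h1, h2]
  simp [mul_comm]

theorem inner_deriv_tr (a b : TestFn) (u : ℝ) :
    inner ℝ (a.tr u) (b.deriv.tr u) = -inner ℝ (a.deriv.tr u) (b.tr u) := by
  rw [inner_tr, inner_tr]
  have := (a.isWeakDeriv 1).2 b b.smooth b.compact
  simp only [iteratedDeriv_one, pow_one, neg_one_mul] at this
  exact this

end TestFn

/-! ### Coordinates, frame and projections as families of rank one operators -/

namespace GammaData

variable {k : ℕ} (D : GammaData k)

/-- `γⱼ` as a test function. -/
def test (j : Fin k) : TestFn := ⟨D.γ j, D.γ_smooth j, D.γ_compact j⟩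

/-- The coordinate `⟨γⱼ(· + e^{1/t}), ·⟩`, zero for `t ≤ 0`. -/
def coord (j : Fin k) : ℝ → Lp ℝ 2 (volume : Measure ℝ) →ₗ[ℝ] ℝ :=
  rankOne (D.test j).tr (fun _ => (1 : ℝ)) 0 0

/-- The derivative of `coord` with respect to `t`. -/
def coordDeriv (j : Fin k) : ℝ → Lp ℝ 2 (volume : Measure ℝ) →ₗ[ℝ] ℝ :=
  (-1 : ℝ) • rankOne (D.test j).deriv.tr (fun _ => (1 : ℝ)) 2 1

/-- The frame `γⱼ(· + e^{1/t})`, zero for `t ≤ 0`. -/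
def frame (j : Fin k) (t : ℝ) : Lp ℝ 2 (volume : Measure ℝ) :=
  if 0 < t then (D.test j).tr (Real.exp (1 / t)) else 0

/-- The projection `π_t` as a linear map. -/
def projL : ℝ → Lp ℝ 2 (volume : Measure ℝ) →ₗ[ℝ] Lp ℝ 2 (volume : Measure ℝ) :=
  ∑ j, rankOne (D.test j).tr (D.test j).tr 0 0

/-- The part of the derivative of `π_t` in which the frame is differentiated. -/
def frameDeriv : ℝ → Lp ℝ 2 (volume : Measure ℝ) →ₗ[ℝ] Lp ℝ 2 (volume : Measure ℝ) :=
  ∑ j, (-1 : ℝ) • rankOne (D.test j).tr (D.test j).deriv.tr 2 1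

/-- The derivative of `π_t` with respect to `t`. -/
def projDeriv : ℝ → Lp ℝ 2 (volume : Measure ℝ) →ₗ[ℝ] Lp ℝ 2 (volume : Measure ℝ) :=
  ∑ j, (-1 : ℝ) • (rankOne (D.test j).deriv.tr (D.test j).tr 2 1
    + rankOne (D.test j).tr (D.test j).deriv.tr 2 1)

/-- `f ↦ (d/dt ⟨γⱼ(· + e^{1/t}), ·⟩) (π_t f)`. -/
def coordDerivProj (j : Fin k) : ℝ → Lp ℝ 2 (volume : Measure ℝ) →ₗ[ℝ] ℝ :=
  ∑ i, (-∫ s, (D.test j).deriv s * D.test i s) • rankOne (D.test i).tr (fun _ => (1 : ℝ)) 2 1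

/-! ### Identities -/

theorem inner_test (i j : Fin k) (u : ℝ) :
    inner ℝ ((D.test i).tr u) ((D.test j).tr u) = if i = j then 1 else 0 := by
  rw [TestFn.inner_tr]
  exact D.γ_orthonormal i j

variable {t : ℝ} (f : Lp ℝ 2 (volume : Measure ℝ))

theorem coord_of_pos (j : Fin k) (ht : 0 < t) :
    D.coord j t f = inner ℝ ((D.test j).tr (Real.exp (1 / t))) f := by
  simp [coord, rankOne_of_pos _ _ _ _ ht]

theorem coord_of_nonpos (j : Fin k) (ht : t ≤ 0) : D.coord j t = 0 :=
  rankOne_of_nonpos _ _ _ _ ht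

theorem coordDeriv_of_pos (j : Fin k) (ht : 0 < t) :
    D.coordDeriv j t f = -((1 / t) ^ 2 * Real.exp (1 / t)
      * inner ℝ ((D.test j).deriv.tr (Real.exp (1 / t))) f) := by
  simp [coordDeriv, rankOne_of_pos _ _ _ _ ht]

theorem coordDeriv_of_nonpos (j : Fin k) (ht : t ≤ 0) : D.coordDeriv j t = 0 := by
  simp [coordDeriv, rankOne_of_nonpos _ _ _ _ ht]

theorem frame_of_pos (j : Fin k) (ht : 0 < t) :
    D.frame j t = (D.test j).tr (Real.exp (1 / t)) := if_pos ht

theorem frame_of_nonpos (j : Fin k) (ht : t ≤ 0) : D.frame j t = 0 := if_neg ht.not_gt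

/-- This exhibits a scalar times a frame vector as the value of one rank one family. Such products
are smooth although the frame alone is not. -/
theorem rankOne_tr_frame (a : ℝ → Lp ℝ 2 (volume : Measure ℝ)) (j : Fin k) (p q : ℕ) (t : ℝ) :
    rankOne a (D.test j).tr p q t f = rankOne a (fun _ => (1 : ℝ)) p q t f • D.frame j t := by
  rcases lt_or_ge 0 t with ht | ht
  · simp [rankOne_of_pos _ _ _ _ ht, D.frame_of_pos j ht, mul_smul]
  · simp [rankOne_of_nonpos _ _ _ _ ht]

theorem projL_apply (t : ℝ) : D.projL t f = ∑ j, D.coord j t f • D.frame j t := by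
  simp only [projL, Finset.sum_apply, LinearMap.sum_apply, rankOne_tr_frame]
  rfl

theorem proj_eq (t : ℝ) : D.proj t f = D.projL t f := by
  unfold proj
  rw [projL_apply]
  split_ifs with ht
  · simp [D.coord_of_nonpos _ ht]
  · push Not at ht
    refine Finset.sum_congr rfl fun j _ => ?_
    rw [D.coord_of_pos f j ht, D.frame_of_pos j ht, real_inner_comm]
    rfl

theorem frameDeriv_of_pos (ht : 0 < t) : D.frameDeriv t f = ∑ j, D.coord j t f •
    (-((1 / t) ^ 2 * Real.exp (1 / t))) • (D.test j).deriv.tr (Real.exp (1 / t)) := by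
  simp only [frameDeriv, Finset.sum_apply, LinearMap.sum_apply, Pi.smul_apply, LinearMap.smul_apply,
    rankOne_of_pos _ _ _ _ ht, D.coord_of_pos f _ ht]
  refine Finset.sum_congr rfl fun j _ => ?_
  module

theorem frameDeriv_of_nonpos (ht : t ≤ 0) : D.frameDeriv t = 0 := by
  simp [frameDeriv, rankOne_of_nonpos _ _ _ _ ht]

theorem projDeriv_apply (t : ℝ) :
    D.projDeriv t f = ∑ j, D.coordDeriv j t f • D.frame j t + D.frameDeriv t f := by
  simp only [projDeriv, frameDeriv, coordDeriv, Finset.sum_apply, LinearMap.sum_apply,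
    Pi.smul_apply, LinearMap.smul_apply, Pi.add_apply, LinearMap.add_apply, smul_add,
    Finset.sum_add_distrib, rankOne_tr_frame, smul_assoc]

theorem coord_frame (i j : Fin k) (ht : 0 < t) :
    D.coord i t (D.frame j t) = if i = j then 1 else 0 := by
  rw [D.coord_of_pos _ i ht, D.frame_of_pos j ht, inner_test]

theorem coord_sum_frame (i : Fin k) (ht : 0 < t) (c : Fin k → ℝ) :
    D.coord i t (∑ j, c j • D.frame j t) = c i := by
  simp [D.coord_frame i _ ht]

theorem coord_projL (i : Fin k) (t : ℝ) : D.coord i t (D.projL t f) = D.coord i t f := by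
  rcases lt_or_ge 0 t with ht | ht
  · rw [projL_apply, D.coord_sum_frame i ht]
  · simp [D.coord_of_nonpos i ht]

theorem projL_projL (t : ℝ) : D.projL t (D.projL t f) = D.projL t f := by
  rw [projL_apply]
  simp only [coord_projL]
  rw [← projL_apply]

theorem frameDeriv_projL (t : ℝ) : D.frameDeriv t (D.projL t f) = D.frameDeriv t f := by
  rcases lt_or_ge 0 t with ht | ht
  · simp only [D.frameDeriv_of_pos _ ht, coord_projL]
  · simp [D.frameDeriv_of_nonpos ht]

/-- The products `⟨γⱼ', γᵢ⟩` are independent of the translation, so the composition is a combination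
of rank one families with constant coefficients. In this form it can be differentiated once more in
`t`. -/
theorem coordDerivProj_apply (j : Fin k) (t : ℝ) :
    D.coordDerivProj j t f = D.coordDeriv j t (D.projL t f) := by
  rcases lt_or_ge 0 t with ht | ht
  · rw [projL_apply, map_sum]
    simp only [coordDerivProj, Finset.sum_apply, LinearMap.sum_apply, Pi.smul_apply,
      LinearMap.smul_apply, rankOne_of_pos _ _ _ _ ht, real_inner_smul_right,
      D.coord_of_pos f _ ht, D.coordDeriv_of_pos _ j ht, D.frame_of_pos _ ht, TestFn.inner_tr,
      smul_eq_mul]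
    refine Finset.sum_congr rfl fun i _ => ?_
    ring
  · simp [coordDerivProj, rankOne_of_nonpos _ _ _ _ ht, D.coordDeriv_of_nonpos j ht]

/-- For `t > 0` this is the derivative of the orthonormality relations of the frame, that is,
integration by parts in `⟨γᵢ, γⱼ'⟩`. -/
theorem coord_frameDeriv (i : Fin k) (t : ℝ) :
    D.coord i t (D.frameDeriv t f) = -D.coordDeriv i t (D.projL t f) := by
  rcases lt_or_ge 0 t with ht | ht
  · rw [D.frameDeriv_of_pos f ht, projL_apply, map_sum, map_sum, ← Finset.sum_neg_distrib]
    simp only [real_inner_smul_right, D.coord_of_pos _ i ht, TestFn.inner_deriv_tr,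
      D.coordDeriv_of_pos _ i ht, D.frame_of_pos _ ht]
    refine Finset.sum_congr rfl fun j _ => ?_
    ring
  · simp [D.coord_of_nonpos i ht, D.coordDeriv_of_nonpos i ht]

theorem frame_mem_level (j : Fin k) (t : ℝ) (m : ℕ) : D.frame j t ∈ D.sobolevScale.level m := by
  rcases lt_or_ge 0 t with ht | ht
  · rw [D.frame_of_pos j ht]; exact D.tr_mem_level _ _ _
  · rw [D.frame_of_nonpos j ht]; exact Submodule.zero_mem _

theorem frameDeriv_mem_level (t : ℝ) (m : ℕ) : D.frameDeriv t f ∈ D.sobolevScale.level m := by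
  rcases lt_or_ge 0 t with ht | ht
  · rw [D.frameDeriv_of_pos f ht]
    exact Submodule.sum_mem _ fun j _ => Submodule.smul_mem _ _
      (Submodule.smul_mem _ _ (D.tr_mem_level _ _ _))
  · rw [D.frameDeriv_of_nonpos ht]; exact Submodule.zero_mem _

theorem projL_mem_level (t : ℝ) (m : ℕ) : D.projL t f ∈ D.sobolevScale.level m := by
  rw [projL_apply]
  exact Submodule.sum_mem _ fun j _ => Submodule.smul_mem _ _ (D.frame_mem_level j t m)

theorem mem_level_zero : f ∈ D.sobolevScale.level 0 :=
  (D.sobolevNorm_zero f).trans_lt enorm_lt_top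

/-! ### Differentiability -/

theorem isGrowingClass_one : IsGrowingClass D.δ (ScScale.const ℝ)
    (Set.range fun v : ℝ => fun _ : ℝ => v) := isGrowingClass_const D.δ_nonneg

theorem isFam_tr_tr (a b : TestFn) (m : ℕ) :
    IsFam m D.sobolevScale D.sobolevScale (rankOne a.tr b.tr 0 0) :=
  isFam_rankOne_zero D.δ_strictMono D.enorm_le_sobolevNorm D.isDecayingClass_tr
    D.isGrowingClass_tr m ⟨a, rfl⟩ ⟨b, rfl⟩

theorem isFam_tr_tr_shift (a b : TestFn) (p q m : ℕ) :
    IsFam m D.sobolevScale.shift D.sobolevScale (rankOne a.tr b.tr p q) :=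
  isFam_rankOne_shift D.δ_strictMono D.enorm_le_sobolevNorm D.isDecayingClass_tr
    D.isGrowingClass_tr m p q ⟨a, rfl⟩ ⟨b, rfl⟩

theorem isFam_tr_one_shift (a : TestFn) (p q m : ℕ) : IsFam m D.sobolevScale.shift
    (ScScale.const ℝ) (rankOne a.tr (fun _ => (1 : ℝ)) p q) :=
  isFam_rankOne_shift D.δ_strictMono D.enorm_le_sobolevNorm D.isDecayingClass_tr
    D.isGrowingClass_one m p q ⟨a, rfl⟩ ⟨1, rfl⟩

theorem isFam_coord (j : Fin k) (m : ℕ) :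
    IsFam m D.sobolevScale (ScScale.const ℝ) (D.coord j) :=
  isFam_rankOne_zero D.δ_strictMono D.enorm_le_sobolevNorm D.isDecayingClass_tr
    D.isGrowingClass_one m ⟨D.test j, rfl⟩ ⟨1, rfl⟩

theorem isFam_coordDeriv (j : Fin k) (m : ℕ) :
    IsFam m D.sobolevScale.shift (ScScale.const ℝ) (D.coordDeriv j) :=
  (D.isFam_tr_one_shift _ 2 1 m).smul _

theorem isFam_projL (m : ℕ) : IsFam m D.sobolevScale D.sobolevScale D.projL :=
  .sum _ fun _ _ => D.isFam_tr_tr _ _ m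

theorem isFam_frameDeriv (m : ℕ) : IsFam m D.sobolevScale.shift D.sobolevScale D.frameDeriv :=
  .sum _ fun _ _ => (D.isFam_tr_tr_shift _ _ 2 1 m).smul _

theorem isFam_projDeriv (m : ℕ) : IsFam m D.sobolevScale.shift D.sobolevScale D.projDeriv :=
  .sum _ fun _ _ => ((D.isFam_tr_tr_shift _ _ 2 1 m).add (D.isFam_tr_tr_shift _ _ 2 1 m)).smul _

theorem isFam_coordDerivProj (j : Fin k) (m : ℕ) :
    IsFam m D.sobolevScale.shift (ScScale.const ℝ) (D.coordDerivProj j) :=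
  .sum _ fun _ _ => (D.isFam_tr_one_shift _ 2 1 m).smul _

theorem famDeriv_coord (j : Fin k) :
    FamDeriv D.sobolevScale (ScScale.const ℝ) (D.coord j) (D.coordDeriv j) := by
  have h := famDeriv_rankOne D.δ_strictMono D.enorm_le_sobolevNorm (D.isDecaying_tr (D.test j))
    ((D.test j).hasDerivAt_tr D) (D.isGrowingClass_one.isGrowing _ ⟨1, rfl⟩)
    (D.isGrowingClass_one.isGrowing _ ⟨0, rfl⟩)
    (fun m u ε _ => .of_forall fun τ => by simp [(ScScale.const ℝ).nrm_zero]) 0 0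
  -- With `p = q = 0` the two terms from the scalar factor vanish, and the constant curve has
  -- derivative zero; only the derivative of `a` remains.
  have e : rankOneDeriv (D.test j).tr (D.test j).deriv.tr (fun _ => (1 : ℝ)) (fun _ => (0 : ℝ)) 0 0
      = D.coordDeriv j := by
    funext t
    refine LinearMap.ext fun x => ?_
    rcases lt_or_ge 0 t with ht | ht
    · simp [rankOneDeriv, coordDeriv, rankOne_of_pos _ _ _ _ ht]
    · simp [rankOneDeriv, coordDeriv, rankOne_of_nonpos _ _ _ _ ht]
  exact e ▸ h

theorem famDeriv_projL : FamDeriv D.sobolevScale D.sobolevScale D.projL D.projDeriv := by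
  refine .sum _ fun j _ => ?_
  have h := famDeriv_rankOne D.δ_strictMono D.enorm_le_sobolevNorm (D.isDecaying_tr (D.test j))
    ((D.test j).hasDerivAt_tr D) (D.isGrowing_tr (D.test j)) (D.isGrowing_tr (D.test j).deriv)
    (D.hasScaleDeriv_tr (D.test j)) 0 0
  have e : rankOneDeriv (D.test j).tr (D.test j).deriv.tr (D.test j).tr (D.test j).deriv.tr 0 0
      = (-1 : ℝ) • (rankOne (D.test j).deriv.tr (D.test j).tr 2 1
        + rankOne (D.test j).tr (D.test j).deriv.tr 2 1) := by
    simp [rankOneDeriv]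
  exact e ▸ h

end GammaData

/-! ## Linearizations and density -/

section

variable {E F : Type*} [AddCommGroup E] [Module ℝ E] [AddCommGroup F] [Module ℝ F]
  {S : ScScale E} {T : ScScale F} {U : Set E} {f : E → F} {x : E} {A : E →ₗ[ℝ] F}

theorem IsScDerivAt.scDeriv_isScDerivAt (h : IsScDerivAt S T U f x A) :
    IsScDerivAt S T U f x (scDeriv S T U f x) := by
  have h' : ∃ A : E →ₗ[ℝ] F, IsScDerivAt S T U f x A := ⟨A, h⟩
  rw [scDeriv, dif_pos h']
  exact h'.choose_spec

theorem IsScDerivAt.scDeriv_eq (h : IsScDerivAt S T U f x A) (hU : ∀ k ∈ S.level 1, x + k ∈ U)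
    {k : E} (hk : k ∈ S.level 1) : scDeriv S T U f x k = A k :=
  h.scDeriv_isScDerivAt.unique h hU hk

/-- If `E₁` is dense in `E₀`, the linearization is unique. -/
theorem IsScDerivAt.scDeriv_eq_of_dense (h : IsScDerivAt S T U f x A)
    (hU : ∀ k ∈ S.level 1, x + k ∈ U)
    (hd : ∀ k ∈ S.level 0, ∀ ε : ℝ≥0∞, 0 < ε → ∃ k' ∈ S.level 1, S.nrm 0 (k - k') < ε)
    {k : E} (hk : k ∈ S.level 0) : scDeriv S T U f x k = A k := by
  rw [← sub_eq_zero]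
  refine T.eq_zero_of_nrm 0 _ ?_
  obtain ⟨C, hC⟩ := h.scDeriv_isScDerivAt.1
  obtain ⟨C', hC'⟩ := h.1
  by_contra hne
  have hpos : 0 < T.nrm 0 (scDeriv S T U f x k - A k) := pos_iff_ne_zero.2 hne
  have hlim : Tendsto (fun ε : ℝ≥0∞ => ((C + C' : ℝ≥0) : ℝ≥0∞) * ε) (𝓝 0) (𝓝 0) :=
    tendsto_const_mul_zero tendsto_id ENNReal.coe_ne_top
  obtain ⟨ε, hε, hε'⟩ := ENNReal.nhds_zero_basis.eventually_iff.1
    (hlim.eventually (gt_mem_nhds hpos))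
  obtain ⟨k', hk', hlt⟩ := hd k hk ε hε
  have hk0 : k - k' ∈ S.level 0 := Submodule.sub_mem _ hk (S.level_succ_le 0 hk')
  -- Both operators agree at `k' ∈ E₁`, so only the small vector `k - k'` contributes.
  have e : scDeriv S T U f x k - A k = scDeriv S T U f x (k - k') - A (k - k') := by
    rw [map_sub, map_sub, h.scDeriv_eq hU hk']
    abel
  have := hε' hlt
  rw [e] at this
  refine absurd this (not_lt.2 ?_)
  refine (T.nrm_sub_le 0 _ _).trans ((add_le_add (hC _ hk0) (hC' _ hk0)).trans_eq ?_)
  push_cast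
  rw [add_mul]

end

/-! ## The geometry of `Γₙᵏ` -/

/-- The index set of the coordinates on `Γₙᵏ`. -/
abbrev GammaIdx (n k : ℕ) : Type := (Fin n ⊕ Unit) ⊕ Fin k

/-- The scale `ℝⁿ ⊕ ℝ ⊕ S`. -/
abbrev gammaScale (n : ℕ) (S : ScScale (Lp ℝ 2 (volume : Measure ℝ))) :
    ScScale (GammaAmbient n) :=
  (ScScale.const (EuclideanSpace ℝ (Fin n))).prod ((ScScale.const ℝ).prod S)

/-- The coordinate `t` on `ℝⁿ ⊕ ℝ ⊕ L²`. -/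
def timeL (n : ℕ) : GammaAmbient n →ₗ[ℝ] ℝ :=
  LinearMap.fst ℝ ℝ (Lp ℝ 2 (volume : Measure ℝ)) ∘ₗ LinearMap.snd ℝ _ _

/-- The component in `L²` on `ℝⁿ ⊕ ℝ ⊕ L²`. -/
def funL (n : ℕ) : GammaAmbient n →ₗ[ℝ] Lp ℝ 2 (volume : Measure ℝ) :=
  LinearMap.snd ℝ ℝ (Lp ℝ 2 (volume : Measure ℝ)) ∘ₗ LinearMap.snd ℝ _ _

/-- The coordinate `xᵢ` on `ℝⁿ ⊕ ℝ ⊕ L²`. -/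
def spaceL (n : ℕ) (i : Fin n) : GammaAmbient n →ₗ[ℝ] ℝ :=
  (EuclideanSpace.proj i : EuclideanSpace ℝ (Fin n) →L[ℝ] ℝ).toLinearMap ∘ₗ LinearMap.fst ℝ _ _

theorem timeL_apply {n : ℕ} (p : GammaAmbient n) : timeL n p = p.2.1 := rfl

theorem funL_apply {n : ℕ} (p : GammaAmbient n) : funL n p = p.2.2 := rfl

theorem isScOp_timeL (n : ℕ) (S : ScScale (Lp ℝ 2 (volume : Measure ℝ))) :
    IsScOp (gammaScale n S) (ScScale.const ℝ) (timeL n) :=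
  IsScOp.fst.comp IsScOp.snd

theorem isScOp_funL (n : ℕ) (S : ScScale (Lp ℝ 2 (volume : Measure ℝ))) :
    IsScOp (gammaScale n S) S (funL n) :=
  IsScOp.snd.comp IsScOp.snd

theorem isScOp_const {V W : Type*} [NormedAddCommGroup V] [NormedSpace ℝ V] [NormedAddCommGroup W]
    [NormedSpace ℝ W] (L : V →L[ℝ] W) :
    IsScOp (ScScale.const V) (ScScale.const W) L.toLinearMap :=
  fun _ => ⟨‖L‖₊, fun x => L.le_opENorm x⟩

theorem isScOp_spaceL (n : ℕ) (S : ScScale (Lp ℝ 2 (volume : Measure ℝ))) (i : Fin n) :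
    IsScOp (gammaScale n S) (ScScale.const ℝ) (spaceL n i) :=
  (isScOp_const (EuclideanSpace.proj i : EuclideanSpace ℝ (Fin n) →L[ℝ] ℝ)).comp IsScOp.fst

namespace GammaData

variable {n k : ℕ} (D : GammaData k)

/-- The differentials of the coordinates on `Γₙᵏ`. -/
def form : GammaIdx n k → GammaAmbient n → GammaAmbient n →ₗ[ℝ] ℝ
  | .inl (.inl i), _ => spaceL n i
  | .inl (.inr _), _ => timeL n
  | .inr j, x => D.coord j (timeL n x) ∘ₗ funL n
      + (timeL n).smulRight (D.coordDeriv j (timeL n x) (funL n x))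

/-- The differentials of all coordinates. -/
def formVec (x : GammaAmbient n) : GammaAmbient n →ₗ[ℝ] GammaIdx n k → ℝ :=
  LinearMap.pi fun a => D.form a x

/-- The tangent vector with given coordinates. -/
def synth (x : GammaAmbient n) : (GammaIdx n k → ℝ) →ₗ[ℝ] GammaAmbient n :=
  ((WithLp.linearEquiv 2 ℝ (Fin n → ℝ)).symm.toLinearMap ∘ₗ
    LinearMap.funLeft ℝ ℝ fun i => .inl (.inl i)).prod
  ((LinearMap.proj (.inl (.inr ()))).prod
    (∑ j, (LinearMap.proj (.inr j)).smulRight (D.frame j (timeL n x))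
      + (LinearMap.proj (.inl (.inr ()))).smulRight (D.frameDeriv (timeL n x) (funL n x))))

/-- The linearization of the retraction. -/
def gammaDr (x : GammaAmbient n) : GammaAmbient n →ₗ[ℝ] GammaAmbient n :=
  D.synth x ∘ₗ D.formVec x

theorem formVec_apply (x v : GammaAmbient n) (a : GammaIdx n k) :
    D.formVec x v a = D.form a x v := rfl

theorem form_time (x v : GammaAmbient n) : D.form (.inl (.inr ())) x v = v.2.1 := rfl

theorem form_coord (j : Fin k) (x v : GammaAmbient n) :
    D.form (.inr j) x v = D.coord j x.2.1 v.2.2 + v.2.1 * D.coordDeriv j x.2.1 x.2.2 := rfl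

theorem synth_apply (x : GammaAmbient n) (z : GammaIdx n k → ℝ) :
    D.synth x z = (WithLp.toLp 2 fun i => z (.inl (.inl i)), z (.inl (.inr ())),
      ∑ j, z (.inr j) • D.frame j x.2.1 + z (.inl (.inr ())) • D.frameDeriv x.2.1 x.2.2) := by
  refine Prod.ext rfl (Prod.ext rfl ?_)
  simp [synth, timeL_apply, funL_apply]

/-- The product rule for `π_t f = ∑ⱼ cⱼ γⱼ(· + e^{1/t})`: the derivatives of the coefficients enter
through `formVec`, those of the frame through `synth`. Thus the linearization of the retraction
factors through `ℝⁿ⁺¹⁺ᵏ`. -/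
theorem gammaDr_apply (x h : GammaAmbient n) : D.gammaDr x h
    = (h.1, h.2.1, D.projL x.2.1 h.2.2 + h.2.1 • D.projDeriv x.2.1 x.2.2) := by
  rw [gammaDr, LinearMap.comp_apply, synth_apply]
  refine Prod.ext rfl (Prod.ext rfl ?_)
  simp only [formVec_apply, form_coord, form_time, projDeriv_apply, projL_apply, add_smul, smul_add,
    Finset.sum_add_distrib, Finset.smul_sum, mul_smul]
  abel

theorem synth_mem_level (x : GammaAmbient n) (z : GammaIdx n k → ℝ) (m : ℕ) :
    D.synth x z ∈ (Gamma n D).scale.level m := by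
  rw [synth_apply]
  refine max_lt enorm_lt_top (max_lt enorm_lt_top ?_)
  exact Submodule.add_mem _ (Submodule.sum_mem _ fun j _ => Submodule.smul_mem _ _
    (D.frame_mem_level j _ m)) (Submodule.smul_mem _ _ (D.frameDeriv_mem_level _ _ m))

/-! ### The retraction -/

theorem gamma_r (p : GammaAmbient n) :
    (Gamma n D).r p = (p.1, timeL n p, D.projL (timeL n p) (funL n p)) := by
  rw [← D.proj_eq]
  rfl

theorem gamma_r_r (p : GammaAmbient n) : (Gamma n D).r ((Gamma n D).r p) = (Gamma n D).r p := by
  simp only [gamma_r]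
  refine Prod.ext rfl (Prod.ext rfl ?_)
  exact D.projL_projL _ _

/-- The level does not appear on the right: the image of `π_t` is spanned by test functions, so all
points of `X` lie in every level. -/
theorem mem_pts {x : GammaAmbient n} {m : ℕ} :
    x ∈ (Gamma n D).pts m ↔ D.projL x.2.1 x.2.2 = x.2.2 := by
  constructor
  · rintro ⟨⟨y, -, rfl⟩, -⟩
    rw [gamma_r]
    exact D.projL_projL _ _
  · intro h
    refine ⟨⟨x, trivial, ?_⟩, ?_⟩
    · rw [gamma_r]
      exact Prod.ext rfl (Prod.ext rfl h)
    · refine max_lt enorm_lt_top (max_lt enorm_lt_top ?_)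
      rw [← h]
      exact D.projL_mem_level _ _ m

theorem gamma_r_mem_pts (p : GammaAmbient n) (m : ℕ) : (Gamma n D).r p ∈ (Gamma n D).pts m := by
  rw [mem_pts, gamma_r]
  exact D.projL_projL _ _

/-- The scales are arguments so that the statement also covers the retraction of `X¹`. -/
theorem isSc_gamma_r {S T : ScScale (Lp ℝ 2 (volume : Measure ℝ))} {m : ℕ}
    (h : IsFam m S T D.projL) (U : Set (GammaAmbient n)) :
    IsSc m (gammaScale n S) (gammaScale n T) U (Gamma n D).r := by
  have h1 : IsSc m (gammaScale n S) (ScScale.const (EuclideanSpace ℝ (Fin n))) U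
      (LinearMap.fst ℝ _ _) := .op m IsScOp.fst U
  have h2 := IsSc.op m (isScOp_timeL n S) U
  have h3 := h.isSc_comp (isScOp_timeL n S) (isScOp_funL n S) U
  exact (h1.prodMk (h2.prodMk h3)).congr fun p _ => (D.gamma_r p).symm

theorem isScDerivAt_gamma_r (U : Set (GammaAmbient n)) {x : GammaAmbient n}
    (hx : x ∈ (Gamma n D).scale.level 1) :
    IsScDerivAt (Gamma n D).scale (Gamma n D).scale U (Gamma n D).r x (D.gammaDr x) := by
  have h1 : IsScDerivAt (Gamma n D).scale (ScScale.const (EuclideanSpace ℝ (Fin n))) U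
      (LinearMap.fst ℝ _ _) x (LinearMap.fst ℝ _ _) := .op IsScOp.fst U x
  have h2 : IsScDerivAt (Gamma n D).scale (ScScale.const ℝ) U (timeL n) x (timeL n) :=
    .op (isScOp_timeL n D.sobolevScale) U x
  have hx' : funL n x ∈ D.sobolevScale.level 1 :=
    (isScOp_funL n D.sobolevScale).map_level hx
  have h3 := D.famDeriv_projL.isScDerivAt_comp (D.isFam_projL 0).unifBdd
    (D.isFam_projDeriv 0).unifBdd (R := (Gamma n D).scale) (U := U)
    (IsScDerivAt.op (isScOp_funL n D.sobolevScale) U x) hx'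
    ((isScOp_funL n D.sobolevScale 1).imp fun C hC k _ => hC k) (isScOp_timeL n D.sobolevScale)
  have h4 := (h1.prodMk (h2.prodMk h3)).congr (g := (Gamma n D).r) (D.gamma_r x).symm
    fun p _ => (D.gamma_r p).symm
  have e : D.gammaDr x = _ := LinearMap.ext (g := (LinearMap.fst ℝ _ _).prod ((timeL n).prod
      (D.projL (timeL n x) ∘ₗ funL n
        + (timeL n).smulRight (D.projDeriv (timeL n x) (funL n x))))) fun h => D.gammaDr_apply x h
  rw [e]
  exact h4

theorem isScSmoothRetract_gamma : (Gamma n D).IsScSmoothRetract := by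
  refine ⟨fun x _ => ?_, fun x _ => ⟨1, one_pos, fun _ _ => trivial⟩, fun _ _ => trivial,
    fun x _ => D.gamma_r_r x, fun m => D.isSc_gamma_r (D.isFam_projL m) _⟩
  exact max_lt enorm_lt_top (max_lt enorm_lt_top (D.mem_level_zero _))

theorem gamma_mem_level_zero (x : GammaAmbient n) : x ∈ (Gamma n D).scale.level 0 :=
  D.isScSmoothRetract_gamma.1 x trivial

theorem gamma_dense (x : GammaAmbient n) {ε : ℝ≥0∞} (hε : 0 < ε) :
    ∃ x' ∈ (Gamma n D).scale.level 1, (Gamma n D).scale.nrm 0 (x - x') < ε := by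
  obtain ⟨a, ha⟩ := dense_tr x.2.2 hε
  refine ⟨(x.1, x.2.1, a.tr 0), max_lt enorm_lt_top (max_lt enorm_lt_top (D.tr_mem_level a 1 0)), ?_⟩
  refine max_lt ?_ (max_lt ?_ ?_)
  · simpa [ScScale.const] using hε
  · simpa [ScScale.const] using hε
  · exact (D.sobolevNorm_zero _).trans_lt ha

/-- `Dr` is chosen among all linearizations and is determined at first only on `E₁`. Density extends
the equality to all of `E₀`, as needed for the tangent spaces. -/
theorem gamma_Dr {x : GammaAmbient n} (hx : x ∈ (Gamma n D).scale.level 1) (h : GammaAmbient n) :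
    (Gamma n D).Dr x h = D.gammaDr x h :=
  (D.isScDerivAt_gamma_r (Gamma n D).U hx).scDeriv_eq_of_dense (fun _ _ => trivial)
    (fun y _ _ hε => D.gamma_dense y hε) (D.gamma_mem_level_zero h)

theorem mem_tangentSpace {x v : GammaAmbient n} (hx : x ∈ (Gamma n D).scale.level 1) :
    v ∈ (Gamma n D).tangentSpace x ↔ ∃ h, D.gammaDr x h = v := by
  constructor
  · rintro ⟨h, -, rfl⟩
    exact ⟨h, (D.gamma_Dr hx h).symm⟩
  · rintro ⟨h, rfl⟩
    exact ⟨h, D.gamma_mem_level_zero h, D.gamma_Dr hx h⟩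

/-! ### Coordinates -/

/-- The base point enters only through `t` and through the frame derivative, which sees `f` only
through its coordinates. Hence tensors composed with the retraction can be written at the original
point. -/
theorem synth_gamma_r (x : GammaAmbient n) : D.synth ((Gamma n D).r x) = D.synth x := by
  refine LinearMap.ext fun z => ?_
  rw [synth_apply, synth_apply, gamma_r]
  simp only [timeL_apply, funL_apply, frameDeriv_projL]

/-- The coordinates along the frame vanish for `t ≤ 0`. -/
def IsAdmissible (k : ℕ) (x : GammaAmbient n) (z : GammaIdx n k → ℝ) : Prop :=
  x.2.1 ≤ 0 → ∀ j, z (.inr j) = 0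

theorem isAdmissible_formVec (x y v : GammaAmbient n) (h : x.2.1 = y.2.1) :
    IsAdmissible k x (D.formVec y v) := by
  intro ht j
  rw [h] at ht
  rw [formVec_apply, form_coord, D.coord_of_nonpos j ht, D.coordDeriv_of_nonpos j ht]
  simp

/-- For `t > 0` the frame is orthonormal, and by `coord_frameDeriv` with `π_t f = f` the motion of
the frame cancels the derivative of the coordinate functional. For `t ≤ 0` admissibility makes the
frame coordinates zero on both sides. -/
theorem formVec_synth {x : GammaAmbient n} (hx : D.projL x.2.1 x.2.2 = x.2.2)
    {z : GammaIdx n k → ℝ} (hz : IsAdmissible k x z) : D.formVec x (D.synth x z) = z := by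
  funext a
  rw [formVec_apply, synth_apply]
  rcases a with (i | i) | j
  · rfl
  · rfl
  · rw [form_coord]
    rcases lt_or_ge 0 x.2.1 with ht | ht
    · rw [map_add, D.coord_sum_frame j ht, map_smul, coord_frameDeriv, hx]
      simp
    · rw [D.coord_of_nonpos j ht, D.coordDeriv_of_nonpos j ht, hz ht j]
      simp

/-- Infinitesimally, the coordinate functions are invariant under the retraction. Tensors composed
with the induced retraction thus become expressions in the coordinates of arbitrary ambient vectors.
-/
theorem formVec_gamma_r_gammaDr (x h : GammaAmbient n) :
    D.formVec ((Gamma n D).r x) (D.gammaDr x h) = D.formVec x h := by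
  rw [gammaDr, LinearMap.comp_apply, ← synth_gamma_r]
  refine D.formVec_synth ?_ (D.isAdmissible_formVec _ _ _ ?_)
  · rw [gamma_r]; exact D.projL_projL _ _
  · rw [gamma_r]; rfl

theorem formVec_gammaDr {x : GammaAmbient n} (hx : D.projL x.2.1 x.2.2 = x.2.2)
    (h : GammaAmbient n) : D.formVec x (D.gammaDr x h) = D.formVec x h :=
  D.formVec_synth hx (D.isAdmissible_formVec x x h rfl)

theorem level_of_mem_pts {x : GammaAmbient n} {m : ℕ} (hx : x ∈ (Gamma n D).pts m) (l : ℕ) :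
    x ∈ (Gamma n D).scale.level l :=
  (D.mem_pts.2 (D.mem_pts.1 hx) : x ∈ (Gamma n D).pts l).2

/-- Tangent vectors are determined by their coordinates. -/
theorem mem_tangentSpace_iff {x v : GammaAmbient n} {m : ℕ} (hx : x ∈ (Gamma n D).pts m) :
    v ∈ (Gamma n D).tangentSpace x ↔ D.synth x (D.formVec x v) = v := by
  rw [D.mem_tangentSpace (D.level_of_mem_pts hx 1)]
  constructor
  · rintro ⟨h, rfl⟩
    rw [D.formVec_gammaDr (D.mem_pts.1 hx)]
    rfl
  · exact fun h => ⟨v, h⟩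

theorem synth_mem_tangentSpace {x : GammaAmbient n} {m : ℕ} (hx : x ∈ (Gamma n D).pts m)
    {z : GammaIdx n k → ℝ} (hz : IsAdmissible k x z) :
    D.synth x z ∈ (Gamma n D).tangentSpace x := by
  rw [D.mem_tangentSpace_iff hx, D.formVec_synth (D.mem_pts.1 hx) hz]

/-! ### Smoothness of the coordinates -/

section Smooth

variable {V : Type w} [AddCommGroup V] [Module ℝ V] {R : ScScale V} {Y W : V →ₗ[ℝ] GammaAmbient n}

theorem isSc_form (hY : IsScOp R (Gamma n D).scale.shift Y) (hW : IsScOp R (Gamma n D).scale W)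
    (U : Set V) (m : ℕ) (a : GammaIdx n k) :
    IsSc m R (ScScale.const ℝ) U (fun p => D.form a (Y p) (W p)) := by
  rcases a with (i | i) | j
  · exact .op m ((isScOp_spaceL n D.sobolevScale i).comp hW) U
  · exact .op m ((isScOp_timeL n D.sobolevScale).comp hW) U
  · have hY1 : IsScOp R (ScScale.const ℝ) (timeL n ∘ₗ Y) :=
      (isScOp_timeL n D.sobolevScale.shift).comp hY
    have hY2 : IsScOp R D.sobolevScale.shift (funL n ∘ₗ Y) :=
      (isScOp_funL n D.sobolevScale.shift).comp hY
    have hW1 : IsScOp R (ScScale.const ℝ) (timeL n ∘ₗ W) :=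
      (isScOp_timeL n D.sobolevScale).comp hW
    have hW2 : IsScOp R D.sobolevScale (funL n ∘ₗ W) :=
      (isScOp_funL n D.sobolevScale).comp hW
    exact ((D.isFam_coord j m).isSc_comp hY1 hW2 U).add
      ((IsSc.op m hW1 U).smul_fun ((D.isFam_coordDeriv j m).isSc_comp hY1 hY2 U))

/-- The frame vectors have `L²` norm one for `t > 0` and vanish for `t ≤ 0`, so they are
discontinuous at `0`. Multiplied by a frame coordinate they become rank one operators, in which the
decay of the pairing compensates the growth of the vector. -/
theorem isSc_form_smul_frame (hY : IsScOp R (Gamma n D).scale.shift Y)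
    (hW : IsScOp R (Gamma n D).scale W) (U : Set V) (m : ℕ) (i j : Fin k) :
    IsSc m R D.sobolevScale U (fun p => D.form (.inr i) (Y p) (W p) • D.frame j (timeL n (Y p))) := by
  have hY1 : IsScOp R (ScScale.const ℝ) (timeL n ∘ₗ Y) :=
    (isScOp_timeL n D.sobolevScale.shift).comp hY
  have hY2 : IsScOp R D.sobolevScale.shift (funL n ∘ₗ Y) :=
    (isScOp_funL n D.sobolevScale.shift).comp hY
  have hW1 : IsScOp R (ScScale.const ℝ) (timeL n ∘ₗ W) :=
    (isScOp_timeL n D.sobolevScale).comp hW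
  have hW2 : IsScOp R D.sobolevScale (funL n ∘ₗ W) :=
    (isScOp_funL n D.sobolevScale).comp hW
  refine (((D.isFam_tr_tr (D.test i) (D.test j) m).isSc_comp hY1 hW2 U).add
    ((IsSc.op m hW1 U).smul_fun (((D.isFam_tr_tr_shift (D.test i).deriv (D.test j) 2 1 m).smul
      (-1)).isSc_comp hY1 hY2 U))).congr fun p _ => ?_
  simp only [LinearMap.comp_apply, timeL_apply, funL_apply, form_coord, add_smul, mul_smul,
    Pi.smul_apply, LinearMap.smul_apply, rankOne_tr_frame, coord, coordDeriv, smul_assoc]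

/-- The zero block is essential: it ensures that only frame coordinates multiply frame vectors,
whereas a term such as `dt • frame` would be discontinuous at `t = 0`. The coordinate `dt`
multiplies only the frame derivative, whose argument is the base point and hence has a level to
spare. -/
theorem isSc_synth (hY : IsScOp R (Gamma n D).scale.shift Y) (hW : IsScOp R (Gamma n D).scale W)
    (U : Set V) (m : ℕ) (J₀ : Matrix (Fin n ⊕ Unit) (Fin n ⊕ Unit) ℝ)
    (J₁ : Matrix (Fin k) (Fin k) ℝ) :
    IsSc m R (Gamma n D).scale U (fun p => D.synth (Y p)
      ((Matrix.fromBlocks J₀ 0 0 J₁).mulVec (D.formVec (Y p) (W p)))) := by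
  have hY1 : IsScOp R (ScScale.const ℝ) (timeL n ∘ₗ Y) :=
    (isScOp_timeL n D.sobolevScale.shift).comp hY
  have hY2 : IsScOp R D.sobolevScale.shift (funL n ∘ₗ Y) :=
    (isScOp_funL n D.sobolevScale.shift).comp hY
  have hl : ∀ a, IsSc m R (ScScale.const ℝ) U
      (fun p => (Matrix.fromBlocks J₀ 0 0 J₁).mulVec (D.formVec (Y p) (W p)) (.inl a)) := by
    intro a
    exact IsSc.sum Finset.univ fun b _ => (D.isSc_form hY hW U m b).smul
      (Matrix.fromBlocks J₀ 0 0 J₁ (.inl a) b)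
  have h1 : IsSc m R (ScScale.const (EuclideanSpace ℝ (Fin n))) U (fun p => WithLp.toLp 2 fun i =>
      (Matrix.fromBlocks J₀ 0 0 J₁).mulVec (D.formVec (Y p) (W p)) (.inl (.inl i))) := by
    -- The vector is assembled from its scalar components along the standard basis.
    have := IsSc.sum (S := R) (T := ScScale.const (EuclideanSpace ℝ (Fin n))) (U := U) (k := m)
      Finset.univ fun (i : Fin n) _ => (hl (.inl i)).op_comp (isScOp_const
        ((ContinuousLinearMap.id ℝ ℝ).smulRight (EuclideanSpace.single i (1 : ℝ))))
    refine this.congr fun p _ => ?_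
    ext i
    simp [Finset.sum_apply, Pi.single_apply]
  have h2 : IsSc m R D.sobolevScale U (fun p => ∑ j,
      (Matrix.fromBlocks J₀ 0 0 J₁).mulVec (D.formVec (Y p) (W p)) (.inr j)
        • D.frame j (timeL n (Y p))) := by
    have := IsSc.sum (S := R) (T := D.sobolevScale) (U := U) (k := m) Finset.univ
      fun (j : Fin k) _ => IsSc.sum (S := R) (T := D.sobolevScale) (U := U) (k := m) Finset.univ
        fun (i : Fin k) _ => (D.isSc_form_smul_frame hY hW U m i j).smul (J₁ j i)
    refine this.congr fun p _ => Finset.sum_congr rfl fun j _ => ?_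
    simp [Matrix.mulVec, dotProduct, Finset.sum_smul, formVec_apply, mul_smul]
  exact (h1.prodMk ((hl (.inr ())).prodMk (h2.add ((hl (.inr ())).smul_fun
    ((D.isFam_frameDeriv m).isSc_comp hY1 hY2 U))))).congr fun p _ => (D.synth_apply _ _).symm

end Smooth

end GammaData

/-! ## Linear algebra -/

theorem exists_matrix_sq_neg_one {ι : Type*} [Fintype ι] [DecidableEq ι]
    (h : Even (Fintype.card ι)) : ∃ J : Matrix ι ι ℝ, J * J = -1 ∧ J.transpose = -J := by
  obtain ⟨m, hm⟩ := h
  have e : Fin m ⊕ Fin m ≃ ι := Fintype.equivOfCardEq (by simp [hm])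
  refine ⟨(Matrix.J (Fin m) ℝ).submatrix e.symm e.symm, ?_, ?_⟩
  · rw [Matrix.submatrix_mul_equiv, Matrix.J_squared, Matrix.submatrix_neg]
    simp
  · rw [Matrix.transpose_submatrix, Matrix.J_transpose, Matrix.submatrix_neg]
    rfl

/-- On a finite-dimensional space, a nondegenerate bilinear form identifies the space with its
continuous dual. -/
theorem exists_continuousLinearEquiv_dual {V : Type*} [NormedAddCommGroup V] [NormedSpace ℝ V]
    [FiniteDimensional ℝ V] (B : V →ₗ[ℝ] V →ₗ[ℝ] ℝ) (hB : ∀ v, (∀ w, B v w = 0) → v = 0) :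
    ∃ Φ : V ≃L[ℝ] (V →L[ℝ] ℝ), ∀ v w, Φ v w = B v w := by
  have hinj : Function.Injective B := (injective_iff_map_eq_zero B).2 fun v hv =>
    hB v fun w => by rw [hv]; rfl
  exact ⟨((LinearMap.linearEquivOfInjective B hinj Subspace.dual_finrank_eq.symm).trans
    LinearMap.toContinuousLinearMap).toContinuousLinearEquiv, fun v w => rfl⟩

section

variable {E : Type*} {F : Type*} [AddCommGroup E] [Module ℝ E] [AddCommGroup F] [Module ℝ F]
  {S : ScScale E} {T : ScScale F}

theorem IsScOp.sum {ι : Type*} (s : Finset ι) {L : ι → E →ₗ[ℝ] F} (h : ∀ i ∈ s, IsScOp S T (L i)) :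
    IsScOp S T (∑ i ∈ s, L i) := by
  classical
  induction s using Finset.induction_on with
  | empty => exact fun m => ⟨0, fun x => by simp [T.nrm_zero]⟩
  | insert i s hi ih =>
    rw [Finset.sum_insert hi]
    exact (h i (Finset.mem_insert_self i s)).add
      (ih fun j hj => h j (Finset.mem_insert_of_mem hj))

theorem IsScOp.smulRight {L : E →ₗ[ℝ] ℝ} (h : IsScOp S (ScScale.const ℝ) L) {y : F}
    (hy : ∀ m, y ∈ T.level m) : IsScOp S T (L.smulRight y) := by
  intro m
  obtain ⟨C, hC⟩ := h m
  refine ⟨C * (T.nrm m y).toNNReal, fun x => ?_⟩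
  rw [LinearMap.smulRight_apply, T.nrm_smul, ENNReal.coe_mul,
    ENNReal.coe_toNNReal (T.mem_level.1 (hy m)).ne, mul_right_comm]
  exact mul_le_mul' (hC x) le_rfl

end

namespace GammaData

variable {n k : ℕ} (D : GammaData k)

/-! ### Tensors with constant coefficients -/

/-- The endomorphism with constant matrix `K` in the coordinates. -/
def constEnd (K : Matrix (GammaIdx n k) (GammaIdx n k) ℝ) (x : GammaAmbient n) :
    GammaAmbient n →ₗ[ℝ] GammaAmbient n :=
  D.synth x ∘ₗ K.mulVecLin ∘ₗ D.formVec x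

/-- The bilinear form with constant matrix `K` in the coordinates. -/
def constForm (K : Matrix (GammaIdx n k) (GammaIdx n k) ℝ) (x : GammaAmbient n) :
    GammaAmbient n →ₗ[ℝ] GammaAmbient n →ₗ[ℝ] ℝ :=
  (Matrix.toLinearMap₂' ℝ K).compl₁₂ (D.formVec x) (D.formVec x)

variable {K : Matrix (GammaIdx n k) (GammaIdx n k) ℝ} {x : GammaAmbient n}

theorem constEnd_apply (K : Matrix (GammaIdx n k) (GammaIdx n k) ℝ) (x v : GammaAmbient n) :
    D.constEnd K x v = D.synth x (K.mulVec (D.formVec x v)) := rfl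

theorem constForm_apply (K : Matrix (GammaIdx n k) (GammaIdx n k) ℝ) (x v w : GammaAmbient n) :
    D.constForm K x v w = dotProduct (D.formVec x v) (K.mulVec (D.formVec x w)) := by
  rw [constForm, LinearMap.compl₁₂_apply, Matrix.toLinearMap₂'_apply']

theorem constForm_eq_sum (K : Matrix (GammaIdx n k) (GammaIdx n k) ℝ) (x v w : GammaAmbient n) :
    D.constForm K x v w = ∑ a, ∑ b, K a b * (D.form a x v * D.form b x w) := by
  rw [constForm_apply]
  simp only [dotProduct, Matrix.mulVec, Finset.mul_sum, formVec_apply]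
  exact Finset.sum_congr rfl fun a _ => Finset.sum_congr rfl fun b _ => by ring

theorem constForm_one (x v w : GammaAmbient n) :
    D.constForm (k := k) 1 x v w = dotProduct (D.formVec x v) (D.formVec x w) := by
  rw [constForm_apply, Matrix.one_mulVec]

theorem isAdmissible_mulVec {z : GammaIdx n k → ℝ} (h : IsAdmissible k x z)
    (J₀ : Matrix (Fin n ⊕ Unit) (Fin n ⊕ Unit) ℝ) (J₁ : Matrix (Fin k) (Fin k) ℝ) :
    IsAdmissible k x ((Matrix.fromBlocks J₀ 0 0 J₁).mulVec z) := by
  intro ht j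
  rw [Matrix.fromBlocks_mulVec]
  have : z ∘ Sum.inr = 0 := funext fun i => h ht i
  simp [this]

section Block

variable {J₀ : Matrix (Fin n ⊕ Unit) (Fin n ⊕ Unit) ℝ} {J₁ : Matrix (Fin k) (Fin k) ℝ} {m : ℕ}

theorem formVec_constEnd (hx : x ∈ (Gamma n D).pts m) (v : GammaAmbient n) :
    D.formVec x (D.constEnd (Matrix.fromBlocks J₀ 0 0 J₁) x v)
      = (Matrix.fromBlocks J₀ 0 0 J₁).mulVec (D.formVec x v) := by
  rw [constEnd_apply, D.formVec_synth (D.mem_pts.1 hx)]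
  exact isAdmissible_mulVec (D.isAdmissible_formVec x x v rfl) J₀ J₁

theorem constEnd_mem_tangentSpace (hx : x ∈ (Gamma n D).pts m) (v : GammaAmbient n) :
    D.constEnd (Matrix.fromBlocks J₀ 0 0 J₁) x v ∈ (Gamma n D).tangentSpace x :=
  D.synth_mem_tangentSpace hx (isAdmissible_mulVec (D.isAdmissible_formVec x x v rfl) J₀ J₁)

/-- The transpose arises from `⟨J v, w⟩ = vᵀ Jᵀ w` in coordinates. -/
theorem fundamentalForm_apply (hx : x ∈ (Gamma n D).pts m) (v w : GammaAmbient n) :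
    fundamentalForm (D.constEnd (Matrix.fromBlocks J₀ 0 0 J₁)) (D.constForm 1) x v w
      = D.constForm (Matrix.fromBlocks J₀ 0 0 J₁).transpose x v w := by
  rw [fundamentalForm, LinearMap.comp_apply, constForm_one, D.formVec_constEnd hx, constForm_apply,
    Matrix.mulVec_transpose, dotProduct_comm, Matrix.dotProduct_mulVec, dotProduct_comm]

end Block

theorem isScOp_form (a : GammaIdx n k) (x : GammaAmbient n) :
    IsScOp (Gamma n D).scale (ScScale.const ℝ) (D.form a x) := by
  rcases a with (i | i) | j
  · exact isScOp_spaceL n D.sobolevScale i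
  · exact isScOp_timeL n D.sobolevScale
  · refine IsScOp.add (IsScOp.comp (fun m => ?_) (isScOp_funL n D.sobolevScale))
      ((isScOp_timeL n D.sobolevScale).smulRight fun _ => enorm_lt_top)
    obtain ⟨C, hC⟩ := (D.isFam_coord j 0).unifBdd m
    exact ⟨C, hC _⟩

theorem synth_eq_sum (x : GammaAmbient n) (z : GammaIdx n k → ℝ) :
    D.synth x z = ∑ a, z a • D.synth x (Pi.single a 1) := by
  conv_lhs => rw [pi_eq_sum_univ' z, map_sum]
  exact Finset.sum_congr rfl fun a _ => map_smul _ _ _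

theorem isScOp_constEnd (K : Matrix (GammaIdx n k) (GammaIdx n k) ℝ) (x : GammaAmbient n) :
    IsScOp (Gamma n D).scale (Gamma n D).scale (D.constEnd K x) := by
  have e : D.constEnd K x = ∑ a, ∑ b, (K a b • D.form b x).smulRight
      (D.synth x (Pi.single a 1)) := by
    refine LinearMap.ext fun v => ?_
    rw [constEnd_apply, synth_eq_sum]
    simp only [LinearMap.sum_apply, Matrix.mulVec, dotProduct, Finset.sum_smul, formVec_apply,
      LinearMap.smulRight_apply, LinearMap.smul_apply, smul_eq_mul]
  rw [e]
  exact .sum _ fun a _ => .sum _ fun b _ => ((D.isScOp_form b x).smul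
    _).smulRight fun m => D.synth_mem_level x _ m

/-! ### The dimension of the tangent spaces -/

theorem eq_zero_of_formVec {x v : GammaAmbient n} {m : ℕ} (hx : x ∈ (Gamma n D).pts m)
    (hv : v ∈ (Gamma n D).tangentSpace x) (h : D.formVec (n := n) x v = 0) : v = 0 := by
  rw [← (D.mem_tangentSpace_iff hx).1 hv, h, map_zero]

theorem finiteDimensional_tanSp {m : ℕ} (hx : x ∈ (Gamma n D).pts m) :
    FiniteDimensional ℝ ((Gamma n D).TanSp x) := by
  refine FiniteDimensional.of_injective (D.formVec x ∘ₗ (Gamma n D).incl x)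
    ((injective_iff_map_eq_zero _).2 fun v hv => ?_)
  exact Subtype.ext (D.eq_zero_of_formVec hx v.2 hv)

theorem zero_mem_pts (t : ℝ) : ((0, t, 0) : GammaAmbient n) ∈ (Gamma n D).pts 1 :=
  D.mem_pts.2 (map_zero _)

/-- Admissibility at `t = 0` kills the `k` frame coordinates and leaves the other `n + 1` free. -/
theorem finrank_tanSp_zero :
    Module.finrank ℝ ((Gamma n D).TanSp (0, 0, 0)) = n + 1 := by
  have hx := D.zero_mem_pts (n := n) 0
  have e : (Gamma n D).TanSp (0, 0, 0) ≃ₗ[ℝ] (Fin n ⊕ Unit → ℝ) := by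
    refine LinearEquiv.ofBijective (LinearMap.funLeft ℝ ℝ Sum.inl ∘ₗ
      D.formVec (0, 0, 0) ∘ₗ (Gamma n D).incl (0, 0, 0)) ⟨(injective_iff_map_eq_zero _).2
        fun v hv => Subtype.ext (D.eq_zero_of_formVec hx v.2 (funext fun a => ?_)), fun z => ?_⟩
    · rcases a with a | j
      · exact congrFun hv a
      · exact D.isAdmissible_formVec (0, 0, 0) (0, 0, 0) _ rfl le_rfl j
    · have hz : IsAdmissible k ((0, 0, 0) : GammaAmbient n) (Sum.elim z 0) := fun _ _ => rfl
      refine ⟨⟨_, D.synth_mem_tangentSpace hx hz⟩, ?_⟩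
      funext a
      exact congrFun (D.formVec_synth (D.mem_pts.1 hx) hz) (.inl a)
  rw [e.finrank_eq]
  simp

theorem finrank_tanSp_one :
    Module.finrank ℝ ((Gamma n D).TanSp (0, 1, 0)) = n + 1 + k := by
  have hx := D.zero_mem_pts (n := n) 1
  have e : (Gamma n D).TanSp (0, 1, 0) ≃ₗ[ℝ] (GammaIdx n k → ℝ) := by
    refine LinearEquiv.ofBijective (D.formVec (0, 1, 0) ∘ₗ (Gamma n D).incl (0, 1, 0))
      ⟨(injective_iff_map_eq_zero _).2 fun v hv => Subtype.ext (D.eq_zero_of_formVec hx v.2 hv),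
        fun z => ?_⟩
    have hz : IsAdmissible k ((0, 1, 0) : GammaAmbient n) z :=
      fun h => absurd h (not_le.2 one_pos)
    exact ⟨⟨_, D.synth_mem_tangentSpace hx hz⟩, D.formVec_synth (D.mem_pts.1 hx) hz⟩
  rw [e.finrank_eq]
  simp

/-- Two points suffice: the dimension is `n + 1` at `t = 0` and `n + 1 + k` at `t = 1`. -/
theorem even_of_isEvenDimensional (h : (Gamma n D).IsEvenDimensional) :
    Even (n + 1) ∧ Even k := by
  have h0 := h _ (D.zero_mem_pts 0) (D.finiteDimensional_tanSp (D.zero_mem_pts 0))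
  have h1 := h _ (D.zero_mem_pts 1) (D.finiteDimensional_tanSp (D.zero_mem_pts 1))
  rw [finrank_tanSp_zero] at h0
  rw [finrank_tanSp_one, Nat.even_add] at h1
  exact ⟨h0, h1.1 h0⟩

/-! ### Smoothness -/

theorem isAlmostComplex_constEnd {J₀ : Matrix (Fin n ⊕ Unit) (Fin n ⊕ Unit) ℝ}
    {J₁ : Matrix (Fin k) (Fin k) ℝ}
    (h : Matrix.fromBlocks J₀ 0 0 J₁ * Matrix.fromBlocks J₀ 0 0 J₁ = -1) :
    (Gamma n D).IsAlmostComplex (D.constEnd (Matrix.fromBlocks J₀ 0 0 J₁)) := by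
  refine ⟨fun m => ?_, fun x hx => ⟨fun v _ => D.constEnd_mem_tangentSpace hx v,
    isScZero_op (D.isScOp_constEnd _ x) _, fun v hv => ?_⟩⟩
  · have hY : IsScOp (Gamma n D).scale.tangent (Gamma n D).scale.shift (LinearMap.fst ℝ _ _) :=
      IsScOp.fst
    have hW : IsScOp (Gamma n D).scale.tangent (Gamma n D).scale (LinearMap.snd ℝ _ _) :=
      IsScOp.snd
    have h1 := (D.isSc_gamma_r (n := n) (D.isFam_projL m).shift Set.univ).comp_op (L :=
      LinearMap.fst ℝ (GammaAmbient n) (GammaAmbient n)) hY (U := (Gamma n D).tangent.U)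
      fun _ _ => trivial
    refine (h1.prodMk (D.isSc_synth hY hW (Gamma n D).tangent.U m J₀ J₁)).congr fun p hp => ?_
    refine Prod.ext rfl ?_
    change _ = D.constEnd _ ((Gamma n D).r p.1) ((Gamma n D).Dr p.1 p.2)
    -- By invariance of `synth` and of the coordinates, `J` after the retraction of `TX` is given by
    -- the same formula at the original pair, to which `isSc_synth` applies.
    rw [D.gamma_Dr hp.2.1, constEnd_apply, synth_gamma_r, formVec_gamma_r_gammaDr]
    rfl
  · rw [constEnd_apply, D.formVec_constEnd hx, Matrix.mulVec_mulVec, h, Matrix.neg_mulVec,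
      Matrix.one_mulVec, map_neg, (D.mem_tangentSpace_iff hx).1 hv]

theorem isSc_constForm (K : Matrix (GammaIdx n k) (GammaIdx n k) ℝ) (m : ℕ) :
    IsSc m (Gamma n D).whitney.scale (ScScale.const ℝ) (Gamma n D).whitney.U
      (fun p => D.constForm K ((Gamma n D).whitney.r p).1 ((Gamma n D).whitney.r p).2.1
        ((Gamma n D).whitney.r p).2.2) := by
  have hY : IsScOp (Gamma n D).whitney.scale (Gamma n D).scale.shift
    (LinearMap.fst ℝ (GammaAmbient n) (GammaAmbient n × GammaAmbient n)) := IsScOp.fst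
  have h2 : IsScOp (Gamma n D).whitney.scale ((Gamma n D).scale.prod (Gamma n D).scale)
    (LinearMap.snd ℝ (GammaAmbient n) (GammaAmbient n × GammaAmbient n)) := IsScOp.snd
  have hV : IsScOp (Gamma n D).whitney.scale (Gamma n D).scale
    (LinearMap.fst ℝ (GammaAmbient n) (GammaAmbient n) ∘ₗ LinearMap.snd ℝ (GammaAmbient n) _) :=
      IsScOp.fst.comp h2
  have hW : IsScOp (Gamma n D).whitney.scale (Gamma n D).scale
    (LinearMap.snd ℝ (GammaAmbient n) (GammaAmbient n) ∘ₗ LinearMap.snd ℝ (GammaAmbient n) _) :=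
      IsScOp.snd.comp h2
  have := IsSc.sum Finset.univ fun (a : GammaIdx n k) _ => IsSc.sum Finset.univ
    fun (b : GammaIdx n k) _ => (((D.isSc_form hY hV (Gamma n D).whitney.U m a).smul_fun
      (D.isSc_form hY hW (Gamma n D).whitney.U m b)).smul (K a b))
  refine this.congr fun p hp => ?_
  change _ = D.constForm K ((Gamma n D).r p.1) ((Gamma n D).Dr p.1 p.2.1)
    ((Gamma n D).Dr p.1 p.2.2)
  rw [D.gamma_Dr hp.2.1, D.gamma_Dr hp.2.1, constForm_apply, formVec_gamma_r_gammaDr,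
    formVec_gamma_r_gammaDr, ← constForm_apply, constForm_eq_sum]
  rfl

theorem isScZero_constForm (K : Matrix (GammaIdx n k) (GammaIdx n k) ℝ) (x : GammaAmbient n)
    (U : Set (GammaAmbient n × GammaAmbient n)) :
    IsScZero ((Gamma n D).scale.prod (Gamma n D).scale) (ScScale.const ℝ) U
      (fun p => D.constForm K x p.1 p.2) := by
  have h := fun a => D.isScOp_form (n := n) a x
  have := IsSc.sum (k := 0) Finset.univ fun (a : GammaIdx n k) _ => IsSc.sum (k := 0) Finset.univ
    fun (b : GammaIdx n k) _ => ((IsSc.op 0 ((h a).comp (IsScOp.fst (T := (Gamma n D).scale)))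
      U).smul_fun (IsSc.op 0 ((h b).comp (IsScOp.snd (S := (Gamma n D).scale))) U)).smul (K a b)
  exact IsScZero.congr this fun p _ => (D.constForm_eq_sum K x p.1 p.2).symm

/-- Testing `v` against the vector whose coordinates are the block matrix applied to `z`, the
coordinates of `v`, gives `zᵀ z`. Block form is needed for this test vector to be tangent; finite
dimension turns injectivity into an isomorphism with the dual. -/
theorem isStronglyNondegenerate_of_eq {ω : GammaAmbient n → GammaAmbient n →ₗ[ℝ]
    GammaAmbient n →ₗ[ℝ] ℝ} {J₀ : Matrix (Fin n ⊕ Unit) (Fin n ⊕ Unit) ℝ}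
    {J₁ : Matrix (Fin k) (Fin k) ℝ} {K : Matrix (GammaIdx n k) (GammaIdx n k) ℝ}
    (h : K * Matrix.fromBlocks J₀ 0 0 J₁ = 1)
    (hω : ∀ x ∈ (Gamma n D).pts 1, ∀ v w, ω x v w = D.constForm K x v w) :
    (Gamma n D).IsStronglyNondegenerate ω := by
  intro x hx
  have := D.finiteDimensional_tanSp hx
  refine exists_continuousLinearEquiv_dual ((ω x).compl₁₂ ((Gamma n D).incl x)
    ((Gamma n D).incl x)) fun v hv => Subtype.ext (D.eq_zero_of_formVec hx v.2 ?_)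
  have h1 := hv ⟨_, D.constEnd_mem_tangentSpace (J₀ := J₀) (J₁ := J₁) hx v.1⟩
  have h2 : ω x v.1 (D.constEnd (Matrix.fromBlocks J₀ 0 0 J₁) x v.1) = 0 := h1
  rw [hω x hx, constForm_apply, D.formVec_constEnd hx, Matrix.mulVec_mulVec, h, Matrix.one_mulVec]
    at h2
  exact dotProduct_self_eq_zero.1 h2

theorem isStrongRiemannianMetric_constForm :
    (Gamma n D).IsStrongRiemannianMetric (D.constForm 1) := by
  refine ⟨⟨D.isSc_constForm 1, fun x _ => D.isScZero_constForm 1 x _⟩, fun x _ v _ w _ => ?_,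
    D.isStronglyNondegenerate_of_eq (J₀ := 1) (J₁ := 1) (K := 1) ?_ fun _ _ _ _ => rfl,
    fun x hx v hv h0 => ?_⟩
  · rw [constForm_one, constForm_one, dotProduct_comm]
  · rw [Matrix.fromBlocks_one, one_mul]
  · rw [constForm_one]
    have hne : D.formVec (k := k) x v ≠ 0 := fun h => h0 (D.eq_zero_of_formVec hx hv h)
    exact lt_of_le_of_ne (Finset.sum_nonneg fun _ _ => mul_self_nonneg _)
      fun h => hne (dotProduct_self_eq_zero.1 h.symm)

end GammaData

/-! ## Linearizations on the first level -/

section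

variable {E : Type u} {F : Type v} [AddCommGroup E] [Module ℝ E] [AddCommGroup F] [Module ℝ F]
  {S : ScScale E} {T : ScScale F} {U : Set E} {f : E → F} {x : E}

theorem ScScale.exists_bound_of_nrm_lt_one {L : E →ₗ[ℝ] F} {m l : ℕ} {d : ℝ≥0∞} (hd : 0 < d)
    (h : ∀ k, S.nrm m k < d → T.nrm l (L k) < 1) :
    ∃ C : ℝ≥0, ∀ k ∈ S.level m, T.nrm l (L k) ≤ C * S.nrm m k := by
  obtain ⟨c, hc, hcd⟩ := ENNReal.lt_iff_exists_nnreal_btwn.1 hd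
  have hc0 : 0 < c := by exact_mod_cast hc
  refine ⟨c⁻¹, fun k hk => ?_⟩
  rcases eq_or_ne (S.nrm m k) 0 with h0 | h0
  · rw [S.eq_zero_of_nrm m k h0, map_zero, T.nrm_zero]
    exact bot_le
  · obtain ⟨a, ha⟩ : ∃ a : ℝ≥0, (a : ℝ≥0∞) = S.nrm m k :=
      ⟨_, ENNReal.coe_toNNReal (S.mem_level.1 hk).ne⟩
    have ha0 : a ≠ 0 := by
      rintro rfl
      exact h0 ha.symm
    have e : ∀ b : ℝ≥0, ‖(b : ℝ)‖ₑ = b := fun b => by simp [enorm_eq_nnnorm]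
    have h1 : S.nrm m (((c * a⁻¹ : ℝ≥0) : ℝ) • k) = c := by
      rw [S.nrm_smul, e, ← ha, ← ENNReal.coe_mul, mul_assoc, inv_mul_cancel₀ ha0, mul_one]
    have h2 := h _ (h1.trans_lt hcd)
    have h3 : k = ((c⁻¹ * a : ℝ≥0) : ℝ) • ((c * a⁻¹ : ℝ≥0) : ℝ) • k := by
      rw [smul_smul, ← NNReal.coe_mul, mul_mul_mul_comm, inv_mul_cancel₀ hc0.ne',
        mul_inv_cancel₀ ha0, mul_one, NNReal.coe_one, one_smul]
    calc T.nrm l (L k) = (c⁻¹ * a : ℝ≥0) * T.nrm l (L (((c * a⁻¹ : ℝ≥0) : ℝ) • k)) := by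
          conv_lhs => rw [h3, map_smul, T.nrm_smul, e]
      _ ≤ (c⁻¹ * a : ℝ≥0) * 1 := by gcongr
      _ = c⁻¹ * S.nrm m k := by rw [mul_one, ENNReal.coe_mul, ha]

/-- At points of regularity `2`, the linearization of an sc¹ map is bounded on the first levels. -/
theorem IsSc.exists_isScDerivAt_bound (h : IsSc 1 S T U f) (hx : x ∈ U) (hx2 : x ∈ S.level 2) :
    ∃ A : E →ₗ[ℝ] F, IsScDerivAt S T U f x A ∧
      ∃ C : ℝ≥0, ∀ k ∈ S.level 1, T.nrm 1 (A k) ≤ C * S.nrm 1 k := by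
  obtain ⟨-, Df, hD, hT⟩ := h
  have hx1 : x ∈ S.level 1 := S.level_succ_le 1 hx2
  refine ⟨Df x, hD x hx hx1, ?_⟩
  -- Level one of the tangent scale is `E₂ ⊕ E₁`, so continuity of the tangent map at `(x, 0)` needs
  -- `x ∈ E₂`. It gives continuity of `Df x : E₁ → F₁` at zero, hence boundedness.
  obtain ⟨-, hε⟩ := hT 1 (x, 0) ⟨hx, hx1, Submodule.zero_mem _⟩
    (show max _ _ < ∞ from max_lt hx2 (Submodule.zero_mem (S.level 1)))
  obtain ⟨d, hd, hd'⟩ := hε 1 one_pos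
  refine ScScale.exists_bound_of_nrm_lt_one hd fun k hk => ?_
  have hk' : S.tangent.nrm 1 ((x, k) - (x, 0)) < d := by
    refine max_lt ?_ ?_
    · simpa [S.shift.nrm_zero] using hd
    · simpa using hk
  have hk1 : k ∈ S.level 0 := S.level_succ_le 0 (hk.trans_le le_top)
  have h2 := (le_max_right _ _).trans_lt (hd' (x, k) ⟨hx, hx1, hk1⟩ hk')
  simpa using h2

end

theorem Finset.sum_sum_eq_zero_of_antisymm {ι : Type*} [Fintype ι] {f : ι → ι → ℝ}
    (h : ∀ a b, f a b = -f b a) : ∑ a, ∑ b, f a b = 0 := by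
  have h1 : ∑ a, ∑ b, f a b = -∑ a, ∑ b, f a b := by
    conv_lhs => rw [Finset.sum_comm]
    rw [← Finset.sum_neg_distrib]
    refine Finset.sum_congr rfl fun a _ => ?_
    rw [← Finset.sum_neg_distrib]
    exact Finset.sum_congr rfl fun b _ => h b a
  linarith

/-! ### Closedness of forms with constant coefficients -/

namespace GammaData

variable {n k : ℕ} (D : GammaData k) {p : GammaAmbient n} {m : ℕ}

theorem gamma_r_of_mem_pts (hp : p ∈ (Gamma n D).pts m) : (Gamma n D).r p = p := by
  rw [gamma_r]
  exact Prod.ext rfl (Prod.ext rfl (D.mem_pts.1 hp))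

theorem level_of_mem_tangentSpace (hp : p ∈ (Gamma n D).pts m) {v : GammaAmbient n}
    (hv : v ∈ (Gamma n D).tangentSpace p) (l : ℕ) : v ∈ (Gamma n D).scale.level l := by
  rw [← (D.mem_tangentSpace_iff hp).1 hv]
  exact D.synth_mem_level _ _ l

/-- The part of a tangent vector outside the image of `π_t` comes only from the motion of the frame,
so it is `dt` times a vector depending on the base point alone. This makes the Hessians of the
coordinates symmetric. -/
theorem sub_projL_of_mem_tangentSpace (hp : p ∈ (Gamma n D).pts m) {v : GammaAmbient n}
    (hv : v ∈ (Gamma n D).tangentSpace p) : v.2.2 - D.projL p.2.1 v.2.2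
      = v.2.1 • (D.projDeriv p.2.1 p.2.2 - D.projL p.2.1 (D.projDeriv p.2.1 p.2.2)) := by
  obtain ⟨u, rfl⟩ := (D.mem_tangentSpace (D.level_of_mem_pts hp 1)).1 hv
  rw [gammaDr_apply]
  simp only [map_add, map_smul, D.projL_projL, smul_sub]
  abel

/-- The coordinates of vector fields can be differentiated, up to symmetric terms, by
differentiating the vector fields. -/
theorem exists_symm_isScDerivAt_form (hp : p ∈ (Gamma n D).pts m) (a : GammaIdx n k) :
    ∃ b : GammaAmbient n → GammaAmbient n → ℝ,
      (∀ v ∈ (Gamma n D).tangentSpace p, ∀ w ∈ (Gamma n D).tangentSpace p, b v w = b w v) ∧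
      ∀ (U : Set (GammaAmbient n)) (M : GammaAmbient n → GammaAmbient n)
        (A : GammaAmbient n →ₗ[ℝ] GammaAmbient n),
        IsScDerivAt (Gamma n D).scale.shift (Gamma n D).scale U M p A →
        (∃ C : ℝ≥0, ∀ h ∈ (Gamma n D).scale.shift.level 1,
          (Gamma n D).scale.nrm 1 (A h) ≤ C * (Gamma n D).scale.shift.nrm 1 h) →
        M p ∈ (Gamma n D).scale.level 1 →
        ∃ L : GammaAmbient n →ₗ[ℝ] ℝ, IsScDerivAt (Gamma n D).scale.shift (ScScale.const ℝ) U
          (fun y => D.form a ((Gamma n D).r y) (M y)) p L ∧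
          ∀ h, L h = D.form a p (A h) + b h (M p) := by
  rcases a with (i | i) | j
  · exact ⟨fun _ _ => 0, fun _ _ _ _ => rfl, fun U M A hA _ _ =>
      ⟨_, hA.op_comp (isScOp_spaceL n D.sobolevScale i), fun h => (add_zero _).symm⟩⟩
  · exact ⟨fun _ _ => 0, fun _ _ _ _ => rfl, fun U M A hA _ _ =>
      ⟨_, hA.op_comp (isScOp_timeL n D.sobolevScale), fun h => (add_zero _).symm⟩⟩
  · obtain ⟨hW, -, W', hd, hW'⟩ := D.isFam_coordDerivProj j 1
    -- These are the terms, in the derivative along `h` of the coordinate of a vector field with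
    -- value `v`, that do not differentiate the field: the Hessian of `cⱼ`.
    refine ⟨fun h v => h.2.1 * D.coordDeriv j p.2.1 v.2.2
      + v.2.1 * (D.coordDerivProj j p.2.1 h.2.2 + h.2.1 * W' p.2.1 p.2.2), fun v hv w hw => ?_,
      fun U M A hA hC hM => ?_⟩
    · have e : ∀ u ∈ (Gamma n D).tangentSpace p, D.coordDeriv j p.2.1 u.2.2
          = D.coordDerivProj j p.2.1 u.2.2 + u.2.1 * D.coordDeriv j p.2.1
            (D.projDeriv p.2.1 p.2.2 - D.projL p.2.1 (D.projDeriv p.2.1 p.2.2)) := fun u hu => by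
        rw [coordDerivProj_apply, ← smul_eq_mul, ← map_smul,
          ← D.sub_projL_of_mem_tangentSpace hp hu, ← map_add, add_sub_cancel]
      simp only [e v hv, e w hw]
      ring
    · obtain ⟨C, hC⟩ := hC
      obtain ⟨C', hC'⟩ := isScOp_funL n D.sobolevScale 1
      have h1 := (D.famDeriv_coord j).isScDerivAt_comp (D.isFam_coord j 0).unifBdd
        (D.isFam_coordDeriv j 0).unifBdd (hA.op_comp (isScOp_funL n D.sobolevScale))
        ((isScOp_funL n D.sobolevScale).map_level hM) ⟨C' * C, fun h hh => by
          rw [ENNReal.coe_mul, mul_assoc]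
          exact (hC' _).trans (mul_le_mul_right (hC h hh) _)⟩
        (isScOp_timeL n D.sobolevScale.shift)
      have h2 := hd.isScDerivAt_comp hW hW'.unifBdd
        (IsScDerivAt.op (isScOp_funL n D.sobolevScale.shift) U p)
        ((isScOp_funL n D.sobolevScale).map_level (D.level_of_mem_pts hp 2))
        ((isScOp_funL n D.sobolevScale.shift 1).imp fun C hC k _ => hC k)
        (isScOp_timeL n D.sobolevScale.shift)
      have h3 := (hA.op_comp (isScOp_timeL n D.sobolevScale)).bilin h2
        (isScBilin_smul (ScScale.const ℝ)) enorm_lt_top enorm_lt_top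
      -- At the retracted point the functional is applied to `π_t f`, which produces
      -- `coordDerivProj`.
      have e : ∀ y, D.form (.inr j) ((Gamma n D).r y) (M y) = D.coord j y.2.1 (M y).2.2
          + (M y).2.1 * D.coordDerivProj j y.2.1 y.2.2 := fun y => by
        rw [form_coord, gamma_r, coordDerivProj_apply]
        rfl
      refine ⟨_, (h1.add h3).congr ?_ fun y _ => ?_, fun h => ?_⟩
      · exact (e p).symm
      · exact (e y).symm
      · have hpr : D.coordDerivProj j p.2.1 p.2.2 = D.coordDeriv j p.2.1 p.2.2 := by
          rw [coordDerivProj_apply, D.mem_pts.1 hp]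
        change D.coord j p.2.1 (A h).2.2 + h.2.1 * D.coordDeriv j p.2.1 (M p).2.2
          + ((M p).2.1 * (D.coordDerivProj j p.2.1 h.2.2 + h.2.1 * W' p.2.1 p.2.2)
            + (A h).2.1 * D.coordDerivProj j p.2.1 p.2.2) = _
        rw [form_coord, hpr]
        ring

/-- Boundedness on the first levels requires a point of level two in the shifted scale, that is, of
level three. Points of `X` have every regularity, so this costs nothing. -/
theorem isVectorField_exists_isScDerivAt {μ : GammaAmbient n → GammaAmbient n}
    (h : (Gamma n D).IsVectorField μ) (hp : p ∈ (Gamma n D).pts m) :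
    ∃ A : GammaAmbient n →ₗ[ℝ] GammaAmbient n,
      IsScDerivAt (Gamma n D).scale.shift (Gamma n D).scale (Gamma n D).shift.U
        (fun y => μ ((Gamma n D).r y)) p A ∧
      ∃ C : ℝ≥0, ∀ h ∈ (Gamma n D).scale.shift.level 1,
        (Gamma n D).scale.nrm 1 (A h) ≤ C * (Gamma n D).scale.shift.nrm 1 h :=
  ((h.2 1).op_comp (L := LinearMap.snd ℝ (GammaAmbient n) (GammaAmbient n))
    (IsScOp.snd (S := (Gamma n D).scale.shift))).exists_isScDerivAt_bound
    ⟨trivial, D.level_of_mem_pts hp 1⟩ (D.level_of_mem_pts hp 3)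

/-- Tangent vectors lie in every level, in particular in level one of the shifted scale, where
linearizations are unique without a density argument. -/
theorem shift_deriv_eq {F : Type*} [AddCommGroup F] [Module ℝ F] {T : ScScale F}
    {f : GammaAmbient n → F} {A : GammaAmbient n →ₗ[ℝ] F} (hp : p ∈ (Gamma n D).pts m)
    (hA : IsScDerivAt (Gamma n D).scale.shift T (Gamma n D).shift.U
      (fun y => f ((Gamma n D).r y)) p A) {v : GammaAmbient n}
    (hv : v ∈ (Gamma n D).tangentSpace p) : (Gamma n D).shift.deriv T f p v = A v :=
  hA.scDeriv_eq (fun _ hk => ⟨trivial, Submodule.add_mem _ (D.level_of_mem_pts hp 1)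
    ((Gamma n D).scale.level_succ_le 1 hk)⟩) (D.level_of_mem_tangentSpace hp hv 2)

/-- Write `ω = ∑ K a c θₐ ⊗ θ_c`. The Leibniz rule and the formula for the derivatives of the
`θₐ(μᵢ)` turn `dω` into a sum over `a`, `c` of terms with a differentiated field, which the brackets
cancel, and of Hessian terms, which cancel by symmetry. -/
theorem isClosedForm_of_eq {ω : GammaAmbient n → GammaAmbient n →ₗ[ℝ]
    GammaAmbient n →ₗ[ℝ] ℝ} {K : Matrix (GammaIdx n k) (GammaIdx n k) ℝ} (hK : K.transpose = -K)
    (hω : ∀ x ∈ (Gamma n D).pts 1, ∀ v w, ω x v w = D.constForm K x v w) :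
    (Gamma n D).IsClosedForm ω := by
  intro μ₀ μ₁ μ₂ h₀ h₁ h₂ p hp
  have hp1 : p ∈ (Gamma n D).pts 1 := D.mem_pts.2 (D.mem_pts.1 hp)
  have hr := D.gamma_r_of_mem_pts hp
  choose b hb hL using D.exists_symm_isScDerivAt_form hp
  have main : ∀ μ, (Gamma n D).IsVectorField μ → ∃ (A : GammaAmbient n →ₗ[ℝ] GammaAmbient n)
      (L : GammaIdx n k → GammaAmbient n →ₗ[ℝ] ℝ),
      (∀ v ∈ (Gamma n D).tangentSpace p, (Gamma n D).shift.deriv (Gamma n D).scale μ p v = A v) ∧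
      (∀ a, IsScDerivAt (Gamma n D).scale.shift (ScScale.const ℝ) (Gamma n D).shift.U
        (fun y => D.form a ((Gamma n D).r y) (μ ((Gamma n D).r y))) p (L a)) ∧
      ∀ a h, L a h = D.form a p (A h) + b a h (μ p) := by
    intro μ hμ
    obtain ⟨A, hA, hC⟩ := D.isVectorField_exists_isScDerivAt hμ hp
    choose L h1 h2 using fun a => hL a _ _ A hA hC (by
      rw [hr]
      exact D.level_of_mem_tangentSpace hp (hμ.1 p hp1) 1)
    refine ⟨A, L, fun v hv => D.shift_deriv_eq hp hA hv, h1, fun a h => ?_⟩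
    rw [h2, hr]
  have hform : ∀ (μ ν : GammaAmbient n → GammaAmbient n) (L L' : GammaIdx n k → GammaAmbient n →ₗ[ℝ] ℝ),
      (∀ a, IsScDerivAt (Gamma n D).scale.shift (ScScale.const ℝ) (Gamma n D).shift.U
        (fun y => D.form a ((Gamma n D).r y) (μ ((Gamma n D).r y))) p (L a)) →
      (∀ a, IsScDerivAt (Gamma n D).scale.shift (ScScale.const ℝ) (Gamma n D).shift.U
        (fun y => D.form a ((Gamma n D).r y) (ν ((Gamma n D).r y))) p (L' a)) →
      ∀ v ∈ (Gamma n D).tangentSpace p,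
        (Gamma n D).shift.deriv (ScScale.const ℝ) (fun x => ω x (μ x) (ν x)) p v
          = ∑ a, ∑ c, K a c * (D.form a p (μ p) * L' c v + L a v * D.form c p (ν p)) := by
    intro μ ν L L' h h' v hv
    have h1 := IsScDerivAt.sum Finset.univ fun (a : GammaIdx n k) _ => IsScDerivAt.sum Finset.univ
      fun (c : GammaIdx n k) _ => ((h a).bilin (h' c) (isScBilin_smul (ScScale.const ℝ))
        enorm_lt_top enorm_lt_top).smul (K a c)
    have e : ∀ y, ω ((Gamma n D).r y) (μ ((Gamma n D).r y)) (ν ((Gamma n D).r y))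
        = ∑ a, ∑ c, K a c * (D.form a ((Gamma n D).r y) (μ ((Gamma n D).r y))
          * D.form c ((Gamma n D).r y) (ν ((Gamma n D).r y))) := fun y => by
      rw [hω _ (D.gamma_r_mem_pts y 1), constForm_eq_sum]
    rw [D.shift_deriv_eq hp (h1.congr (g := fun y => ω ((Gamma n D).r y) (μ ((Gamma n D).r y))
      (ν ((Gamma n D).r y))) (e p).symm fun y _ => (e y).symm) hv]
    simp only [LinearMap.sum_apply, LinearMap.smul_apply, LinearMap.add_apply,
      LinearMap.comp_apply, LinearMap.flip_apply, LinearMap.lsmul_apply, smul_eq_mul, hr]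
  obtain ⟨A₀, L₀, e₀, d₀, l₀⟩ := main μ₀ h₀
  obtain ⟨A₁, L₁, e₁, d₁, l₁⟩ := main μ₁ h₁
  obtain ⟨A₂, L₂, e₂, d₂, l₂⟩ := main μ₂ h₂
  have v₀ := h₀.1 p hp1
  have v₁ := h₁.1 p hp1
  have v₂ := h₂.1 p hp1
  rw [ScRetract.extDeriv, hform _ _ _ _ d₁ d₂ _ v₀, hform _ _ _ _ d₀ d₂ _ v₁,
    hform _ _ _ _ d₀ d₁ _ v₂, hω p hp1, hω p hp1, hω p hp1, constForm_eq_sum,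
    constForm_eq_sum, constForm_eq_sum]
  simp only [ScRetract.lieBracket, e₀ _ v₁, e₀ _ v₂, e₁ _ v₀, e₁ _ v₂, e₂ _ v₀,
    e₂ _ v₁, map_sub]
  simp only [← Finset.sum_sub_distrib, ← Finset.sum_add_distrib]
  -- The cancellation pairs `(a, c)` with `(c, a)`, since it uses the skew symmetry of `K`.
  refine Finset.sum_sum_eq_zero_of_antisymm fun a c => ?_
  have hac : K a c = -K c a := by
    have := congrFun (congrFun hK c) a
    simpa using this
  rw [hac]
  simp only [l₀, l₁, l₂, hb _ _ v₀ _ v₁, hb _ _ v₀ _ v₂, hb _ _ v₁ _ v₂]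
  ring

theorem isTwoForm_of_eq {ω : GammaAmbient n → GammaAmbient n →ₗ[ℝ]
    GammaAmbient n →ₗ[ℝ] ℝ} {K : Matrix (GammaIdx n k) (GammaIdx n k) ℝ} (hK : K.transpose = -K)
    (hω : ∀ x ∈ (Gamma n D).pts 1, ∀ v w, ω x v w = D.constForm K x v w) :
    (Gamma n D).IsTwoForm ω := by
  refine ⟨fun m => (D.isSc_constForm K m).congr fun p _ =>
    (hω _ (D.gamma_r_mem_pts p.1 1) _ _).symm, fun x hx v _ => ?_⟩
  rw [hω x hx, constForm_eq_sum]
  refine Finset.sum_sum_eq_zero_of_antisymm fun a c => ?_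
  have hac : K a c = -K c a := by
    have := congrFun (congrFun hK c) a
    simpa using this
  rw [hac]
  ring

end GammaData

end

/-! ### The compatible structures on `Γₙᵏ` -/

theorem theorem3p6 (n k : ℕ) (D : GammaData k) (hX : (Gamma n D).IsEvenDimensional) :
    (Gamma n D).IsScSmoothRetract ∧
    ∃ (J : GammaAmbient n → GammaAmbient n →ₗ[ℝ] GammaAmbient n)
      (g : GammaAmbient n → GammaAmbient n →ₗ[ℝ] GammaAmbient n →ₗ[ℝ] ℝ),
      (Gamma n D).IsAlmostComplex J ∧
      (Gamma n D).IsStrongRiemannianMetric g ∧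
      (Gamma n D).IsCompatible J g ∧
      (Gamma n D).IsStrongSymplecticForm (fundamentalForm J g) := by
  obtain ⟨hn, hk⟩ := D.even_of_isEvenDimensional hX
  obtain ⟨J₀, h₀, t₀⟩ := exists_matrix_sq_neg_one (ι := Fin n ⊕ Unit) (by simpa using hn)
  obtain ⟨J₁, h₁, t₁⟩ := exists_matrix_sq_neg_one (ι := Fin k) (by simpa using hk)
  have hsq : Matrix.fromBlocks J₀ 0 0 J₁ * Matrix.fromBlocks J₀ 0 0 J₁ = -1 := by
    rw [Matrix.fromBlocks_multiply, ← Matrix.fromBlocks_one, Matrix.fromBlocks_neg]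
    simp [h₀, h₁]
  have htr : (Matrix.fromBlocks J₀ 0 0 J₁).transpose = -Matrix.fromBlocks J₀ 0 0 J₁ := by
    rw [Matrix.fromBlocks_transpose, Matrix.fromBlocks_neg, t₀, t₁]
    simp
  have htr' : (Matrix.fromBlocks J₀ 0 0 J₁).transpose.transpose
      = -(Matrix.fromBlocks J₀ 0 0 J₁).transpose := by
    rw [htr, Matrix.transpose_neg, htr]
  -- Being skew with square `-1`, the block matrix is orthogonal. This gives both the compatibility
  -- of `g` with `J` and the nondegeneracy of `ω`, whose matrix is the transpose.
  have hinv : (Matrix.fromBlocks J₀ 0 0 J₁).transpose * Matrix.fromBlocks J₀ 0 0 J₁ = 1 := by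
    rw [htr, neg_mul, hsq, neg_neg]
  have hω := fun x (hx : x ∈ (Gamma n D).pts 1) =>
    D.fundamentalForm_apply (J₀ := J₀) (J₁ := J₁) hx
  refine ⟨D.isScSmoothRetract_gamma, D.constEnd (Matrix.fromBlocks J₀ 0 0 J₁), D.constForm 1,
    D.isAlmostComplex_constEnd hsq, D.isStrongRiemannianMetric_constForm,
    fun x hx v _ w _ => ?_, D.isTwoForm_of_eq htr' hω, D.isClosedForm_of_eq htr' hω,
    D.isStronglyNondegenerate_of_eq hinv hω⟩
  rw [D.constForm_one, D.constForm_one, D.formVec_constEnd hx, D.formVec_constEnd hx,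
    Matrix.dotProduct_mulVec, Matrix.vecMul_mulVec, hinv, Matrix.vecMul_one]
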